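/- An instance $M=(G,w,s,t,r,b)$ of the time-inconsistent planning model consists of a finite acyclic digraph $G$, edge weights $w:E(G)\to\mathbb{R}_{\ge 0}$, vertices $s,t\in V(G)$, a reward $r\in\mathbb{R}_{\ge 0}$ and a salience factor $b\in\mathbb{R}_{\ge 1}$. An agent standing at a vertex $u$ evaluates a $u$-$t$ path with edges $e_1,\dots,e_p$ to cost $b\cdot w(e_1)+\sum_{i=2}^{p}w(e_i)$. If the minimum $\zeta(u)$ of this perceived cost over all $u$-$t$ paths exceeds $r$ (or there is no such path), he abandons the task; otherwise he picks nondeterministically one of the minimizing paths, traverses its first edge, and repeats, until he reaches $t$ or abandons. The instance is motivating if every possible route of the agent from $s$ leads to $t$. A subgraph $G'$ of $G$ is motivating if it contains $s$ and $t$ and the instance $(G',w|_{E(G')},s,t,r,b)$ is motivating. A branching vertex of a digraph is a vertex of out-degree at least two. The problem Simple Motivating Subgraph asks, given $M$ and an integer $k\ge 0$, whether $G$ has a motivating subgraph with at most $k$ branching vertices. Theorem. Simple Motivating Subgraph is solvable in time $(|V(G)|\cdot W)^{\mathcal{O}(k)}$ whenever all edge weights are integers and $W$ is the sum of all weights. Precisely: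 there are a single program for a deterministic random access machine with natural-number and real registers and a constant $c$ such that, on every such instance (with arbitrary real $b\ge 1$, $r\ge 0$ stored in real registers), the program halts with the correct answer after at most $\max\bigl(2,\ |V(G)|\cdot\max(1,W)\bigr)^{c\cdot\max(1,k)}$ steps; this is $(|V(G)|\cdot W)^{ck}$ whenever $k\ge 1$, $W\ge 1$ and $|V(G)|\cdot W\ge 2$. The machine adds, subtracts and compares numbers of either kind and accesses registers (indirectly addressed) in unit time; products, quotients and remainders of natural numbers, and products of a natural number with a real, cost one plus the bit lengths of the natural numbers involved; no other arithmetic is available. -/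

import Mathlib

open scoped NNReal ENNReal

/-! ### Directed graphs with explicit finite vertex and edge sets -/

/-- A finite directed graph `(V(G), E(G))` with `E(G) ⊆ V(G) × V(G)`; the vertices are elements
of the type `V`. -/
structure FinDigraph (V : Type*) where
  verts : Finset V
  edges : Finset (V × V)
  mem_verts : ∀ e ∈ edges, e.1 ∈ verts ∧ e.2 ∈ verts

namespace FinDigraph

variable {V : Type*}

/-- Acyclic: there is a topological order, i.e. an ordering of the vertices in which the first
endpoint of every edge comes strictly before the second one. -/
def IsAcyclic (G : FinDigraph V) : Prop :=
  ∃ ord : V → ℕ, Set.InjOn ord (G.verts : Set V) ∧ ∀ e ∈ G.edges, ord e.1 < ord e.2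

/-- `G'` is a subgraph of `G`. -/
def IsSubgraph (G' G : FinDigraph V) : Prop :=
  G'.verts ⊆ G.verts ∧ G'.edges ⊆ G.edges

/-- `P` is the list of vertices of a path of `G` from `u` to `v`. -/
def IsPath (G : FinDigraph V) (P : List V) (u v : V) : Prop :=
  P.head? = some u ∧ P.getLast? = some v ∧ P.Nodup ∧ (∀ x ∈ P, x ∈ G.verts) ∧
    P.IsChain (fun x y => (x, y) ∈ G.edges)

open Classical in
/-- The number of edges that have `v` as their first endpoint. -/
noncomputable def outDegree (G : FinDigraph V) (v : V) : ℕ :=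
  (G.edges.filter (fun e => e.1 = v)).card

/-- The branching vertices: those of out-degree at least two. -/
noncomputable def branching (G : FinDigraph V) : Finset V :=
  G.verts.filter (fun v => 2 ≤ G.outDegree v)

end FinDigraph

/-- The total weight of a path. -/
noncomputable def pathWeight {V : Type*} (w : V × V → ℝ≥0) : List V → ℝ≥0
  | u :: v :: P => w (u, v) + pathWeight w (v :: P)
  | _ => 0

/-- The cost of a path perceived by an agent with salience factor `b` who stands at its first
vertex: the weight of the first edge is multiplied by `b`. -/
noncomputable def perceivedPathCost {V : Type*} (b : ℝ≥0) (w : V × V → ℝ≥0) : List V → ℝ≥0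
  | u :: v :: P => b * w (u, v) + pathWeight w (v :: P)
  | _ => 0

/-! ### The time-inconsistent planning model -/

/-- An instance `(G, w, s, t, r, b)` of the time-inconsistent planning model. Only the values of
`w` on the edges of `G` matter. -/
structure PlanningModel (V : Type*) where
  G : FinDigraph V
  acyclic : G.IsAcyclic
  w : V × V → ℝ≥0
  s : V
  s_mem : s ∈ G.verts
  t : V
  t_mem : t ∈ G.verts
  r : ℝ≥0
  b : ℝ≥0
  one_le_b : 1 ≤ b

namespace PlanningModel

variable {V : Type*}

/-- The perceived cost `ζ(u)` from `u` to the target: the minimum of the perceived costs of the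
paths from `u` to `t` (infinite if there is no such path). -/
noncomputable def perceivedCost (M : PlanningModel V) (u : V) : ℝ≥0∞ :=
  ⨅ P : {P : List V // M.G.IsPath P u M.t}, (perceivedPathCost M.b M.w P.1 : ℝ≥0∞)

/-- The agent standing at `u` may traverse the edge from `u` to `v`: it is the first edge of a
path from `u` to the target of minimum perceived cost. -/
def MayMove (M : PlanningModel V) (u v : V) : Prop :=
  ∃ P : List V, M.G.IsPath (u :: v :: P) u M.t ∧
    (perceivedPathCost M.b M.w (u :: v :: P) : ℝ≥0∞) = M.perceivedCost u

/-- Whatever choices an agent standing at `u` makes, he will reach the target: either he is there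
already, or he does not abandon at `u` and each of his possible next steps leads to a vertex with
the same property. -/
inductive SurelyReaches (M : PlanningModel V) : V → Prop
  | target : SurelyReaches M M.t
  | step (u : V) (hne : u ≠ M.t) (hstay : M.perceivedCost u ≤ (M.r : ℝ≥0∞))
      (hnext : ∀ v, M.MayMove u v → SurelyReaches M v) : SurelyReaches M u

/-- The model is motivating: every possible route of the agent from `s` leads to `t`. -/
def IsMotivating (M : PlanningModel V) : Prop :=
  M.SurelyReaches M.s

/-- The model obtained by replacing the task graph by a subgraph that contains `s` and `t`. -/
def restrict (M : PlanningModel V) (G' : FinDigraph V) (h : G'.IsSubgraph M.G)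
    (hs : M.s ∈ G'.verts) (ht : M.t ∈ G'.verts) : PlanningModel V where
  G := G'
  acyclic := by
    obtain ⟨ord, hinj, hord⟩ := M.acyclic
    exact ⟨ord, hinj.mono (fun x hx => h.1 hx), fun e he => hord e (h.2 he)⟩
  w := M.w
  s := M.s
  s_mem := hs
  t := M.t
  t_mem := ht
  r := M.r
  b := M.b
  one_le_b := M.one_le_b

/-- `G'` is a motivating subgraph of the task graph of `M`. -/
def IsMotivatingSubgraph (M : PlanningModel V) (G' : FinDigraph V) : Prop :=
  ∃ (h : G'.IsSubgraph M.G) (hs : M.s ∈ G'.verts) (ht : M.t ∈ G'.verts),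
    (M.restrict G' h hs ht).IsMotivating

/-- The question of Simple Motivating Subgraph: is there a motivating subgraph with at most `k`
branching vertices? -/
def HasSimpleMotivatingSubgraph (M : PlanningModel V) (k : ℕ) : Prop :=
  ∃ G' : FinDigraph V, M.IsMotivatingSubgraph G' ∧ G'.branching.card ≤ k

end PlanningModel

/-! ### A real random access machine

There are two unbounded arrays of registers, one for natural numbers and one for real numbers;
registers are addressed indirectly through natural numbers. Addition, truncated subtraction and
comparison of natural numbers, addition, subtraction and comparison of reals, and every memory
access take one step. The operations that could make numbers grow quickly (product, quotient and
remainder of natural numbers, product of a natural number and a real) are charged the bit lengths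
of the natural numbers involved. There is no product of two reals, no rounding, and a program
contains no real constants. -/

namespace RealRAM

/-- The contents of the registers. -/
structure State where
  nat : ℕ → ℕ
  real : ℕ → ℝ

/-- Expressions with values in the natural numbers; `reg a` is the content of the register whose
address is the value of `a`. -/
inductive NatExp where
  | const (c : ℕ)
  | reg (a : NatExp)
  | add (x y : NatExp)
  | sub (x y : NatExp)
  | mul (x y : NatExp)
  | div (x y : NatExp)
  | mod (x y : NatExp)

namespace NatExp

def eval (σ : State) : NatExp → ℕ
  | const c => c
  | reg a => σ.nat (a.eval σ)
  | add x y => x.eval σ + y.eval σ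
  | sub x y => x.eval σ - y.eval σ
  | mul x y => x.eval σ * y.eval σ
  | div x y => x.eval σ / y.eval σ
  | mod x y => x.eval σ % y.eval σ

/-- The number of steps needed to evaluate an expression. -/
def cost (σ : State) : NatExp → ℕ
  | const _ => 1
  | reg a => a.cost σ + 1
  | add x y => x.cost σ + y.cost σ + 1
  | sub x y => x.cost σ + y.cost σ + 1
  | mul x y => x.cost σ + y.cost σ + 1 + (x.eval σ).size + (y.eval σ).size
  | div x y => x.cost σ + y.cost σ + 1 + (x.eval σ).size + (y.eval σ).size
  | mod x y => x.cost σ + y.cost σ + 1 + (x.eval σ).size + (y.eval σ).size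

end NatExp

/-- Expressions with real values. -/
inductive RealExp where
  | ofNat (x : NatExp)
  | reg (a : NatExp)
  | add (x y : RealExp)
  | sub (x y : RealExp)
  | smul (x : NatExp) (y : RealExp)

namespace RealExp

noncomputable def eval (σ : State) : RealExp → ℝ
  | ofNat x => (x.eval σ : ℝ)
  | reg a => σ.real (a.eval σ)
  | add x y => x.eval σ + y.eval σ
  | sub x y => x.eval σ - y.eval σ
  | smul x y => (x.eval σ : ℝ) * y.eval σ

/-- The number of steps needed to evaluate an expression. -/
def cost (σ : State) : RealExp → ℕ
  | ofNat x => x.cost σ + 1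
  | reg a => a.cost σ + 1
  | add x y => x.cost σ + y.cost σ + 1
  | sub x y => x.cost σ + y.cost σ + 1
  | smul x y => x.cost σ + y.cost σ + 1 + (x.eval σ).size

end RealExp

/-- Tests, the conditions of branchings and loops. -/
inductive Test where
  | natEq (x y : NatExp)
  | natLt (x y : NatExp)
  | realLt (x y : RealExp)
  | neg (q : Test)
  | and (q q' : Test)

namespace Test

def Holds (σ : State) : Test → Prop
  | natEq x y => x.eval σ = y.eval σ
  | natLt x y => x.eval σ < y.eval σ
  | realLt x y => x.eval σ < y.eval σ
  | neg q => ¬ q.Holds σ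
  | and q q' => q.Holds σ ∧ q'.Holds σ

/-- The number of steps needed to evaluate a test. -/
def cost (σ : State) : Test → ℕ
  | natEq x y => x.cost σ + y.cost σ + 1
  | natLt x y => x.cost σ + y.cost σ + 1
  | realLt x y => x.cost σ + y.cost σ + 1
  | neg q => q.cost σ + 1
  | and q q' => q.cost σ + q'.cost σ + 1

end Test

/-- Programs: `setNat a x` writes the value of `x` into the natural-number register whose address
is the value of `a`, and `setReal a x` does the same for real registers; `loop q p` runs `p` as
long as `q` holds. -/
inductive Prog where
  | skip
  | setNat (a x : NatExp)
  | setReal (a : NatExp) (x : RealExp)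
  | seq (p p' : Prog)
  | ite (q : Test) (p p' : Prog)
  | loop (q : Test) (p : Prog)

/-- `Exec p σ τ T`: the program `p`, started in the state `σ`, halts in the state `τ` after
exactly `T` steps. -/
inductive Exec : Prog → State → State → ℕ → Prop
  | skip (σ : State) : Exec .skip σ σ 1
  | setNat (a x : NatExp) (σ : State) :
      Exec (.setNat a x) σ { σ with nat := Function.update σ.nat (a.eval σ) (x.eval σ) }
        (a.cost σ + x.cost σ + 1)
  | setReal (a : NatExp) (x : RealExp) (σ : State) :
      Exec (.setReal a x) σ { σ with real := Function.update σ.real (a.eval σ) (x.eval σ) }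
        (a.cost σ + x.cost σ + 1)
  | seq {p p' : Prog} {σ τ υ : State} {T T' : ℕ} (h : Exec p σ τ T) (h' : Exec p' τ υ T') :
      Exec (.seq p p') σ υ (T + T')
  | ite_pos {q : Test} {p p' : Prog} {σ τ : State} {T : ℕ} (hq : q.Holds σ)
      (h : Exec p σ τ T) : Exec (.ite q p p') σ τ (q.cost σ + 1 + T)
  | ite_neg {q : Test} {p p' : Prog} {σ τ : State} {T : ℕ} (hq : ¬ q.Holds σ)
      (h : Exec p' σ τ T) : Exec (.ite q p p') σ τ (q.cost σ + 1 + T)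
  | loop_stop {q : Test} {p : Prog} {σ : State} (hq : ¬ q.Holds σ) :
      Exec (.loop q p) σ σ (q.cost σ + 1)
  | loop_step {q : Test} {p : Prog} {σ τ υ : State} {T T' : ℕ} (hq : q.Holds σ)
      (h : Exec p σ τ T) (h' : Exec (.loop q p) τ υ T') :
      Exec (.loop q p) σ υ (q.cost σ + 1 + T + T')

/-- The machine is deterministic: the final state and the number of steps are unique. -/
theorem Exec.unique {p : Prog} {σ τ τ' : State} {T T' : ℕ} (h : Exec p σ τ T)
    (h' : Exec p σ τ' T') : τ = τ' ∧ T = T' := by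
  induction h generalizing τ' T' with
  | skip σ => cases h'; exact ⟨rfl, rfl⟩
  | setNat a x σ => cases h'; exact ⟨rfl, rfl⟩
  | setReal a x σ => cases h'; exact ⟨rfl, rfl⟩
  | seq _ _ ih₁ ih₂ =>
    cases h' with
    | seq g g' =>
      obtain ⟨rfl, rfl⟩ := ih₁ g
      obtain ⟨rfl, rfl⟩ := ih₂ g'
      exact ⟨rfl, rfl⟩
  | ite_pos hq _ ih =>
    cases h' with
    | ite_pos _ g => obtain ⟨rfl, rfl⟩ := ih g; exact ⟨rfl, rfl⟩
    | ite_neg hq' _ => exact absurd hq hq'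
  | ite_neg hq _ ih =>
    cases h' with
    | ite_pos hq' _ => exact absurd hq' hq
    | ite_neg _ g => obtain ⟨rfl, rfl⟩ := ih g; exact ⟨rfl, rfl⟩
  | loop_stop hq =>
    cases h' with
    | loop_stop _ => exact ⟨rfl, rfl⟩
    | loop_step hq' _ _ => exact absurd hq' hq
  | loop_step hq _ _ ih₁ ih₂ =>
    cases h' with
    | loop_stop hq' => exact absurd hq hq'
    | loop_step _ g g' =>
      obtain ⟨rfl, rfl⟩ := ih₁ g
      obtain ⟨rfl, rfl⟩ := ih₂ g'
      exact ⟨rfl, rfl⟩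

end RealRAM

/-- The initial memory for a model `M` with vertices `0, …, n - 1`, integer edge weights `w`, the
edges being listed as `es`, and a parameter `k`. The natural-number registers hold
`n, |E(G)|, s, t, k` and then, for each edge `e = (u, v)` in turn, `u, v, w e`; the first two real
registers hold `b` and `r`; all other registers are zero. -/
noncomputable def PlanningModel.input (M : PlanningModel ℕ) (n : ℕ) (w : ℕ × ℕ → ℕ)
    (es : List (ℕ × ℕ)) (k : ℕ) : RealRAM.State where
  nat := fun i =>
    ([n, es.length, M.s, M.t, k] ++ es.flatMap (fun e => [e.1, e.2, w e])).getD i 0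
  real := fun i => ([(M.b : ℝ), (M.r : ℝ)] : List ℝ).getD i 0

/-! At a vertex `u ≠ t` of a motivating subgraph only two edges matter: the one the agent takes and
the first edge of a shortest path to `t`. If they can be chosen equal, nothing has to branch at `u`;
otherwise `u` is a branching vertex. Hence a subgraph with at most `k` branching vertices can be
explored by `k + 1` pebbles, each claiming the distance from its vertex to `t`. Pebble `0` is the
agent, and all pebbles start on `s`. Again and again all pebbles on a vertex of minimum level leave
together along one edge, except that at a branching a pebble not used so far goes along the shortest
path and from then on vouches for its length. Levels increase along edges, so a vertex that has been
left is never entered again.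

A play that ends with all pebbles on `t` yields a subgraph, built backwards from the edges used
(`PlanningModel.exists_certifies`). Conversely a simple motivating subgraph dictates a play
(`PlanningModel.Tracks.exists_move`). A position consists of `k + 1` vertices, `k + 1` distances of
at most `W` and a counter, that is, of `2 (k + 1) + 1` digits in a base `β` polynomial in `n W`. So
there are `N = β ^ (2 (k + 1) + 1)` codes, and reachability among them is tabulated in `N` layers
(`PlanningModel.hasSimpleMotivatingSubgraph_iff_layer`). The reals `b` and `r` enter only into
comparisons of numbers `w * b + d` with `r` and with each other, so they never have to be encoded.

On the machine, a fixed formula with bounded quantifiers is decided in time polynomial in a bound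
`X` for the register contents (`Decides`), and a table of reachability can be filled by such
formulas (`Computes.layers`). It remains to see that `X` is at most `max 2 (n * max 1 W)` to the
power `74 * max 1 k` (`Instance.X_le`). -/

namespace RealRAM

/-! ### Polynomial bounds for the cost of expressions -/

/-- The factor `X ^ 3 ≥ 8` leaves room for a sum of up to eight such terms, which lets `omega`
finish every cost estimate below. -/
theorem pow_bounds {X a b p q : ℕ} (hX : 2 ≤ X) (ha : a ≤ X ^ p) (hb : b ≤ X ^ q) :
    8 * a ≤ X ^ (p + q + 3) ∧ 8 * b ≤ X ^ (p + q + 3) ∧ 8 ≤ X ^ (p + q + 3) ∧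
      a * b ≤ X ^ (p + q + 3) := by
  have h8 : 8 ≤ X ^ 3 := by
    calc 8 = 2 ^ 3 := by norm_num
      _ ≤ X ^ 3 := Nat.pow_le_pow_left hX 3
  have h1 : ∀ j, 1 ≤ X ^ j := fun j => Nat.one_le_pow _ _ (by omega)
  have e : X ^ (p + q + 3) = X ^ 3 * (X ^ p * X ^ q) := by ring
  have hp : X ^ p ≤ X ^ p * X ^ q := Nat.le_mul_of_pos_right _ (h1 q)
  have hq : X ^ q ≤ X ^ p * X ^ q := Nat.le_mul_of_pos_left _ (h1 p)
  rw [e]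
  refine ⟨Nat.mul_le_mul h8 (ha.trans hp), Nat.mul_le_mul h8 (hb.trans hq), ?_, ?_⟩
  · calc 8 = 8 * 1 := by norm_num
      _ ≤ _ := Nat.mul_le_mul h8 ((h1 p).trans hp)
  · calc a * b ≤ X ^ p * X ^ q := Nat.mul_le_mul ha hb
      _ ≤ _ := Nat.le_mul_of_pos_left _ (h1 3)

theorem size_le_self (a : ℕ) : a.size ≤ a := Nat.size_le.2 Nat.lt_two_pow_self

/-- The exponent depends on the expression alone. Bit lengths are estimated by the values
themselves, which is affordable because values are polynomial in `X`. -/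
theorem NatExp.exists_bound (e : NatExp) : ∃ q, ∀ (X : ℕ) (σ : State), 2 ≤ X →
    (∀ j, σ.nat j ≤ X) → e.eval σ ≤ X ^ q ∧ e.cost σ ≤ X ^ q := by
  induction e with
  | const c =>
    refine ⟨c, fun X σ hX _ => ⟨?_, Nat.one_le_pow _ _ (by omega)⟩⟩
    exact (Nat.lt_two_pow_self (n := c)).le.trans (Nat.pow_le_pow_left hX c)
  | reg a ih =>
    obtain ⟨q, h⟩ := ih
    refine ⟨q + 0 + 3, fun X σ hX hσ => ?_⟩
    obtain ⟨h1, h2⟩ := h X σ hX hσ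
    obtain ⟨b1, b2, b3, b4⟩ := pow_bounds (q := 0) hX h2 (b := 1) (by simp)
    refine ⟨(hσ _).trans (Nat.le_self_pow (by omega) X), ?_⟩
    simp only [cost]; omega
  | add x y ihx ihy | sub x y ihx ihy | mul x y ihx ihy | div x y ihx ihy | mod x y ihx ihy =>
    obtain ⟨p, hx⟩ := ihx
    obtain ⟨q, hy⟩ := ihy
    refine ⟨p + q + 3, fun X σ hX hσ => ?_⟩
    obtain ⟨h1, h2⟩ := hx X σ hX hσ
    obtain ⟨h3, h4⟩ := hy X σ hX hσ
    obtain ⟨b1, b2, b3, b4⟩ := pow_bounds hX h1 h3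
    obtain ⟨c1, c2, c3, c4⟩ := pow_bounds hX h2 h4
    have s1 := size_le_self (x.eval σ)
    have s2 := size_le_self (y.eval σ)
    have s3 := Nat.div_le_self (x.eval σ) (y.eval σ)
    have s4 := Nat.mod_le (x.eval σ) (y.eval σ)
    simp only [eval, cost]
    constructor <;> omega

theorem RealExp.exists_bound (e : RealExp) : ∃ q, ∀ (X : ℕ) (σ : State), 2 ≤ X →
    (∀ j, σ.nat j ≤ X) → e.cost σ ≤ X ^ q := by
  induction e with
  | ofNat a | reg a =>
    obtain ⟨q, h⟩ := a.exists_bound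
    refine ⟨q + 0 + 3, fun X σ hX hσ => ?_⟩
    obtain ⟨h1, h2⟩ := h X σ hX hσ
    obtain ⟨b1, b2, b3, b4⟩ := pow_bounds (q := 0) hX h2 (b := 1) (by simp)
    simp only [cost]; omega
  | add x y ihx ihy | sub x y ihx ihy =>
    obtain ⟨p, hx⟩ := ihx
    obtain ⟨q, hy⟩ := ihy
    refine ⟨p + q + 3, fun X σ hX hσ => ?_⟩
    obtain ⟨c1, c2, c3, c4⟩ := pow_bounds hX (hx X σ hX hσ) (hy X σ hX hσ)
    simp only [cost]; omega
  | smul x y ihy =>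
    obtain ⟨p, hx⟩ := x.exists_bound
    obtain ⟨q, hy⟩ := ihy
    refine ⟨p + q + 3, fun X σ hX hσ => ?_⟩
    obtain ⟨h1, h2⟩ := hx X σ hX hσ
    obtain ⟨b1, -⟩ := pow_bounds hX h1 (hy X σ hX hσ)
    obtain ⟨c1, c2, c3, c4⟩ := pow_bounds hX h2 (hy X σ hX hσ)
    have s1 := size_le_self (x.eval σ)
    simp only [cost]; omega

theorem Test.exists_bound (t : Test) : ∃ q, ∀ (X : ℕ) (σ : State), 2 ≤ X →
    (∀ j, σ.nat j ≤ X) → t.cost σ ≤ X ^ q := by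
  induction t with
  | natEq x y | natLt x y =>
    obtain ⟨p, hx⟩ := x.exists_bound
    obtain ⟨q, hy⟩ := y.exists_bound
    refine ⟨p + q + 3, fun X σ hX hσ => ?_⟩
    obtain ⟨c1, c2, c3, c4⟩ := pow_bounds hX (hx X σ hX hσ).2 (hy X σ hX hσ).2
    simp only [cost]; omega
  | realLt x y =>
    obtain ⟨p, hx⟩ := x.exists_bound
    obtain ⟨q, hy⟩ := y.exists_bound
    refine ⟨p + q + 3, fun X σ hX hσ => ?_⟩
    obtain ⟨c1, c2, c3, c4⟩ := pow_bounds hX (hx X σ hX hσ) (hy X σ hX hσ)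
    simp only [cost]; omega
  | neg t ih =>
    obtain ⟨q, h⟩ := ih
    refine ⟨q + 0 + 3, fun X σ hX hσ => ?_⟩
    obtain ⟨b1, b2, b3, b4⟩ := pow_bounds (q := 0) hX (h X σ hX hσ) (b := 1) (by simp)
    simp only [cost]; omega
  | and x y ihx ihy =>
    obtain ⟨p, hx⟩ := ihx
    obtain ⟨q, hy⟩ := ihy
    refine ⟨p + q + 3, fun X σ hX hσ => ?_⟩
    obtain ⟨c1, c2, c3, c4⟩ := pow_bounds hX (hx X σ hX hσ) (hy X σ hX hσ)
    simp only [cost]; omega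

/-! ### Uniform computations -/

/-- One program takes every state `σ i` to `τ i`, in time polynomial in `X i`. -/
def Computes {ι : Type*} (X : ι → ℕ) (σ τ : ι → State) : Prop :=
  ∃ (p : Prog) (q : ℕ), ∀ i, ∃ T, T ≤ X i ^ q ∧ Exec p (σ i) (τ i) T

namespace Computes

variable {ι : Type*} {X : ι → ℕ}

theorem trans (hX : ∀ i, 2 ≤ X i) {σ τ υ : ι → State} (h : Computes X σ τ)
    (h' : Computes X τ υ) : Computes X σ υ := by
  obtain ⟨p, q, h⟩ := h
  obtain ⟨p', q', h'⟩ := h'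
  refine ⟨.seq p p', q + q' + 3, fun i => ?_⟩
  obtain ⟨T, hT, e⟩ := h i
  obtain ⟨T', hT', e'⟩ := h' i
  obtain ⟨b1, b2, -⟩ := pow_bounds (hX i) hT hT'
  exact ⟨T + T', by omega, .seq e e'⟩

theorem refl (σ : ι → State) : Computes X σ σ :=
  ⟨.skip, 0, fun i => ⟨1, by simp, .skip _⟩⟩

theorem comp {κ : Type*} {σ τ : ι → State} (h : Computes X σ τ) (f : κ → ι) :
    Computes (fun j => X (f j)) (fun j => σ (f j)) (fun j => τ (f j)) := by
  obtain ⟨p, q, h⟩ := h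
  exact ⟨p, q, fun j => h (f j)⟩

theorem congr {σ τ σ' τ' : ι → State} (h : Computes X σ τ) (hσ : ∀ i, σ i = σ' i)
    (hτ : ∀ i, τ i = τ' i) : Computes X σ' τ' := by
  obtain rfl : σ = σ' := funext hσ
  obtain rfl : τ = τ' := funext hτ
  exact h

theorem setNat (hX : ∀ i, 2 ≤ X i) {σ : ι → State} (hσ : ∀ i j, (σ i).nat j ≤ X i)
    (a x : NatExp) : Computes X σ (fun i => { σ i with
      nat := Function.update (σ i).nat (a.eval (σ i)) (x.eval (σ i)) }) := by
  obtain ⟨p, ha⟩ := a.exists_bound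
  obtain ⟨q, hx⟩ := x.exists_bound
  refine ⟨.setNat a x, p + q + 3, fun i => ⟨_, ?_, .setNat a x (σ i)⟩⟩
  obtain ⟨b1, b2, b3, -⟩ := pow_bounds (hX i) (ha _ _ (hX i) (hσ i)).2 (hx _ _ (hX i) (hσ i)).2
  omega

/-- Each branch has to be correct only for the states that reach it, hence the subfamilies indexed
by subtypes. -/
theorem ite (hX : ∀ i, 2 ≤ X i) {σ τ : ι → State} (hσ : ∀ i j, (σ i).nat j ≤ X i) (t : Test)
    (h : Computes (fun i : {i // t.Holds (σ i)} => X i) (fun i => σ i) (fun i => τ i))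
    (h' : Computes (fun i : {i // ¬ t.Holds (σ i)} => X i) (fun i => σ i) (fun i => τ i)) :
    Computes X σ τ := by
  obtain ⟨p, q, h⟩ := h
  obtain ⟨p', q', h'⟩ := h'
  obtain ⟨s, ht⟩ := t.exists_bound
  refine ⟨.ite t p p', s + (q + q' + 3) + 3, fun i => ?_⟩
  have hc := ht _ _ (hX i) (hσ i)
  by_cases hi : t.Holds (σ i)
  · obtain ⟨T, hT, e⟩ := h ⟨i, hi⟩
    obtain ⟨c1, -⟩ := pow_bounds (hX i) hT (b := 1) (q := q') (Nat.one_le_pow _ _ (by have := hX i; omega))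
    obtain ⟨b1, b2, b3, -⟩ := pow_bounds (hX i) hc (show T ≤ _ from le_trans (by omega) c1)
    exact ⟨_, by omega, .ite_pos hi e⟩
  · obtain ⟨T, hT, e⟩ := h' ⟨i, hi⟩
    obtain ⟨-, c1, -⟩ := pow_bounds (hX i) (a := 1) (p := q) (Nat.one_le_pow _ _ (by have := hX i; omega)) hT
    obtain ⟨b1, b2, b3, -⟩ := pow_bounds (hX i) hc (show T ≤ _ from le_trans (by omega) c1)
    exact ⟨_, by omega, .ite_neg hi e⟩

/-- A loop whose body runs through the states `σ i 0`, …, `σ i (B i)`. -/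
theorem loop (hX : ∀ i, 2 ≤ X i) (σ : ι → ℕ → State) (B : ι → ℕ) (hB : ∀ i, B i ≤ X i)
    (hσ : ∀ i a, a ≤ B i → ∀ j, (σ i a).nat j ≤ X i) (t : Test)
    (ht : ∀ i a, a ≤ B i → (t.Holds (σ i a) ↔ a < B i))
    (h : Computes (fun x : {x : ι × ℕ // x.2 < B x.1} => X x.1.1) (fun x => σ x.1.1 x.1.2)
      (fun x => σ x.1.1 (x.1.2 + 1))) :
    Computes X (fun i => σ i 0) (fun i => σ i (B i)) := by
  obtain ⟨p, q, h⟩ := h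
  obtain ⟨s, hs⟩ := t.exists_bound
  -- `X ^ (s + q + 3)` pays for one round, and the other four factors `X` for the `B i + 1`
  -- evaluations of the test.
  refine ⟨.loop t p, 1 + (s + q + 3) + 3, fun i => ?_⟩
  have key : ∀ j a, a + j = B i → ∃ T, T ≤ (j + 1) * X i ^ (s + q + 3) ∧
      Exec (.loop t p) (σ i a) (σ i (B i)) T := by
    intro j
    induction j with
    | zero =>
      intro a ha
      obtain rfl : a = B i := by omega
      refine ⟨_, ?_, Exec.loop_stop (fun hc => absurd ((ht i _ le_rfl).1 hc) (lt_irrefl _))⟩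
      obtain ⟨b1, b2, b3, -⟩ := pow_bounds (hX i) (hs _ _ (hX i) (hσ i _ le_rfl)) (b := 1) (q := q)
        (Nat.one_le_pow _ _ (by have := hX i; omega))
      omega
    | succ j ih =>
      intro a ha
      obtain ⟨T', hT', e'⟩ := ih (a + 1) (by omega)
      obtain ⟨T, hT, e⟩ := h ⟨(i, a), by simp; omega⟩
      refine ⟨_, ?_, .loop_step ((ht i a (by omega)).2 (by omega)) e e'⟩
      obtain ⟨b1, b2, b3, -⟩ := pow_bounds (hX i) (hs _ _ (hX i) (hσ i a (by omega))) hT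
      have : (j + 1 + 1) * X i ^ (s + q + 3) = (j + 1) * X i ^ (s + q + 3) + X i ^ (s + q + 3) := by
        ring
      omega
  obtain ⟨T, hT, e⟩ := key (B i) 0 (by omega)
  refine ⟨T, hT.trans ?_, e⟩
  have hXi := hX i
  calc (B i + 1) * X i ^ (s + q + 3) ≤ (X i ^ 3 * X i) * X i ^ (s + q + 3) := by
        refine Nat.mul_le_mul_right _ ?_
        have := hB i
        have : 8 ≤ X i ^ 3 := by
          calc 8 = 2 ^ 3 := by norm_num
            _ ≤ X i ^ 3 := Nat.pow_le_pow_left hXi 3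
        nlinarith
    _ = _ := by ring

end Computes

/-! ### Structured memory -/

/-- The input region of the memory, the real registers, and named arrays of natural numbers. -/
structure Ctx where
  nat : ℕ → ℕ
  real : ℕ → ℝ
  arr : ℕ → ℕ → ℕ

namespace Ctx

/-- The first address behind the input region. -/
def base (c : Ctx) : ℕ := 5 + 3 * c.nat 1

/-- Replace the array named `a`. -/
def set (c : Ctx) (a : ℕ) (f : ℕ → ℕ) : Ctx := { c with arr := Function.update c.arr a f }

@[simp] theorem set_arr_self (c : Ctx) (a : ℕ) (f : ℕ → ℕ) : (c.set a f).arr a = f := by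
  simp [set]
theorem set_arr_of_ne (c : Ctx) {a a' : ℕ} (h : a' ≠ a) (f : ℕ → ℕ) :
    (c.set a f).arr a' = c.arr a' := by simp [set, h]
@[simp] theorem set_set (c : Ctx) (a : ℕ) (f g : ℕ → ℕ) : (c.set a f).set a g = c.set a g := by
  simp [set]
@[simp] theorem set_self (c : Ctx) (a : ℕ) : c.set a (c.arr a) = c := by simp [set]

end Ctx

/-- The content of position `i` of the array `a`; array `0` holds a single flag `d`, and array `1`
the variables `ρ`. -/
def cell (c : Ctx) {ℓ : ℕ} (ρ : Fin ℓ → ℕ) (d a i : ℕ) : ℕ :=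
  if a = 0 then (if i = 0 then d else 0)
  else if a = 1 then (if h : i < ℓ then ρ ⟨i, h⟩ else 0) else c.arr a i

/-- The memory in which the arrays follow the input region, interleaved. -/
def memory (c : Ctx) {ℓ : ℕ} (ρ : Fin ℓ → ℕ) (d : ℕ) : State where
  nat j := if j < c.base then c.nat j else cell c ρ d ((j - c.base) % 8) ((j - c.base) / 8)
  real := c.real

section

variable (c : Ctx) {ℓ : ℕ} (ρ : Fin ℓ → ℕ) (d : ℕ)

theorem memory_nat_of_lt {j : ℕ} (h : j < c.base) : (memory c ρ d).nat j = c.nat j := by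
  simp [memory, h]

theorem memory_nat_cell {a : ℕ} (ha : a < 8) (i : ℕ) :
    (memory c ρ d).nat (c.base + a + 8 * i) = cell c ρ d a i := by
  have h1 : c.base + a + 8 * i - c.base = a + 8 * i := by omega
  have h2 : ¬ c.base + a + 8 * i < c.base := by omega
  have h3 : (a + 8 * i) % 8 = a := by omega
  have h4 : (a + 8 * i) / 8 = i := by omega
  simp [memory, h1, h2, h3, h4]

theorem memory_update {c' : Ctx} {ℓ' : ℕ} {ρ' : Fin ℓ' → ℕ} {d' a₀ i₀ v : ℕ} (ha : a₀ < 8)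
    (hn : c'.nat = c.nat) (hr : c'.real = c.real)
    (h : ∀ a i, cell c' ρ' d' a i = if a = a₀ ∧ i = i₀ then v else cell c ρ d a i) :
    ({ memory c ρ d with
      nat := Function.update (memory c ρ d).nat (c.base + a₀ + 8 * i₀) v } : State) =
      memory c' ρ' d' := by
  have hb : c'.base = c.base := by simp [Ctx.base, hn]
  unfold memory
  simp only [hr, State.mk.injEq, and_true]
  funext j
  by_cases hj : j < c.base
  · have : j ≠ c.base + a₀ + 8 * i₀ := by omega
    simp [hb, hj, hn, Function.update_of_ne this]
  · simp only [hb, hj, if_false, h]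
    by_cases hj' : j = c.base + a₀ + 8 * i₀
    · subst hj'
      rw [Function.update_self, if_pos]
      omega
    · have hne : ¬ ((j - c.base) % 8 = a₀ ∧ (j - c.base) / 8 = i₀) := by omega
      rw [Function.update_of_ne hj', if_neg hne]
      simp [hj]

/-- A variable with value `0` cannot be told from an absent one, so the scope of a quantifier opens
without any instruction and closes by resetting the variable. -/
theorem memory_succ : memory c (Fin.snoc (α := fun _ => ℕ) ρ 0) d = memory c ρ d := by
  unfold memory
  congr 1
  funext j
  split_ifs with hj
  · rfl
  · unfold cell
    split_ifs with h1 h2 h3 h4 h5 h6 <;> try rfl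
    · simp [Fin.snoc, h5]
    · simp [Fin.snoc, h5]
    · omega

end

/-- All registers hold numbers of at most `X`. -/
structure Bounded (X : ℕ) (c : Ctx) {ℓ : ℕ} (ρ : Fin ℓ → ℕ) : Prop where
  two_le : 2 ≤ X
  nat : ∀ j, c.nat j ≤ X
  arr : ∀ a i, c.arr a i ≤ X
  var : ∀ i, ρ i ≤ X

theorem Bounded.memory_le {X : ℕ} {c : Ctx} {ℓ : ℕ} {ρ : Fin ℓ → ℕ} (h : Bounded X c ρ) {d : ℕ}
    (hd : d ≤ 1) (j : ℕ) : (memory c ρ d).nat j ≤ X := by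
  have := h.two_le
  unfold memory cell
  dsimp only
  split_ifs
  · exact h.nat j
  · omega
  · omega
  · exact h.var _
  · omega
  · exact h.arr _ _

theorem Bounded.snoc {X : ℕ} {c : Ctx} {ℓ : ℕ} {ρ : Fin ℓ → ℕ} (h : Bounded X c ρ) {a : ℕ}
    (ha : a ≤ X) : Bounded X c (Fin.snoc (α := fun _ => ℕ) ρ a) where
  two_le := h.two_le
  nat := h.nat
  arr := h.arr
  var i := by
    refine Fin.lastCases ?_ (fun i => ?_) i
    · simpa using ha
    · simpa using h.var i

/-! ### Terms -/

/-- The first address behind the input region. -/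
def baseExp : NatExp := .add (.const 5) (.mul (.const 3) (.reg (.const 1)))

theorem baseExp_eval (c : Ctx) {ℓ : ℕ} (ρ : Fin ℓ → ℕ) (d : ℕ) :
    baseExp.eval (memory c ρ d) = c.base := by
  simp only [baseExp, NatExp.eval]
  rw [memory_nat_of_lt _ _ _ (by unfold Ctx.base; omega)]
  rfl

/-- The address of position `i` of the array `a`. -/
def addrExp (a : ℕ) (i : NatExp) : NatExp := .add (.add baseExp (.const a)) (.mul (.const 8) i)

theorem addrExp_eval (c : Ctx) {ℓ : ℕ} (ρ : Fin ℓ → ℕ) (d a : ℕ) (i : NatExp) :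
    (addrExp a i).eval (memory c ρ d) = c.base + a + 8 * i.eval (memory c ρ d) := by
  simp [addrExp, NatExp.eval, baseExp_eval]

/-- `f` is the value of an expression. -/
def Term (ℓ : ℕ) (f : Ctx → (Fin ℓ → ℕ) → ℕ) : Prop :=
  ∃ e : NatExp, ∀ c ρ d, e.eval (memory c ρ d) = f c ρ

namespace Term

variable {ℓ : ℕ} {f g : Ctx → (Fin ℓ → ℕ) → ℕ}

theorem const (a : ℕ) : Term ℓ (fun _ _ => a) := ⟨.const a, fun _ _ _ => rfl⟩

theorem add (hf : Term ℓ f) (hg : Term ℓ g) : Term ℓ (fun c ρ => f c ρ + g c ρ) := by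
  obtain ⟨e, he⟩ := hf
  obtain ⟨e', he'⟩ := hg
  exact ⟨.add e e', fun c ρ d => by simp [NatExp.eval, he, he']⟩

theorem sub (hf : Term ℓ f) (hg : Term ℓ g) : Term ℓ (fun c ρ => f c ρ - g c ρ) := by
  obtain ⟨e, he⟩ := hf
  obtain ⟨e', he'⟩ := hg
  exact ⟨.sub e e', fun c ρ d => by simp [NatExp.eval, he, he']⟩

theorem mul (hf : Term ℓ f) (hg : Term ℓ g) : Term ℓ (fun c ρ => f c ρ * g c ρ) := by
  obtain ⟨e, he⟩ := hf
  obtain ⟨e', he'⟩ := hg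
  exact ⟨.mul e e', fun c ρ d => by simp [NatExp.eval, he, he']⟩

theorem div (hf : Term ℓ f) (hg : Term ℓ g) : Term ℓ (fun c ρ => f c ρ / g c ρ) := by
  obtain ⟨e, he⟩ := hf
  obtain ⟨e', he'⟩ := hg
  exact ⟨.div e e', fun c ρ d => by simp [NatExp.eval, he, he']⟩

theorem mod (hf : Term ℓ f) (hg : Term ℓ g) : Term ℓ (fun c ρ => f c ρ % g c ρ) := by
  obtain ⟨e, he⟩ := hf
  obtain ⟨e', he'⟩ := hg
  exact ⟨.mod e e', fun c ρ d => by simp [NatExp.eval, he, he']⟩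

theorem var (i : Fin ℓ) : Term ℓ (fun _ ρ => ρ i) :=
  ⟨.reg (addrExp 1 (.const i)), fun c ρ d => by
    simp only [NatExp.eval, addrExp_eval]
    rw [memory_nat_cell _ _ _ (by norm_num)]
    simp [cell]⟩

theorem arr (a : ℕ) (ha : 2 ≤ a ∧ a < 8) (hf : Term ℓ f) : Term ℓ (fun c ρ => c.arr a (f c ρ)) := by
  obtain ⟨e, he⟩ := hf
  refine ⟨.reg (addrExp a e), fun c ρ d => ?_⟩
  simp only [NatExp.eval, addrExp_eval]
  rw [memory_nat_cell _ _ _ ha.2, he]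
  simp [cell, show a ≠ 0 by omega, show a ≠ 1 by omega]

/-- Only these registers lie in the input region of every context; the length of the edge list
varies. -/
theorem inp (j : ℕ) (hj : j < 5) : Term ℓ (fun c _ => c.nat j) :=
  ⟨.reg (.const j), fun c ρ d => by
    simp only [NatExp.eval]
    rw [memory_nat_of_lt]
    unfold Ctx.base
    omega⟩

end Term

/-- `f` is the value of an expression. -/
def RealTerm (ℓ : ℕ) (f : Ctx → (Fin ℓ → ℕ) → ℝ) : Prop :=
  ∃ e : RealExp, ∀ c ρ d, e.eval (memory c ρ d) = f c ρ

namespace RealTerm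

variable {ℓ : ℕ}

theorem ofNat {f : Ctx → (Fin ℓ → ℕ) → ℕ} (hf : Term ℓ f) :
    RealTerm ℓ (fun c ρ => (f c ρ : ℝ)) := by
  obtain ⟨e, he⟩ := hf
  exact ⟨.ofNat e, fun c ρ d => by simp [RealExp.eval, he]⟩

theorem inp (j : ℕ) : RealTerm ℓ (fun c _ => c.real j) := ⟨.reg (.const j), fun _ _ _ => rfl⟩

theorem add {f g : Ctx → (Fin ℓ → ℕ) → ℝ} (hf : RealTerm ℓ f) (hg : RealTerm ℓ g) :
    RealTerm ℓ (fun c ρ => f c ρ + g c ρ) := by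
  obtain ⟨e, he⟩ := hf
  obtain ⟨e', he'⟩ := hg
  exact ⟨.add e e', fun c ρ d => by simp [RealExp.eval, he, he']⟩

theorem smul {f : Ctx → (Fin ℓ → ℕ) → ℕ} {g : Ctx → (Fin ℓ → ℕ) → ℝ} (hf : Term ℓ f)
    (hg : RealTerm ℓ g) : RealTerm ℓ (fun c ρ => (f c ρ : ℝ) * g c ρ) := by
  obtain ⟨e, he⟩ := hf
  obtain ⟨e', he'⟩ := hg
  exact ⟨.smul e e', fun c ρ d => by simp [RealExp.eval, he, he']⟩

end RealTerm

/-! ### Formulas with bounded quantifiers -/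

/-- A memory with all its entries bounded. -/
structure Snapshot (ℓ : ℕ) where
  X : ℕ
  c : Ctx
  ρ : Fin ℓ → ℕ
  bounded : Bounded X c ρ

open Classical in
/-- Some program writes the truth value of `φ` into the flag. -/
def Decides (ℓ : ℕ) (φ : Ctx → (Fin ℓ → ℕ) → Prop) : Prop :=
  Computes (fun s : Snapshot ℓ => s.X) (fun s => memory s.c s.ρ 0)
    (fun s => memory s.c s.ρ (if φ s.c s.ρ then 1 else 0))

/-- Writing into the flag. -/
theorem Computes.setFlag {ι : Type*} {X : ι → ℕ} {ℓ : ℕ} {c : ι → Ctx} {ρ : ι → Fin ℓ → ℕ}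
    {d : ι → ℕ} (hb : ∀ i, Bounded (X i) (c i) (ρ i)) (hd : ∀ i, d i ≤ 1) (x : NatExp)
    {v : ι → ℕ} (hx : ∀ i, x.eval (memory (c i) (ρ i) (d i)) = v i) :
    Computes X (fun i => memory (c i) (ρ i) (d i)) (fun i => memory (c i) (ρ i) (v i)) := by
  refine (Computes.setNat (fun i => (hb i).two_le) (fun i => (hb i).memory_le (hd i))
    (addrExp 0 (.const 0)) x).congr (fun _ => rfl) (fun i => ?_)
  simp only [addrExp_eval, hx, NatExp.eval]
  refine memory_update _ _ _ (by norm_num) rfl rfl (fun a j => ?_)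
  by_cases ha : a = 0 <;> by_cases hj : j = 0 <;> simp [cell, ha, hj]

/-- Writing into the last variable. -/
theorem Computes.setVar {ι : Type*} {X : ι → ℕ} {ℓ : ℕ} {c : ι → Ctx} {ρ : ι → Fin ℓ → ℕ}
    {u : ι → ℕ} {d : ι → ℕ}
    (hb : ∀ i, Bounded (X i) (c i) (Fin.snoc (α := fun _ => ℕ) (ρ i) (u i)))
    (hd : ∀ i, d i ≤ 1) (x : NatExp) {v : ι → ℕ}
    (hx : ∀ i, x.eval (memory (c i) (Fin.snoc (α := fun _ => ℕ) (ρ i) (u i)) (d i)) = v i) :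
    Computes X (fun i => memory (c i) (Fin.snoc (α := fun _ => ℕ) (ρ i) (u i)) (d i))
      (fun i => memory (c i) (Fin.snoc (α := fun _ => ℕ) (ρ i) (v i)) (d i)) := by
  refine (Computes.setNat (fun i => (hb i).two_le) (fun i => (hb i).memory_le (hd i))
    (addrExp 1 (.const ℓ)) x).congr (fun _ => rfl) (fun i => ?_)
  simp only [addrExp_eval, hx, NatExp.eval]
  refine memory_update _ _ _ (by norm_num) rfl rfl (fun a j => ?_)
  by_cases ha : a = 1
  · subst ha
    rcases lt_trichotomy j ℓ with hj | hj | hj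
    · simp [cell, hj.ne, Fin.snoc, hj]
    · subst hj; simp [cell, Fin.snoc]
    · simp [cell, hj.ne', show ¬ j < ℓ + 1 by omega]
  · simp [cell, ha]

/-- Writing into an array. -/
theorem Computes.setArr {ι : Type*} {X : ι → ℕ} {ℓ : ℕ} {c : ι → Ctx} {ρ : ι → Fin ℓ → ℕ}
    {d : ι → ℕ} (hb : ∀ i, Bounded (X i) (c i) (ρ i)) (hd : ∀ i, d i ≤ 1) (a : ℕ)
    (ha : 2 ≤ a ∧ a < 8) (j x : NatExp) {k v : ι → ℕ}
    (hj : ∀ i, j.eval (memory (c i) (ρ i) (d i)) = k i)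
    (hx : ∀ i, x.eval (memory (c i) (ρ i) (d i)) = v i) :
    Computes X (fun i => memory (c i) (ρ i) (d i)) (fun i =>
      memory ((c i).set a (Function.update ((c i).arr a) (k i) (v i))) (ρ i) (d i)) := by
  refine (Computes.setNat (fun i => (hb i).two_le) (fun i => (hb i).memory_le (hd i))
    (addrExp a j) x).congr (fun _ => rfl) (fun i => ?_)
  simp only [addrExp_eval, hx, hj]
  refine memory_update _ _ _ ha.2 rfl rfl (fun b m => ?_)
  by_cases hb0 : b = 0
  · simp [cell, hb0, show 0 ≠ a by omega]
  by_cases hb1 : b = 1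
  · simp [cell, hb1, show 1 ≠ a by omega]
  by_cases hba : b = a
  · subst hba
    by_cases hm : m = k i <;> simp [cell, hb0, hb1, hm]
  · simp [cell, hb0, hb1, hba, Ctx.set_arr_of_ne]

/-- The flag. -/
def flagExp : NatExp := .reg (addrExp 0 (.const 0))

theorem flagExp_eval (c : Ctx) {ℓ : ℕ} (ρ : Fin ℓ → ℕ) (d : ℕ) :
    flagExp.eval (memory c ρ d) = d := by
  simp only [flagExp, NatExp.eval, addrExp_eval]
  rw [memory_nat_cell _ _ _ (by norm_num)]
  simp [cell]

/-- The last variable. -/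
def lastExp (ℓ : ℕ) : NatExp := .reg (addrExp 1 (.const ℓ))

theorem lastExp_eval (c : Ctx) {ℓ : ℕ} (ρ : Fin ℓ → ℕ) (a d : ℕ) :
    (lastExp ℓ).eval (memory c (Fin.snoc (α := fun _ => ℕ) ρ a) d) = a := by
  simp only [lastExp, NatExp.eval, addrExp_eval]
  rw [memory_nat_cell _ _ _ (by norm_num)]
  simp [cell, Fin.snoc]

namespace Decides

variable {ℓ : ℕ} {φ ψ : Ctx → (Fin ℓ → ℕ) → Prop}

theorem congr (h : Decides ℓ φ) (he : ∀ c ρ, φ c ρ ↔ ψ c ρ) : Decides ℓ ψ := by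
  obtain rfl : φ = ψ := by funext c ρ; exact propext (he c ρ)
  exact h

theorem of_test (t : Test) (h : ∀ c ρ, t.Holds (memory c ρ 0) ↔ φ c ρ) : Decides ℓ φ := by
  classical
  refine Computes.ite (fun s => s.bounded.two_le)
    (fun s => s.bounded.memory_le (by norm_num)) t ?_ ?_
  · refine (Computes.setFlag (fun s => s.1.bounded) (fun _ => zero_le_one) (.const 1)
      (v := fun _ => 1) (fun _ => rfl)).congr (fun _ => rfl) (fun s => ?_)
    rw [if_pos ((h _ _).1 s.2)]
  · refine (Computes.refl _).congr (fun _ => rfl) (fun s => ?_)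
    rw [if_neg (fun hc => s.2 ((h _ _).2 hc))]

theorem eq {f g : Ctx → (Fin ℓ → ℕ) → ℕ} (hf : Term ℓ f) (hg : Term ℓ g) :
    Decides ℓ (fun c ρ => f c ρ = g c ρ) := by
  obtain ⟨e, he⟩ := hf
  obtain ⟨e', he'⟩ := hg
  exact of_test (.natEq e e') (fun c ρ => by simp [Test.Holds, he, he'])

theorem lt {f g : Ctx → (Fin ℓ → ℕ) → ℕ} (hf : Term ℓ f) (hg : Term ℓ g) :
    Decides ℓ (fun c ρ => f c ρ < g c ρ) := by
  obtain ⟨e, he⟩ := hf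
  obtain ⟨e', he'⟩ := hg
  exact of_test (.natLt e e') (fun c ρ => by simp [Test.Holds, he, he'])

theorem le {f g : Ctx → (Fin ℓ → ℕ) → ℕ} (hf : Term ℓ f) (hg : Term ℓ g) :
    Decides ℓ (fun c ρ => f c ρ ≤ g c ρ) := by
  obtain ⟨e, he⟩ := hf
  obtain ⟨e', he'⟩ := hg
  exact of_test (.neg (.natLt e' e)) (fun c ρ => by simp [Test.Holds, he, he'])

theorem real_lt {f g : Ctx → (Fin ℓ → ℕ) → ℝ} (hf : RealTerm ℓ f) (hg : RealTerm ℓ g) :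
    Decides ℓ (fun c ρ => f c ρ < g c ρ) := by
  obtain ⟨e, he⟩ := hf
  obtain ⟨e', he'⟩ := hg
  exact of_test (.realLt e e') (fun c ρ => by simp [Test.Holds, he, he'])

theorem real_le {f g : Ctx → (Fin ℓ → ℕ) → ℝ} (hf : RealTerm ℓ f) (hg : RealTerm ℓ g) :
    Decides ℓ (fun c ρ => f c ρ ≤ g c ρ) := by
  obtain ⟨e, he⟩ := hf
  obtain ⟨e', he'⟩ := hg
  exact of_test (.neg (.realLt e' e)) (fun c ρ => by simp [Test.Holds, he, he'])

theorem not (h : Decides ℓ φ) : Decides ℓ (fun c ρ => ¬ φ c ρ) := by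
  classical
  refine Computes.trans (fun s => s.bounded.two_le) h ?_
  refine Computes.setFlag (fun s => s.bounded) (fun s => by split_ifs <;> norm_num)
    (.sub (.const 1) flagExp) (fun s => ?_)
  simp only [NatExp.eval, flagExp_eval]
  split_ifs <;> simp_all

theorem and (h : Decides ℓ φ) (h' : Decides ℓ ψ) : Decides ℓ (fun c ρ => φ c ρ ∧ ψ c ρ) := by
  classical
  refine Computes.trans (fun s => s.bounded.two_le) h ?_
  have hd : ∀ s : Snapshot ℓ, (if φ s.c s.ρ then 1 else 0 : ℕ) ≤ 1 := fun s => by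
    split_ifs <;> norm_num
  have ht : ∀ s : Snapshot ℓ, (Test.natEq flagExp (.const 1)).Holds
      (memory s.c s.ρ (if φ s.c s.ρ then 1 else 0)) ↔ φ s.c s.ρ := fun s => by
    simp only [Test.Holds, flagExp_eval, NatExp.eval]
    split_ifs <;> simp_all
  refine Computes.ite (fun s => s.bounded.two_le) (fun s => s.bounded.memory_le (hd s))
    (.natEq flagExp (.const 1)) ?_ ?_
  -- The second program expects a cleared flag.
  · refine Computes.trans (fun s => s.1.bounded.two_le) (((Computes.setFlag
      (fun s : Snapshot ℓ => s.bounded) hd (.const 0) (v := fun _ => 0) (fun _ => rfl))).comp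
      Subtype.val) ?_
    refine (h'.comp Subtype.val).congr (fun _ => rfl) (fun s => ?_)
    have := (ht s.1).1 s.2
    simp [this]
  · refine (Computes.refl _).congr (fun _ => rfl) (fun s => ?_)
    have : ¬ φ s.1.c s.1.ρ := fun hc => s.2 ((ht s.1).2 hc)
    simp [this]

theorem or (h : Decides ℓ φ) (h' : Decides ℓ ψ) : Decides ℓ (fun c ρ => φ c ρ ∨ ψ c ρ) :=
  (h.not.and h'.not).not.congr (fun c ρ => by tauto)

theorem imp (h : Decides ℓ φ) (h' : Decides ℓ ψ) : Decides ℓ (fun c ρ => φ c ρ → ψ c ρ) :=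
  (h.and h'.not).not.congr (fun c ρ => by tauto)

-- The candidates are tried in a new last variable until the flag is raised or the bound is reached.
-- The bound is a term over `ℓ + 1` variables because it is evaluated while that variable is in use,
-- and `hle` keeps the counter within the bound for the memory.
open Classical in
theorem ex {P : Ctx → (Fin ℓ → ℕ) → ℕ → Prop} {B : Ctx → (Fin ℓ → ℕ) → ℕ}
    (hB : Term (ℓ + 1) (fun c ρ => B c (fun i => ρ i.castSucc)))
    (hle : ∀ X c ρ, Bounded X c ρ → B c ρ ≤ X)
    (h : Decides (ℓ + 1) (fun c ρ => P c (fun i => ρ i.castSucc) (ρ (Fin.last ℓ)))) :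
    Decides ℓ (fun c ρ => ∃ a, a < B c ρ ∧ P c ρ a) := by
  obtain ⟨e, he⟩ := hB
  -- `Q s a` is the value of the flag before round `a`, and `R s` is the number of rounds: the loop
  -- stops right after the least witness.
  let Q (s : Snapshot ℓ) (a : ℕ) : Prop := ∃ a' < a, P s.c s.ρ a'
  let R (s : Snapshot ℓ) : ℕ :=
    if h : ∃ a, a < B s.c s.ρ ∧ P s.c s.ρ a then Nat.find h + 1 else B s.c s.ρ
  have hRB : ∀ s, R s ≤ B s.c s.ρ := fun s => by
    simp only [R]
    split_ifs with h
    · exact (Nat.find_spec h).1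
    · exact le_rfl
  have hRX : ∀ s, R s ≤ s.X := fun s => (hRB s).trans (hle _ _ _ s.bounded)
  have hlt : ∀ s a, a ≤ R s → ((¬ Q s a ∧ a < B s.c s.ρ) ↔ a < R s) := fun s a ha => by
    simp only [R] at ha ⊢
    split_ifs with h
    · rw [dif_pos h] at ha
      constructor
      · rintro ⟨h1, h2⟩
        rcases ha.lt_or_eq with h3 | h3
        · exact h3
        · exact absurd ⟨Nat.find h, by omega, (Nat.find_spec h).2⟩ h1
      · intro h1
        have h2 := (Nat.find_spec h).1
        refine ⟨?_, by omega⟩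
        rintro ⟨a', h3, h4⟩
        exact Nat.find_min h (m := a') (by omega) ⟨by omega, h4⟩
    · rw [dif_neg h] at ha
      constructor
      · exact And.right
      · exact fun h1 => ⟨fun ⟨a', h3, h4⟩ => h ⟨a', by omega, h4⟩, h1⟩
  have hfin : ∀ s, Q s (R s) ↔ ∃ a, a < B s.c s.ρ ∧ P s.c s.ρ a := fun s => by
    constructor
    · rintro ⟨a, h1, h2⟩
      exact ⟨a, h1.trans_le (hRB s), h2⟩
    · intro h
      refine ⟨Nat.find h, ?_, (Nat.find_spec h).2⟩
      simp [R, h]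
  let σ (s : Snapshot ℓ) (a : ℕ) : State :=
    memory s.c (Fin.snoc (α := fun _ => ℕ) s.ρ a) (if Q s a then 1 else 0)
  have hd : ∀ s a, (if Q s a then 1 else 0 : ℕ) ≤ 1 := fun s a => by split_ifs <;> norm_num
  have hloop : Computes (fun s : Snapshot ℓ => s.X) (fun s => σ s 0) (fun s => σ s (R s)) := by
    refine Computes.loop (fun s => s.bounded.two_le) σ R hRX
      (fun s a ha => (s.bounded.snoc (ha.trans (hRX s))).memory_le (hd s a))
      (.and (.natEq flagExp (.const 0)) (.natLt (lastExp ℓ) e)) ?_ ?_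
    · intro s a ha
      rw [← hlt s a ha]
      simp only [Test.Holds, σ, flagExp_eval, lastExp_eval, he, NatExp.eval, Fin.snoc_castSucc]
      refine and_congr ?_ Iff.rfl
      split_ifs <;> simp_all
    · let f (x : {x : Snapshot ℓ × ℕ // x.2 < R x.1}) : Snapshot (ℓ + 1) :=
        ⟨x.1.1.X, x.1.1.c, Fin.snoc (α := fun _ => ℕ) x.1.1.ρ x.1.2,
          x.1.1.bounded.snoc (x.2.le.trans (hRX _))⟩
      refine Computes.trans (fun x => x.1.1.bounded.two_le) ((h.comp f).congr
        (σ' := fun x => σ x.1.1 x.1.2)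
        (τ' := fun x => memory x.1.1.c (Fin.snoc (α := fun _ => ℕ) x.1.1.ρ x.1.2)
          (if Q x.1.1 (x.1.2 + 1) then 1 else 0)) ?_ ?_) ?_
      · intro x
        have h0 := ((hlt _ _ x.2.le).2 x.2).1
        simp [σ, f, h0]
      · intro x
        have h0 := ((hlt _ _ x.2.le).2 x.2).1
        have h1 : Q x.1.1 (x.1.2 + 1) ↔ P x.1.1.c x.1.1.ρ x.1.2 := by
          constructor
          · rintro ⟨a, h2, h3⟩
            rcases (Nat.lt_succ_iff_lt_or_eq.1 h2) with h4 | h4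
            · exact absurd ⟨a, h4, h3⟩ h0
            · exact h4 ▸ h3
          · exact fun h2 => ⟨_, Nat.lt_succ_self _, h2⟩
        simp [f, h1]
      · exact Computes.setVar (fun x => (f x).bounded) (fun x => hd _ _)
          (.add (lastExp ℓ) (.const 1)) (fun x => by simp [NatExp.eval, lastExp_eval])
  refine (Computes.trans (fun s => s.bounded.two_le) hloop (Computes.setVar
    (fun s => s.bounded.snoc (hRX s)) (fun s => hd _ _) (.const 0) (v := fun _ => 0)
    (fun _ => rfl))).congr (fun s => ?_) (fun s => ?_)
  · simp [σ, Q, memory_succ]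
  · simp only [hfin, memory_succ]
    split_ifs <;> rfl

theorem all {P : Ctx → (Fin ℓ → ℕ) → ℕ → Prop} {B : Ctx → (Fin ℓ → ℕ) → ℕ}
    (hB : Term (ℓ + 1) (fun c ρ => B c (fun i => ρ i.castSucc)))
    (hle : ∀ X c ρ, Bounded X c ρ → B c ρ ≤ X)
    (h : Decides (ℓ + 1) (fun c ρ => P c (fun i => ρ i.castSucc) (ρ (Fin.last ℓ)))) :
    Decides ℓ (fun c ρ => ∀ a, a < B c ρ → P c ρ a) :=
  (ex hB hle h.not).not.congr (fun c ρ => by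
    constructor
    · intro h a ha
      by_contra hc
      exact h ⟨a, ha, hc⟩
    · rintro h ⟨a, ha, hc⟩
      exact hc (h a ha))

end Decides

/-! ### Filling arrays -/

theorem Bounded.set {X : ℕ} {c : Ctx} {ℓ : ℕ} {ρ : Fin ℓ → ℕ} (h : Bounded X c ρ) (a : ℕ)
    {f : ℕ → ℕ} (hf : ∀ j, f j ≤ X) : Bounded X (c.set a f) ρ where
  two_le := h.two_le
  nat := h.nat
  arr b i := by
    by_cases hb : b = a
    · subst hb; simpa using hf i
    · rw [Ctx.set_arr_of_ne _ hb]; exact h.arr b i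
  var := h.var

theorem Bounded.single {X : ℕ} {c : Ctx} {ℓ : ℕ} {ρ : Fin ℓ → ℕ} (h : Bounded X c ρ) {a : ℕ}
    (ha : a ≤ X) : Bounded X c ![a] where
  two_le := h.two_le
  nat := h.nat
  arr := h.arr
  var i := by simpa using ha

theorem snoc_nil (a : ℕ) : Fin.snoc (α := fun _ => ℕ) (![] : Fin 0 → ℕ) a = ![a] := by
  funext i
  fin_cases i
  rfl

theorem lastExp_zero_eval (c : Ctx) (a d : ℕ) :
    (lastExp 0).eval (memory c ![a] d) = a := by
  rw [← snoc_nil, lastExp_eval]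

namespace Computes

variable {ι : Type*} {X : ι → ℕ}

/-- The counter is variable `0`. It is reset at the end, so that the resulting memory has no
variables and such loops can be concatenated. -/
theorem forLoop (C : ι → ℕ → Ctx) (B : ι → ℕ)
    (hb : ∀ i a, a ≤ B i → Bounded (X i) (C i a) ![a]) {f : Ctx → (Fin 1 → ℕ) → ℕ}
    (hf : Term 1 f) (hfB : ∀ i a, a ≤ B i → f (C i a) ![a] = B i)
    (h : Computes (fun x : {x : ι × ℕ // x.2 < B x.1} => X x.1.1)
      (fun x => memory (C x.1.1 x.1.2) ![x.1.2] 0)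
      (fun x => memory (C x.1.1 (x.1.2 + 1)) ![x.1.2] 0)) :
    Computes X (fun i => memory (C i 0) ![] 0) (fun i => memory (C i (B i)) ![] 0) := by
  obtain ⟨e, he⟩ := hf
  have hX : ∀ i, 2 ≤ X i := fun i => (hb i 0 (Nat.zero_le _)).two_le
  have hBX : ∀ i, B i ≤ X i := fun i => by simpa using (hb i _ le_rfl).var 0
  have hloop : Computes X (fun i => memory (C i 0) ![0] 0)
      (fun i => memory (C i (B i)) ![B i] 0) := by
    refine Computes.loop hX (fun i a => memory (C i a) ![a] 0) B hBX
      (fun i a ha => (hb i a ha).memory_le zero_le_one) (.natLt (lastExp 0) e) ?_ ?_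
    · intro i a ha
      simp only [Test.Holds, he, hfB i a ha]
      rw [← snoc_nil, lastExp_eval]
    · refine Computes.trans (fun x => hX _) h ?_
      refine (Computes.setVar (c := fun x : {x : ι × ℕ // x.2 < B x.1} => C x.1.1 (x.1.2 + 1))
        (X := fun x => X x.1.1) (ρ := fun _ => ![]) (u := fun x => x.1.2)
        (v := fun x => x.1.2 + 1) (d := fun _ => 0) (fun x => ?_) (fun _ => zero_le_one)
        (.add (lastExp 0) (.const 1)) (fun x => by rw [snoc_nil]; simp [NatExp.eval, lastExp_zero_eval])).congr
        (fun x => by rw [snoc_nil]) (fun x => by rw [snoc_nil])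
      rw [snoc_nil]
      exact (hb _ _ x.2).single (x.2.le.trans (hBX _))
  refine (hloop.trans hX (Computes.congr (Computes.setVar (c := fun i => C i (B i)) (X := X)
    (ρ := fun _ => ![]) (u := B) (v := fun _ => 0) (d := fun _ => 0) (fun i => ?_)
    (fun _ => zero_le_one) (.const 0) (fun _ => rfl)) (fun i => by rw [snoc_nil])
    (fun i => rfl))).congr (fun i => ?_) (fun i => ?_)
  · rw [snoc_nil]; exact hb i _ le_rfl
  · rw [← snoc_nil, memory_succ]
  · rw [memory_succ]

open Classical in
/-- Filling an array with the truth values of a formula, which may refer to the previous ones. -/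
theorem fill (a : ℕ) (ha : 2 ≤ a ∧ a < 8) (c : ι → Ctx) (h0 : ∀ i, (c i).arr a = fun _ => 0)
    (B : ι → ℕ) (hb : ∀ i, Bounded (X i) (c i) ![B i]) {f : Ctx → ℕ}
    (hf : Term 1 (fun c _ => f c)) (hfB : ∀ i g, f ((c i).set a g) = B i) {φ : Ctx → ℕ → Prop}
    (hφ : Decides 1 (fun c ρ => φ c (ρ 0))) (χ : ι → ℕ → Prop)
    (h : ∀ i j, j < B i →
      (φ ((c i).set a (fun m => if m < j ∧ χ i m then 1 else 0)) j ↔ χ i j)) :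
    Computes X (fun i => memory (c i) ![] 0)
      (fun i => memory ((c i).set a (fun m => if m < B i ∧ χ i m then 1 else 0)) ![] 0) := by
  let C (i : ι) (j : ℕ) : Ctx := (c i).set a (fun m => if m < j ∧ χ i m then 1 else 0)
  have hbC : ∀ i j, j ≤ B i → Bounded (X i) (C i j) ![j] := fun i j hj => by
    refine ((hb i).single (hj.trans ?_)).set a (fun m => ?_)
    · simpa using (hb i).var 0
    · have := (hb i).two_le
      split_ifs <;> omega
  refine (forLoop C B hbC hf (fun i j _ => hfB i _) ?_).congr (fun i => ?_) (fun i => rfl)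
  · let s (x : {x : ι × ℕ // x.2 < B x.1}) : Snapshot 1 :=
      ⟨X x.1.1, C x.1.1 x.1.2, ![x.1.2], hbC _ _ x.2.le⟩
    have hX : ∀ x : {x : ι × ℕ // x.2 < B x.1}, 2 ≤ X x.1.1 := fun x => (hb _).two_le
    refine (hφ.comp s).trans hX ?_
    refine (Computes.setArr (fun x => (s x).bounded) (fun x => ?_) a ha (lastExp 0) flagExp
      (k := fun x => x.1.2) (fun x => lastExp_zero_eval _ _ _)
      (fun x => flagExp_eval _ _ _)).trans hX ?_
    · split_ifs <;> norm_num
    · refine (Computes.setFlag (v := fun _ => 0) (fun x => ?_) (fun x => ?_) (.const 0)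
        (fun _ => rfl)).congr (fun _ => rfl) (fun x => ?_)
      · refine (s x).bounded.set a (fun j => ?_)
        by_cases hj : j = x.1.2
        · subst hj
          rw [Function.update_self]
          have := hX x
          show _ ≤ X x.1.1
          split_ifs <;> omega
        · rw [Function.update_of_ne hj]
          exact (s x).bounded.arr _ _
      · split_ifs <;> norm_num
      · have key := h x.1.1 x.1.2 x.2
        simp only [s, C, Ctx.set_set]
        congr 2
        funext m
        by_cases hm : m = x.1.2
        · subst hm
          simp [key]
        · simp only [Function.update_of_ne hm, Ctx.set_arr_self]
          have : m < x.1.2 + 1 ↔ m < x.1.2 := by omega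
          simp [this]
  · simp only [C, Nat.not_lt_zero, false_and, if_false]
    rw [← h0 i, Ctx.set_self]

end Computes

/-- `layer init step N z y`: the number `y` is reached from `init` in exactly `z` steps through
numbers below `N`. -/
def layer (init : ℕ → Prop) (step : ℕ → ℕ → Prop) (N : ℕ) : ℕ → ℕ → Prop
  | 0, y => init y
  | z + 1, y => ∃ x, x < N ∧ layer init step N z x ∧ step x y

open Classical in
/-- Tabulating reachability, layer by layer. -/
theorem Computes.layers {ι : Type*} {X : ι → ℕ} (a : ℕ) (ha : 2 ≤ a ∧ a < 8) (c : ι → Ctx)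
    (h0 : ∀ i, (c i).arr a = fun _ => 0) (B N : ι → ℕ) (hN : ∀ i, 0 < N i)
    (hb : ∀ i, Bounded (X i) (c i) ![B i]) {f sz : Ctx → ℕ}
    (hf : Term 1 (fun c _ => f c)) (hfB : ∀ i g, f ((c i).set a g) = B i)
    (hs : ∀ ℓ, Term ℓ (fun c _ => sz c)) (hsN : ∀ i g, sz ((c i).set a g) = N i)
    (hsX : ∀ X c, ∀ ρ : Fin 1 → ℕ, Bounded X c ρ → sz c ≤ X)
    {P : Ctx → ℕ → Prop} {Q : Ctx → ℕ → ℕ → Prop} (hP : Decides 1 (fun c ρ => P c (ρ 0)))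
    (hQ : Decides 2 (fun c ρ => Q c (ρ 1) (ρ 0 % sz c)))
    (init : ι → ℕ → Prop) (step : ι → ℕ → ℕ → Prop)
    (hPi : ∀ i g j, P ((c i).set a g) j ↔ init i j)
    (hQs : ∀ i g j j', Q ((c i).set a g) j j' ↔ step i j j') :
    Computes X (fun i => memory (c i) ![] 0)
      (fun i => memory ((c i).set a (fun m => if m < B i ∧
        layer (init i) (step i) (N i) (m / N i) (m % N i) then 1 else 0)) ![] 0) := by
  -- Entry `j` of the table stands for row `j / sz c` and column `j % sz c`. The preceding row
  -- starts at `j - j % sz c - sz c` and has been filled already.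
  refine Computes.fill a ha c h0 B hb hf hfB (φ := fun c j => (j < sz c ∧ P c j) ∨
    (sz c ≤ j ∧ ∃ x, x < sz c ∧ (c.arr a (j - j % sz c - sz c + x) = 1 ∧ Q c x (j % sz c)))) ?_
    (fun i m => layer (init i) (step i) (N i) (m / N i) (m % N i)) ?_
  · refine (((Decides.lt (.var 0) (hs 1)).and hP)).or ((Decides.le (hs 1) (.var 0)).and
      (Decides.ex (B := fun c _ => sz c)
        (P := fun c ρ x => c.arr a (ρ 0 - ρ 0 % sz c - sz c + x) = 1 ∧ Q c x (ρ 0 % sz c))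
        (hs 2) hsX ((Decides.eq (Term.arr a ha ?_) (.const 1)).and hQ)))
    exact (((Term.var 0).sub ((Term.var 0).mod (hs 2))).sub (hs 2)).add (.var 1)
  · intro i j hj
    simp only [hsN, hPi, hQs, Ctx.set_arr_self]
    rcases lt_or_ge j (N i) with hjN | hjN
    · rw [Nat.div_eq_of_lt hjN, Nat.mod_eq_of_lt hjN]
      simp [hjN, hjN.not_ge, layer]
    · have hN := hN i
      obtain ⟨z, hz⟩ : ∃ z, j / N i = z + 1 :=
        ⟨j / N i - 1, by have := Nat.div_pos hjN hN; omega⟩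
      have hjz : j - j % N i - N i = N i * z := by
        have := Nat.div_add_mod j (N i)
        rw [hz, mul_add] at this
        omega
      have hjz' : N i * z + N i ≤ j := by
        have := Nat.div_add_mod j (N i)
        rw [hz, mul_add] at this
        omega
      simp only [hjN, hjN.not_gt, false_and, true_and, false_or, hz, layer, hjz]
      refine exists_congr fun x => and_congr_right fun hx => and_congr_left fun _ => ?_
      have h1 : N i * z + x < j := by omega
      have h2 : (N i * z + x) / N i = z := by
        rw [Nat.mul_add_div hN, Nat.div_eq_of_lt hx, add_zero]
      have h3 : (N i * z + x) % N i = x := by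
        rw [Nat.mul_add_mod, Nat.mod_eq_of_lt hx]
      simp [h1, h2, h3]

end RealRAM

/-! ### Paths and distances in acyclic digraphs -/

namespace FinDigraph

variable {V : Type*} {G : FinDigraph V}

theorem IsAcyclic.nodup (hG : G.IsAcyclic) {P : List V}
    (h : P.IsChain (fun x y => (x, y) ∈ G.edges)) : P.Nodup := by
  obtain ⟨ord, -, hord⟩ := hG
  have h1 : P.IsChain (fun x y => ord x < ord y) := h.imp (fun x y hxy => hord _ hxy)
  have : IsTrans V (fun x y => ord x < ord y) := ⟨fun _ _ _ => lt_trans⟩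
  exact (List.isChain_iff_pairwise.1 h1).imp (fun hab => by rintro rfl; exact lt_irrefl _ hab)

/-- In an acyclic digraph `Nodup` comes for free, so paths can be taken apart and put together edge
by edge. -/
theorem isPath_cons_cons (hG : G.IsAcyclic) {u v x t : V} {P : List V} :
    G.IsPath (u :: v :: P) x t ↔ u = x ∧ (u, v) ∈ G.edges ∧ G.IsPath (v :: P) v t := by
  constructor
  · rintro ⟨h1, h2, h3, h4, h5⟩
    rw [List.isChain_cons_cons] at h5
    refine ⟨by simpa using h1, h5.1, rfl, by simpa using h2, (List.nodup_cons.1 h3).2,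
      fun a ha => h4 a (List.mem_cons_of_mem _ ha), h5.2⟩
  · rintro ⟨rfl, h1, -, h2, h3, h4, h5⟩
    have hc : (u :: v :: P).IsChain (fun x y => (x, y) ∈ G.edges) :=
      List.isChain_cons_cons.2 ⟨h1, h5⟩
    refine ⟨rfl, by simpa using h2, hG.nodup hc, fun a ha => ?_, hc⟩
    rcases List.mem_cons.1 ha with rfl | ha
    · exact (G.mem_verts _ h1).1
    · exact h4 a ha

theorem isPath_singleton {u x t : V} :
    G.IsPath [u] x t ↔ u = x ∧ u = t ∧ u ∈ G.verts := by
  simp [IsPath]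

theorem IsPath.cases {P : List V} {u t : V} (h : G.IsPath P u t) :
    P = [u] ∧ u = t ∨ ∃ v P', P = u :: v :: P' := by
  obtain ⟨h1, h2, -⟩ := h
  match P, h1 with
  | [a], h1 =>
    obtain rfl : a = u := by simpa using h1
    exact .inl ⟨rfl, by simpa using h2⟩
  | a :: v :: P', h1 =>
    obtain rfl : a = u := by simpa using h1
    exact .inr ⟨v, P', rfl⟩

theorem IsPath.exists_cons {P : List V} {u t : V} (h : G.IsPath P u t) : ∃ P', P = u :: P' := by
  rcases h.cases with ⟨rfl, -⟩ | ⟨v, P', rfl⟩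
  exacts [⟨_, rfl⟩, ⟨_, rfl⟩]

theorem IsPath.mem_verts {P : List V} {u t : V} (h : G.IsPath P u t) : u ∈ G.verts := by
  obtain ⟨P', rfl⟩ := h.exists_cons
  exact h.2.2.2.1 u (by simp)

/-- The least weight of a path from `u` to `t` is `D`. -/
def IsDist (G : FinDigraph V) (w : V × V → ℝ≥0) (t u : V) (D : ℝ≥0) : Prop :=
  (∃ P, G.IsPath P u t ∧ pathWeight w P = D) ∧ ∀ P, G.IsPath P u t → D ≤ pathWeight w P

variable {w : V × V → ℝ≥0} {t u : V} {D : ℝ≥0}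

theorem isDist_target (ht : t ∈ G.verts) : G.IsDist w t t 0 :=
  ⟨⟨[t], isPath_singleton.2 ⟨rfl, rfl, ht⟩, by simp [pathWeight]⟩, fun _ _ => bot_le⟩

theorem IsDist.unique {D' : ℝ≥0} (h : G.IsDist w t u D) (h' : G.IsDist w t u D') : D = D' := by
  obtain ⟨⟨P, hP, rfl⟩, h1⟩ := h
  obtain ⟨⟨P', hP', rfl⟩, h1'⟩ := h'
  exact le_antisymm (h1 _ hP') (h1' _ hP)

theorem IsDist.mem_verts (h : G.IsDist w t u D) : u ∈ G.verts := by
  obtain ⟨⟨P, hP, rfl⟩, -⟩ := h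
  exact hP.mem_verts

/-- The distance from `u`, given the distances from the next vertices. -/
theorem isDist_of_edge (hG : G.IsAcyclic) (hu : u ≠ t) {z : V} (hz : (u, z) ∈ G.edges)
    (hD : G.IsDist w t z D)
    (h : ∀ y, (u, y) ∈ G.edges → ∃ D', G.IsDist w t y D' ∧ w (u, z) + D ≤ w (u, y) + D') :
    G.IsDist w t u (w (u, z) + D) := by
  constructor
  · obtain ⟨⟨P, hP, rfl⟩, -⟩ := hD
    obtain ⟨P, rfl⟩ := hP.exists_cons
    exact ⟨u :: z :: P, (isPath_cons_cons hG).2 ⟨rfl, hz, hP⟩, by simp [pathWeight]⟩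
  · intro P hP
    rcases hP.cases with ⟨rfl, h'⟩ | ⟨v, P, rfl⟩
    · exact absurd h' hu
    · obtain ⟨-, he, hP⟩ := (isPath_cons_cons hG).1 hP
      obtain ⟨D', hD', hle⟩ := h v he
      refine hle.trans ?_
      rw [pathWeight]
      gcongr
      exact hD'.2 _ hP

/-- The spanning subgraph with the given edges. -/
def span (G : FinDigraph V) (F : Finset (V × V)) (hF : F ⊆ G.edges) : FinDigraph V where
  verts := G.verts
  edges := F
  mem_verts e he := G.mem_verts e (hF he)

/-- Two graphs have the same paths from the vertices of a set that is closed under the edges. -/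
theorem isPath_iff_of_closed {G G' : FinDigraph V} (hG : G.IsAcyclic) (hG' : G'.IsAcyclic)
    (hv : G.verts = G'.verts) {S : Set V}
    (h : ∀ u ∈ S, ∀ v, (u, v) ∈ G.edges → v ∈ S)
    (he : ∀ u ∈ S, ∀ v, (u, v) ∈ G.edges ↔ (u, v) ∈ G'.edges) (P : List V) {u t : V}
    (hu : u ∈ S) : G.IsPath P u t ↔ G'.IsPath P u t := by
  induction P generalizing u with
  | nil => simp [IsPath]
  | cons a P ih =>
    cases P with
    | nil => rw [isPath_singleton, isPath_singleton, hv]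
    | cons v P =>
      rw [isPath_cons_cons hG, isPath_cons_cons hG']
      refine and_congr_right ?_
      rintro rfl
      rw [← he a hu v]
      exact and_congr_right fun hav => ih (h a hu v hav)

end FinDigraph

namespace PlanningModel

variable {V : Type*}

/-- The model on a spanning subgraph. -/
def span (M : PlanningModel V) (F : Finset (V × V)) (hF : F ⊆ M.G.edges) : PlanningModel V :=
  M.restrict (M.G.span F hF) ⟨Finset.Subset.refl _, hF⟩ M.s_mem M.t_mem

theorem perceivedCost_le {M : PlanningModel V} {P : List V} {u : V} (h : M.G.IsPath P u M.t) :
    M.perceivedCost u ≤ (perceivedPathCost M.b M.w P : ℝ≥0∞) :=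
  iInf_le (fun P : {P : List V // M.G.IsPath P u M.t} =>
    (perceivedPathCost M.b M.w P.1 : ℝ≥0∞)) ⟨P, h⟩

/-- The strict inequality makes `y` the only vertex the agent may move to. The distances from the
heads of the edges are all that has to be known. -/
theorem surelyReaches_of_edge {M : PlanningModel V} {u y : V} {D : ℝ≥0} (hu : u ≠ M.t)
    (hy : (u, y) ∈ M.G.edges) (hD : M.G.IsDist M.w M.t y D) (hr : M.b * M.w (u, y) + D ≤ M.r)
    (hs : M.SurelyReaches y)
    (h : ∀ z, (u, z) ∈ M.G.edges → z ≠ y →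
      ∃ D', M.G.IsDist M.w M.t z D' ∧ M.b * M.w (u, y) + D < M.b * M.w (u, z) + D') :
    M.SurelyReaches u := by
  have hc : M.perceivedCost u ≤ ((M.b * M.w (u, y) + D : ℝ≥0) : ℝ≥0∞) := by
    obtain ⟨⟨P, hP, rfl⟩, -⟩ := hD
    obtain ⟨P, rfl⟩ := hP.exists_cons
    exact perceivedCost_le ((FinDigraph.isPath_cons_cons M.acyclic).2 ⟨rfl, hy, hP⟩)
  refine .step u hu (hc.trans (by exact_mod_cast hr)) ?_
  rintro v ⟨P, hP, heq⟩
  by_cases hv : v = y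
  · exact hv ▸ hs
  · obtain ⟨-, he, hP'⟩ := (FinDigraph.isPath_cons_cons M.acyclic).1 hP
    obtain ⟨D', hD', hlt⟩ := h v he hv
    rw [← heq] at hc
    have h1 : perceivedPathCost M.b M.w (u :: v :: P) ≤ M.b * M.w (u, y) + D := by
      exact_mod_cast hc
    have h2 := hD'.2 _ hP'
    rw [perceivedPathCost] at h1
    exact absurd (h1.trans_lt (hlt.trans_le (by gcongr))) (lt_irrefl _)

/-- The behaviour of the agent depends only on the paths from vertices he can visit, and a set
closed under the edges contains all of these. -/
theorem surelyReaches_of_closed {M M' : PlanningModel V} (hw : M'.w = M.w) (ht : M'.t = M.t)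
    (hb : M'.b = M.b) (hr : M'.r = M.r) {S : Set V}
    (hS : ∀ u ∈ S, ∀ v, (u, v) ∈ M.G.edges → v ∈ S)
    (hP : ∀ P, ∀ u ∈ S, (M.G.IsPath P u M.t ↔ M'.G.IsPath P u M.t)) {u : V} (hu : u ∈ S)
    (h : M'.SurelyReaches u) : M.SurelyReaches u := by
  have hcost : ∀ u ∈ S, M.perceivedCost u = M'.perceivedCost u := fun u hu => by
    unfold perceivedCost
    rw [iInf_subtype, iInf_subtype, hw, ht, hb]
    exact iInf_congr fun P => iInf_congr_Prop (hP P u hu) (fun _ => rfl)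
  induction h with
  | target => rw [ht]; exact .target
  | step u hne hstay _ ih =>
    refine .step u (ht ▸ hne) (by rw [hcost u hu, ← hr]; exact hstay) ?_
    rintro v ⟨P, hp, heq⟩
    refine ih v ⟨P, ?_, ?_⟩ (hS u hu v ((FinDigraph.isPath_cons_cons M.acyclic).1 hp).2.1)
    · rw [ht]; exact (hP _ u hu).1 hp
    · rw [← hcost u hu, ← heq, hw, hb]

end PlanningModel

/-! ### The pebble game -/

/-- A position of the pebble game: pebble `i` lies on `v i` and claims that the distance from there
to the target is `d i`; so far `c` branchings have been made. Pebble `0` is the agent. -/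
structure Position (V : Type*) where
  v : ℕ → V
  d : ℕ → ℕ
  c : ℕ

namespace PlanningModel

variable {V : Type*}

/-- A move of the pebble game with pebbles `0`, …, `m - 1`: all pebbles on a vertex `x` of minimum
level move along the edge to `y`, except that pebble `q.c` moves along another edge to `z` when
this is a branching. -/
def Move (M : PlanningModel V) (w : V × V → ℕ) (lev : V → ℕ) (m : ℕ) (p q : Position V) : Prop :=
  ∃ x y, (x, y) ∈ M.G.edges ∧ x ≠ M.t ∧ (∃ i, i < m ∧ p.v i = x) ∧
    (∀ j, j < m → lev x ≤ lev (p.v j)) ∧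
    (∀ j, j < m → p.v j ≠ x → q.v j = p.v j ∧ q.d j = p.d j) ∧
    ((q.c = p.c ∧ (∀ j, j < m → p.v j = x → q.v j = y ∧ q.d j + w (x, y) = p.d j) ∧
        (p.v 0 = x → (w (x, y) : ℝ) * M.b + q.d 0 ≤ M.r)) ∨
      (p.v 0 = x ∧ q.c = p.c + 1 ∧ q.c < m ∧ p.v q.c = x ∧
        (w (x, y) : ℝ) * M.b + q.d 0 ≤ M.r ∧ p.d 0 ≤ q.d 0 + w (x, y) ∧
        (∀ j, j < m → p.v j = x → p.d j = p.d 0 ∧ (j ≠ q.c → q.v j = y ∧ q.d j = q.d 0)) ∧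
        ∃ z, (x, z) ∈ M.G.edges ∧ q.v q.c = z ∧ q.d q.c + w (x, z) = p.d 0 ∧
          (w (x, y) : ℝ) * M.b + q.d 0 < (w (x, z) : ℝ) * M.b + q.d q.c))

/-- The initial positions. -/
def Initial (M : PlanningModel V) (m : ℕ) (p : Position V) : Prop :=
  p.c = 0 ∧ ∀ j, j < m → p.v j = M.s

/-- The final positions. -/
def Final (M : PlanningModel V) (m : ℕ) (p : Position V) : Prop :=
  p.c < m ∧ ∀ j, j < m → p.v j = M.t ∧ p.d j = 0

/-- The edges `F` make the claims of the position true. -/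
structure Certifies (M : PlanningModel V) (m : ℕ) (p : Position V) (F : Finset (V × V))
    (hF : F ⊆ M.G.edges) : Prop where
  tail : ∀ e ∈ F, ∃ i < m, Relation.ReflTransGen (fun a b => (a, b) ∈ M.G.edges) (p.v i) e.1
  dist : ∀ i < m, (M.span F hF).G.IsDist M.w M.t (p.v i) (p.d i)
  reaches : (M.span F hF).SurelyReaches (p.v 0)
  branching : (M.G.span F hF).branching.card + p.c < m

theorem certifies_final {M : PlanningModel V} {m : ℕ} {p : Position V} (h : M.Final m p) :
    M.Certifies m p ∅ (Finset.empty_subset _) where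
  tail e he := by simp at he
  dist i hi := by
    rw [(h.2 i hi).1, (h.2 i hi).2, Nat.cast_zero]
    exact FinDigraph.isDist_target M.t_mem
  reaches := by
    rw [(h.2 0 (by have := h.1; omega)).1]
    exact .target (M := M.span ∅ (Finset.empty_subset _))
  branching := by
    have : (M.G.span ∅ (Finset.empty_subset _)).branching = ∅ := by
      refine Finset.filter_eq_empty_iff.2 fun v _ => ?_
      simp [FinDigraph.outDegree, FinDigraph.span]
    rw [this]
    simpa using h.1

theorem lev_le_of_reaches {M : PlanningModel V} {lev : V → ℕ}
    (hlev : ∀ e ∈ M.G.edges, lev e.1 < lev e.2) {a b : V}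
    (h : Relation.ReflTransGen (fun a b => (a, b) ∈ M.G.edges) a b) : a = b ∨ lev a < lev b := by
  induction h with
  | refl => exact .inl rfl
  | tail _ hbc ih =>
    have := hlev _ hbc
    rcases ih with rfl | ih
    · exact .inr this
    · exact .inr (ih.trans this)

/-- The play is read backwards. When the pebbles on `x` are put back, the edges they used are added
to those collected from the later moves. The old edges never touch `x`, and the new ones are
invisible from the vertices that cannot reach `x`; so all earlier claims persist, and the claims
about `x` follow from those about the heads of its one or two edges. A second edge at `x` is paid
for by the increase of the counter. -/
theorem exists_certifies {M : PlanningModel V} {w : V × V → ℕ} {lev : V → ℕ} {m : ℕ}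
    (hw : ∀ e ∈ M.G.edges, M.w e = (w e : ℝ≥0))
    (hlev : ∀ e ∈ M.G.edges, lev e.1 < lev e.2) (hm : 0 < m) {p q : Position V}
    (h : M.Move w lev m p q) {F : Finset (V × V)} {hF : F ⊆ M.G.edges}
    (hq : M.Certifies m q F hF) : ∃ F' hF', M.Certifies m p F' hF' := by
  classical
  obtain ⟨x, y, hxy, hxt, ⟨i₀, hi₀, hpi₀⟩, hmin, hstay, hcase⟩ := h
  let R := Relation.ReflTransGen (fun a b => (a, b) ∈ M.G.edges)
  -- As `x` has minimum level, `S` contains all pebbles of `q` and all pebbles of `p` outside `x`.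
  let S : Set V := {u | ¬ R u x}
  have hyS : ∀ y, (x, y) ∈ M.G.edges → y ∈ S := fun y hy hR => by
    have h1 := hlev _ hy
    rcases lev_le_of_reaches hlev hR with h | h
    · subst h; exact lt_irrefl _ h1
    · exact lt_asymm h1 h
  have hpS : ∀ j < m, p.v j ≠ x → p.v j ∈ S := fun j hj hne hR => by
    rcases lev_le_of_reaches hlev hR with h | h
    · exact hne h
    · exact absurd (hmin j hj) (by omega)
  have hqS : ∀ j < m, q.v j ∈ S ∧ ((q.v j = p.v j ∧ p.v j ≠ x) ∨ (p.v j = x ∧ (x, q.v j) ∈ M.G.edges)) := by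
    intro j hj
    by_cases hpj : p.v j = x
    · suffices (x, q.v j) ∈ M.G.edges from ⟨hyS _ this, .inr ⟨hpj, this⟩⟩
      rcases hcase with ⟨-, h1, -⟩ | ⟨-, -, -, -, -, -, h1, z, hz, hqz, -⟩
      · rw [(h1 j hj hpj).1]; exact hxy
      · by_cases hjc : j = q.c
        · rw [hjc, hqz]; exact hz
        · rw [((h1 j hj hpj).2 hjc).1]; exact hxy
    · rw [(hstay j hj hpj).1]
      exact ⟨hpS j hj hpj, .inl ⟨rfl, hpj⟩⟩
  -- Tails of old edges are reachable from pebbles in `S`, so only the newly added edges will leave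
  -- `x`.
  have hFx : ∀ e ∈ F, e.1 ≠ x := fun e he hex => by
    obtain ⟨i, hi, hR⟩ := hq.tail e he
    exact (hqS i hi).1 (hex ▸ hR)
  -- adding edges that leave `x` changes nothing for the vertices that do not reach `x`
  have ext : ∀ N : Finset (V × V), (∀ e ∈ N, e.1 = x) → ∀ hN : F ∪ N ⊆ M.G.edges,
      (∀ e ∈ F ∪ N, ∃ i < m, R (p.v i) e.1) ∧
      (∀ u ∈ S, ∀ D, (M.span F hF).G.IsDist M.w M.t u D →
        (M.span (F ∪ N) hN).G.IsDist M.w M.t u D) ∧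
      (∀ u ∈ S, (M.span F hF).SurelyReaches u → (M.span (F ∪ N) hN).SurelyReaches u) ∧
      (∀ v ≠ x, (M.G.span (F ∪ N) hN).outDegree v = (M.G.span F hF).outDegree v) := by
    intro N hNx hN
    have hcl : ∀ u ∈ S, ∀ v, (u, v) ∈ (M.span (F ∪ N) hN).G.edges → v ∈ S := by
      intro u hu v huv hR
      exact hu (Relation.ReflTransGen.head (hN huv) hR)
    have hmem : ∀ u ∈ S, ∀ v, (u, v) ∈ (M.span (F ∪ N) hN).G.edges ↔
        (u, v) ∈ (M.span F hF).G.edges := by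
      intro u hu v
      change (u, v) ∈ F ∪ N ↔ (u, v) ∈ F
      rw [Finset.mem_union]
      refine or_iff_left fun hc => hu ?_
      have : u = x := hNx _ hc
      exact this ▸ .refl
    have hpath : ∀ P, ∀ u ∈ S, ((M.span (F ∪ N) hN).G.IsPath P u M.t ↔
        (M.span F hF).G.IsPath P u M.t) := fun P u hu =>
      FinDigraph.isPath_iff_of_closed (M.span (F ∪ N) hN).acyclic (M.span F hF).acyclic rfl
        hcl hmem P hu
    refine ⟨?_, ?_, ?_, ?_⟩
    · intro e he
      rcases Finset.mem_union.1 he with he | he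
      · obtain ⟨i, hi, hR⟩ := hq.tail e he
        refine ⟨i, hi, ?_⟩
        rcases (hqS i hi).2 with ⟨h1, -⟩ | ⟨h1, h2⟩
        · exact h1 ▸ hR
        · exact Relation.ReflTransGen.head (h1 ▸ h2) hR
      · exact ⟨i₀, hi₀, by rw [hNx e he, hpi₀]⟩
    · rintro u hu D ⟨⟨P, hP, hD⟩, h2⟩
      exact ⟨⟨P, (hpath P u hu).2 hP, hD⟩, fun P hP => h2 P ((hpath P u hu).1 hP)⟩
    · intro u hu
      exact surelyReaches_of_closed (M := M.span (F ∪ N) hN) (M' := M.span F hF) rfl rfl rfl rfl hcl hpath hu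
    · intro v hv
      unfold FinDigraph.outDegree
      congr 1
      ext e
      simp only [FinDigraph.span, Finset.mem_filter, Finset.mem_union]
      constructor
      · rintro ⟨h1 | h1, h2⟩
        · exact ⟨h1, h2⟩
        · exact absurd (h2 ▸ hNx e h1) hv
      · exact fun h => ⟨.inl h.1, h.2⟩
  have hq0 := hqS 0 hm
  rcases hcase with ⟨hc, hmove, hr⟩ | ⟨hp0, hc, hcm, hpc, hr, hle, hmove, z, hz, hqz, hdz, hlt⟩
  · have hN : F ∪ {(x, y)} ⊆ M.G.edges :=
      Finset.union_subset hF (by simpa using hxy)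
    obtain ⟨e1, e2, e3, e4⟩ := ext {(x, y)} (by simp) hN
    have hout : ∀ v, (x, v) ∈ (M.span (F ∪ {(x, y)}) hN).G.edges → v = y := fun v hv => by
      rcases Finset.mem_union.1 (show (x, v) ∈ F ∪ {(x, y)} from hv) with h | h
      · exact absurd rfl (hFx _ h)
      · simpa using h
    have hin : (x, y) ∈ (M.span (F ∪ {(x, y)}) hN).G.edges :=
      Finset.mem_union_right _ (Finset.mem_singleton_self _)
    have hwxy := hw _ hxy
    refine ⟨_, hN, e1, fun j hj => ?_, ?_, ?_⟩
    · by_cases hpj : p.v j = x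
      · obtain ⟨h1, h2⟩ := hmove j hj hpj
        have hd := e2 _ (hqS j hj).1 _ (hq.dist j hj)
        rw [h1] at hd
        have := FinDigraph.isDist_of_edge (M.span _ hN).acyclic hxt hin hd (fun v hv => by
          rw [hout v hv]; exact ⟨_, hd, le_rfl⟩)
        rw [hpj, ← h2, Nat.cast_add, add_comm, ← hwxy]
        exact this
      · obtain ⟨h1, h2⟩ := hstay j hj hpj
        have hd := e2 _ (hqS j hj).1 _ (hq.dist j hj)
        rwa [h1, h2] at hd
    · by_cases hp0 : p.v 0 = x
      · obtain ⟨h1, -⟩ := hmove 0 hm hp0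
        have hd := e2 _ (hqS 0 hm).1 _ (hq.dist 0 hm)
        have hs := e3 _ (hqS 0 hm).1 hq.reaches
        rw [h1] at hd hs
        rw [hp0]
        refine surelyReaches_of_edge (M := M.span _ hN) hxt hin hd ?_ hs
          (fun v hv hne => absurd (hout v hv) hne)
        have h3 := hr hp0
        change M.b * M.w (x, y) + q.d 0 ≤ M.r
        rw [hwxy, ← NNReal.coe_le_coe]
        push_cast
        linarith
      · have hs := e3 _ (hqS 0 hm).1 hq.reaches
        rwa [(hstay 0 hm hp0).1] at hs
    · rw [← hc]
      refine lt_of_le_of_lt (Nat.add_le_add_right (Finset.card_le_card ?_) _) hq.branching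
      intro v hv
      obtain ⟨h1, h2⟩ := Finset.mem_filter.1 hv
      refine Finset.mem_filter.2 ⟨h1, ?_⟩
      by_cases hvx : v = x
      · exfalso
        have : (M.G.span (F ∪ {(x, y)}) hN).outDegree v ≤ ({(x, y)} : Finset (V × V)).card := by
          refine Finset.card_le_card fun e he => ?_
          obtain ⟨h3, h4⟩ := Finset.mem_filter.1 he
          obtain ⟨a, b⟩ := e
          obtain rfl : a = x := h4.trans hvx
          simp [hout b h3]
        rw [Finset.card_singleton] at this
        omega
      · rwa [← e4 v hvx]
  · have hN : F ∪ {(x, y), (x, z)} ⊆ M.G.edges := by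
      refine Finset.union_subset hF fun e he => ?_
      rcases Finset.mem_insert.1 he with rfl | he
      · exact hxy
      · rw [Finset.mem_singleton.1 he]; exact hz
    obtain ⟨e1, e2, e3, e4⟩ := ext {(x, y), (x, z)} (by simp) hN
    have hout : ∀ v, (x, v) ∈ (M.span (F ∪ {(x, y), (x, z)}) hN).G.edges → v = y ∨ v = z :=
      fun v hv => by
        rcases Finset.mem_union.1 (show (x, v) ∈ F ∪ {(x, y), (x, z)} from hv) with h | h
        · exact absurd rfl (hFx _ h)
        · simpa using h
    have hiny : (x, y) ∈ (M.span (F ∪ {(x, y), (x, z)}) hN).G.edges :=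
      Finset.mem_union_right _ (by simp)
    have hinz : (x, z) ∈ (M.span (F ∪ {(x, y), (x, z)}) hN).G.edges :=
      Finset.mem_union_right _ (by simp)
    have hwxy := hw _ hxy
    have hwxz := hw _ hz
    -- The pebble that is split off is never the agent, who therefore moves to `y`.
    have h0c : (0 : ℕ) ≠ q.c := by omega
    have hqy : q.v 0 = y := ((hmove 0 hm hp0).2 h0c).1
    have hdy := e2 _ (hqS 0 hm).1 _ (hq.dist 0 hm)
    have hdz' := e2 _ (hqS _ hcm).1 _ (hq.dist _ hcm)
    have hs := e3 _ (hqS 0 hm).1 hq.reaches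
    rw [hqy] at hdy hs
    rw [hqz] at hdz'
    -- The shortest path from `x` runs through `z`: the move requires `p.d 0 ≤ q.d 0 + w (x, y)`,
    -- where `p.d 0` is the length through `z`.
    have hdx := FinDigraph.isDist_of_edge (M.span _ hN).acyclic hxt hinz hdz' (fun v hv => by
      rcases hout v hv with rfl | rfl
      · refine ⟨_, hdy, ?_⟩
        rw [hwxy, hwxz]
        have : w (x, z) + q.d q.c ≤ w (x, v) + q.d 0 := by omega
        exact_mod_cast this
      · exact ⟨_, hdz', le_rfl⟩)
    refine ⟨_, hN, e1, fun j hj => ?_, ?_, ?_⟩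
    · by_cases hpj : p.v j = x
      · rw [hpj, (hmove j hj hpj).1, ← hdz, Nat.cast_add, add_comm, ← hwxz]
        exact hdx
      · obtain ⟨h1, h2⟩ := hstay j hj hpj
        have hd := e2 _ (hqS j hj).1 _ (hq.dist j hj)
        rwa [h1, h2] at hd
    · rw [hp0]
      refine surelyReaches_of_edge (M := M.span _ hN) hxt hiny hdy ?_ hs ?_
      · change M.b * M.w (x, y) + q.d 0 ≤ M.r
        rw [hwxy, ← NNReal.coe_le_coe]
        push_cast
        linarith
      · intro v hv hne
        obtain rfl := (hout v hv).resolve_left hne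
        refine ⟨_, hdz', ?_⟩
        change M.b * M.w (x, y) + q.d 0 < M.b * M.w (x, v) + q.d q.c
        rw [hwxy, hwxz, ← NNReal.coe_lt_coe]
        push_cast
        linarith
    · have hsub : (M.G.span (F ∪ {(x, y), (x, z)}) hN).branching ⊆
          insert x (M.G.span F hF).branching := by
        intro v hv
        obtain ⟨h1, h2⟩ := Finset.mem_filter.1 hv
        by_cases hvx : v = x
        · exact hvx ▸ Finset.mem_insert_self _ _
        · exact Finset.mem_insert_of_mem (Finset.mem_filter.2 ⟨h1, by rwa [← e4 v hvx]⟩)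
      have h1 := (Finset.card_le_card hsub).trans (Finset.card_insert_le _ _)
      have h2 := hq.branching
      omega

/-- A play of the pebble game from an initial to a final position yields a simple motivating
subgraph. -/
theorem hasSimpleMotivatingSubgraph_of_moves {M : PlanningModel V} {w : V × V → ℕ} {lev : V → ℕ}
    {k : ℕ} (hw : ∀ e ∈ M.G.edges, M.w e = (w e : ℝ≥0))
    (hlev : ∀ e ∈ M.G.edges, lev e.1 < lev e.2) {p q : Position V} (hp : M.Initial (k + 1) p)
    (hq : M.Final (k + 1) q) (h : Relation.ReflTransGen (M.Move w lev (k + 1)) p q) :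
    M.HasSimpleMotivatingSubgraph k := by
  have key : ∃ F hF, M.Certifies (k + 1) p F hF := by
    clear hp
    induction h using Relation.ReflTransGen.head_induction_on with
    | refl => exact ⟨_, _, certifies_final hq⟩
    | head h1 _ ih =>
      obtain ⟨F, hF, hc⟩ := ih
      exact exists_certifies hw hlev (Nat.succ_pos _) h1 hc
  obtain ⟨F, hF, hc⟩ := key
  refine ⟨M.G.span F hF, ⟨⟨Finset.Subset.refl _, hF⟩, M.s_mem, M.t_mem, ?_⟩, ?_⟩
  · have := hc.reaches
    rwa [hp.2 0 (Nat.succ_pos _)] at this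
  · have := hc.branching
    rw [hp.1] at this
    omega

end PlanningModel

/-! ### Distances with integer weights, and the play guided by a motivating subgraph. -/

namespace FinDigraph

variable {V : Type*} {G : FinDigraph V} {wt : V × V → ℝ≥0} {w : V × V → ℕ} {t u : V}

theorem exists_pathWeight_eq_natCast (hw : ∀ e ∈ G.edges, wt e = (w e : ℝ≥0)) (P : List V)
    (h : P.IsChain (fun x y => (x, y) ∈ G.edges)) : ∃ a : ℕ, pathWeight wt P = a := by
  induction P with
  | nil => exact ⟨0, by simp [pathWeight]⟩
  | cons x P ih =>
    cases P with
    | nil => exact ⟨0, by simp [pathWeight]⟩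
    | cons y P =>
      rw [List.isChain_cons_cons] at h
      obtain ⟨a, ha⟩ := ih h.2
      exact ⟨w (x, y) + a, by rw [pathWeight, ha, hw _ h.1, Nat.cast_add]⟩

theorem exists_isDist (hw : ∀ e ∈ G.edges, wt e = (w e : ℝ≥0)) {P : List V}
    (h : G.IsPath P u t) : ∃ D : ℕ, G.IsDist wt t u D := by
  classical
  have hex : ∃ D : ℕ, ∃ P, G.IsPath P u t ∧ pathWeight wt P = D := by
    obtain ⟨D, hD⟩ := exists_pathWeight_eq_natCast hw P h.2.2.2.2
    exact ⟨D, P, h, hD⟩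
  refine ⟨Nat.find hex, Nat.find_spec hex, fun P' h' => ?_⟩
  obtain ⟨D, hD⟩ := exists_pathWeight_eq_natCast hw P' h'.2.2.2.2
  rw [hD]
  exact_mod_cast Nat.find_min' hex ⟨P', h', hD⟩

-- Restricting the sum to edges whose tail lies on the path makes the induction work: by `Nodup` the
-- first edge is not counted again by the rest. This bounds the distances, hence the digits of the
-- codes, by the total weight.
open Classical in
theorem pathWeight_le_sum (wt : V × V → ℝ≥0) (P : List V)
    (h : P.IsChain (fun x y => (x, y) ∈ G.edges)) (hn : P.Nodup) :
    pathWeight wt P ≤ ∑ e ∈ G.edges with e.1 ∈ P, wt e := by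
  induction P with
  | nil => simp [pathWeight]
  | cons x P ih =>
    cases P with
    | nil => simp [pathWeight]
    | cons y P =>
      rw [List.isChain_cons_cons] at h
      rw [List.nodup_cons] at hn
      rw [pathWeight]
      have hnot : (x, y) ∉ G.edges.filter (fun e => e.1 ∈ y :: P) := by
        simp only [Finset.mem_filter, not_and]
        exact fun _ => hn.1
      calc wt (x, y) + pathWeight wt (y :: P)
          ≤ wt (x, y) + ∑ e ∈ G.edges with e.1 ∈ y :: P, wt e := by
            gcongr; exact ih h.2 hn.2
        _ = ∑ e ∈ insert (x, y) (G.edges.filter (fun e => e.1 ∈ y :: P)), wt e :=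
            (Finset.sum_insert hnot).symm
        _ ≤ _ := by
            refine Finset.sum_le_sum_of_subset fun e he => ?_
            rcases Finset.mem_insert.1 he with rfl | he
            · exact Finset.mem_filter.2 ⟨h.1, List.mem_cons_self⟩
            · obtain ⟨h1, h2⟩ := Finset.mem_filter.1 he
              exact Finset.mem_filter.2 ⟨h1, List.mem_cons_of_mem _ h2⟩

theorem IsDist.le_sum {D : ℝ≥0} (h : G.IsDist wt t u D) : D ≤ ∑ e ∈ G.edges, wt e := by
  classical
  obtain ⟨⟨P, hP, rfl⟩, -⟩ := h
  exact (pathWeight_le_sum wt P hP.2.2.2.2 hP.2.2.1).trans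
    (Finset.sum_le_sum_of_subset (Finset.filter_subset _ _))

theorem IsDist.exists_edge (hG : G.IsAcyclic) (hw : ∀ e ∈ G.edges, wt e = (w e : ℝ≥0)) {D : ℝ≥0}
    (h : G.IsDist wt t u D) (hu : u ≠ t) :
    ∃ z, ∃ D' : ℕ, (u, z) ∈ G.edges ∧ G.IsDist wt t z D' ∧ D = wt (u, z) + D' := by
  obtain ⟨⟨P, hP, rfl⟩, hmin⟩ := h
  rcases hP.cases with ⟨rfl, h'⟩ | ⟨z, P, rfl⟩
  · exact absurd h' hu
  · obtain ⟨-, he, hP'⟩ := (isPath_cons_cons hG).1 hP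
    obtain ⟨D', hD'⟩ := exists_isDist hw hP'
    refine ⟨z, D', he, hD', le_antisymm ?_ ?_⟩
    · obtain ⟨⟨Q, hQ, hQD⟩, -⟩ := hD'
      obtain ⟨Q, rfl⟩ := hQ.exists_cons
      rw [← hQD]
      exact hmin (u :: z :: Q) ((isPath_cons_cons hG).2 ⟨rfl, he, hQ⟩)
    · rw [pathWeight]
      gcongr
      exact hD'.2 _ hP'

theorem lev_le_of_isPath {lev : V → ℕ} (hG : G.IsAcyclic)
    (hlev : ∀ e ∈ G.edges, lev e.1 < lev e.2) (P : List V) (h : G.IsPath P u t) :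
    lev u ≤ lev t := by
  induction P generalizing u with
  | nil => simp [IsPath] at h
  | cons a P ih =>
    cases P with
    | nil =>
      obtain ⟨rfl, rfl, -⟩ := isPath_singleton.1 h
      exact le_rfl
    | cons v P =>
      obtain ⟨rfl, he, hP⟩ := (isPath_cons_cons hG).1 h
      exact (hlev _ he).le.trans (ih hP)

end FinDigraph

namespace PlanningModel

variable {V : Type*}

theorem SurelyReaches.exists_isDist {M : PlanningModel V} {w : V × V → ℕ}
    (hw : ∀ e ∈ M.G.edges, M.w e = (w e : ℝ≥0)) {u : V} (h : M.SurelyReaches u) :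
    ∃ D : ℕ, M.G.IsDist M.w M.t u D := by
  cases h with
  | target => exact ⟨0, by simpa using FinDigraph.isDist_target M.t_mem⟩
  | step u hne hstay hnext =>
    by_contra hc
    have : IsEmpty {P : List V // M.G.IsPath P u M.t} :=
      ⟨fun P => hc (FinDigraph.exists_isDist hw P.2)⟩
    rw [perceivedCost, iInf_of_empty] at hstay
    exact absurd hstay (by simp)

/-- The next step of a motivated agent, compared with the first edge of a shortest path. -/
theorem SurelyReaches.exists_step {M : PlanningModel V} {w : V × V → ℕ}
    (hw : ∀ e ∈ M.G.edges, M.w e = (w e : ℝ≥0)) {u : V} (h : M.SurelyReaches u) (hu : u ≠ M.t) :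
    ∃ y z, ∃ a b : ℕ, (u, y) ∈ M.G.edges ∧ (u, z) ∈ M.G.edges ∧ M.G.IsDist M.w M.t y a ∧
      M.G.IsDist M.w M.t z b ∧ M.G.IsDist M.w M.t u (M.w (u, z) + b) ∧ M.SurelyReaches y ∧
      M.b * M.w (u, y) + a ≤ M.r ∧
      ((y = z ∧ a = b) ∨ M.b * M.w (u, y) + a < M.b * M.w (u, z) + b) := by
  classical
  obtain ⟨D, hD⟩ := h.exists_isDist hw
  obtain ⟨z, b, hz, hb, rfl'⟩ := hD.exists_edge M.acyclic hw hu
  -- `δ` is the distance to the target; where there is no path its value is irrelevant, and `N`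
  -- below excludes such heads.
  have hex : ∀ v, ∃ a : ℕ, (∃ D : ℕ, M.G.IsDist M.w M.t v D) → M.G.IsDist M.w M.t v a := by
    intro v
    by_cases hv : ∃ D : ℕ, M.G.IsDist M.w M.t v D
    · exact ⟨hv.choose, fun _ => hv.choose_spec⟩
    · exact ⟨0, fun hv' => absurd hv' hv⟩
  choose δ hδ using hex
  let N := M.G.edges.filter (fun e => e.1 = u ∧ ∃ D : ℕ, M.G.IsDist M.w M.t e.2 D)
  have hzN : (u, z) ∈ N := Finset.mem_filter.2 ⟨hz, rfl, b, hb⟩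
  obtain ⟨⟨u', y⟩, hyN, hmin⟩ := N.exists_min_image (fun e => M.b * M.w e + (δ e.2 : ℝ≥0)) ⟨_, hzN⟩
  obtain ⟨hy, hu', hyD⟩ := Finset.mem_filter.1 hyN
  obtain rfl : u' = u := hu'
  have hzδ : δ z = b := by
    have := (hδ z ⟨b, hb⟩).unique hb
    exact_mod_cast this
  -- The edge to `y` minimizes `b * w + δ` over the usable edges, which is a lower bound for every
  -- perceived path cost.
  have hcost : ((M.b * M.w (u', y) + δ y : ℝ≥0) : ℝ≥0∞) ≤ M.perceivedCost u' := by
    refine le_iInf fun P => ?_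
    obtain ⟨P, hP⟩ := P
    rcases hP.cases with ⟨rfl, h'⟩ | ⟨v, P, rfl⟩
    · exact absurd h' hu
    · obtain ⟨-, he, hP'⟩ := (FinDigraph.isPath_cons_cons M.acyclic).1 hP
      have hvD := FinDigraph.exists_isDist hw hP'
      have h1 := hmin (u', v) (Finset.mem_filter.2 ⟨he, rfl, hvD⟩)
      refine ENNReal.coe_le_coe.2 (h1.trans ?_)
      rw [perceivedPathCost]
      gcongr
      exact (hδ v hvD).2 _ hP'
  have hmove : ∀ v, (u', v) ∈ M.G.edges → ∀ a : ℕ, M.G.IsDist M.w M.t v a →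
      M.b * M.w (u', v) + (a : ℝ≥0) ≤ M.b * M.w (u', y) + δ y →
      M.SurelyReaches v ∧ M.b * M.w (u', v) + a ≤ M.r := by
    intro v hv a ha hle
    obtain ⟨⟨P, hP, hPa⟩, -⟩ := ha
    obtain ⟨P, rfl⟩ := hP.exists_cons
    have hP' : M.G.IsPath (u' :: v :: P) u' M.t :=
      (FinDigraph.isPath_cons_cons M.acyclic).2 ⟨rfl, hv, hP⟩
    have heq : (perceivedPathCost M.b M.w (u' :: v :: P) : ℝ≥0∞) = M.perceivedCost u' := by
      refine le_antisymm (le_trans ?_ hcost) (perceivedCost_le hP')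
      rw [perceivedPathCost, hPa]
      exact ENNReal.coe_le_coe.2 hle
    cases h with
    | target => exact absurd rfl hu
    | step _ hne hstay hnext =>
      refine ⟨hnext v ⟨P, hP', heq⟩, ?_⟩
      rw [← heq, perceivedPathCost, hPa] at hstay
      exact ENNReal.coe_le_coe.1 hstay
  rw [rfl'] at hD
  -- Ties are resolved in favour of the shortest path: if its first edge is also one the agent may
  -- take, no branching is needed.
  by_cases hle : M.b * M.w (u', z) + (b : ℝ≥0) ≤ M.b * M.w (u', y) + δ y
  · obtain ⟨h1, h2⟩ := hmove z hz b hb hle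
    exact ⟨z, z, b, b, hz, hz, hb, hb, hD, h1, h2, .inl ⟨rfl, rfl⟩⟩
  · obtain ⟨h1, h2⟩ := hmove y hy (δ y) (hδ y hyD) le_rfl
    exact ⟨y, z, δ y, b, hy, hz, hδ y hyD, hb, hD, h1, h2, .inr (not_le.1 hle)⟩

/-- Two positions with the same first `m` pebbles. -/
def Agree (m : ℕ) (p q : Position V) : Prop :=
  p.c = q.c ∧ ∀ j, j < m → p.v j = q.v j ∧ p.d j = q.d j

/-- Codes record only the first `m` pebbles, so a move has to be insensitive to the others. -/
theorem Move.congr {M : PlanningModel V} {w : V × V → ℕ} {lev : V → ℕ} {m : ℕ} (hm : 0 < m)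
    {p q q' : Position V} (h : M.Move w lev m p q) (ha : Agree m q q') : M.Move w lev m p q' := by
  obtain ⟨x, y, hxy, hxt, hi, hmin, hstay, hcase⟩ := h
  obtain ⟨hc, hvd⟩ := ha
  refine ⟨x, y, hxy, hxt, hi, hmin, fun j hj hne => ?_, ?_⟩
  · rw [← (hvd j hj).1, ← (hvd j hj).2]; exact hstay j hj hne
  · rw [← hc, ← (hvd 0 hm).2]
    refine hcase.imp ?_ ?_
    · rintro ⟨h1, h2, h3⟩
      refine ⟨h1, fun j hj => ?_, h3⟩
      rw [← (hvd j hj).1, ← (hvd j hj).2]; exact h2 j hj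
    · rintro ⟨h1, h2, h3, h4, h5, h6, h7, h8⟩
      refine ⟨h1, h2, h3, h4, h5, h6, fun j hj => ?_, ?_⟩
      · rw [← (hvd j hj).1, ← (hvd j hj).2]; exact h7 j hj
      · rw [← (hvd _ h3).1, ← (hvd _ h3).2]; exact h8

/-- The position is consistent with a motivating subgraph `M'.G` of `M.G`. -/
structure Tracks (M' : PlanningModel V) (lev : V → ℕ) (m : ℕ) (p : Position V) : Prop where
  dist : ∀ i < m, M'.G.IsDist M'.w M'.t (p.v i) (p.d i)
  reaches : M'.SurelyReaches (p.v 0)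
  fresh : ∀ i < m, p.c < i → p.v i = p.v 0
  count : p.c + (M'.G.branching.filter (fun u => lev (p.v 0) ≤ lev u)).card < m

theorem Tracks.congr {M' : PlanningModel V} {lev : V → ℕ} {m : ℕ} (hm : 0 < m)
    {p q : Position V} (h : M'.Tracks lev m p) (ha : Agree m p q) : M'.Tracks lev m q := by
  obtain ⟨hc, hvd⟩ := ha
  have h0 := (hvd 0 hm).1
  refine ⟨fun i hi => ?_, h0 ▸ h.reaches, fun i hi hci => ?_, ?_⟩
  · rw [← (hvd i hi).1, ← (hvd i hi).2]; exact h.dist i hi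
  · rw [← (hvd i hi).1, ← h0]; exact h.fresh i hi (hc ▸ hci)
  · rw [← hc, ← h0]; exact h.count

/-- How far the pebbles still are from the top level `L`. -/
def remaining (lev : V → ℕ) (L m : ℕ) (p : Position V) : ℕ :=
  ∑ j ∈ Finset.range m, (L - lev (p.v j))

theorem remaining_congr {lev : V → ℕ} {L m : ℕ} {p q : Position V} (ha : Agree m p q) :
    remaining lev L m p = remaining lev L m q :=
  Finset.sum_congr rfl fun j hj => by rw [(ha.2 j (Finset.mem_range.1 hj)).1]

/-- The claims are kept equal to the distances in the subgraph, and the unused pebbles, those with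
an index above `p.c`, accompany the agent. A pebble is split off only at a branching vertex of the
subgraph. The agent then leaves its level for good, so the branching vertices still ahead of him
decrease by at least one while the counter grows by one; `count` thus guarantees that an unused
pebble is available. -/
theorem Tracks.exists_move {M M' : PlanningModel V} {w : V × V → ℕ} {lev : V → ℕ} {m L : ℕ}
    (hE : M'.G.edges ⊆ M.G.edges) (hMw : M'.w = M.w) (ht : M'.t = M.t) (hb : M'.b = M.b)
    (hr : M'.r = M.r) (hw : ∀ e ∈ M.G.edges, M.w e = (w e : ℝ≥0))
    (hlev : ∀ e ∈ M.G.edges, lev e.1 < lev e.2) (hL : ∀ v ∈ M'.G.verts, lev v ≤ L) (hm : 0 < m)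
    {p : Position V} (h : M'.Tracks lev m p) :
    M.Final m p ∨ ∃ q, M.Move w lev m p q ∧ M'.Tracks lev m q ∧
      remaining lev L m q < remaining lev L m p := by
  classical
  have hw' : ∀ e ∈ M'.G.edges, M'.w e = (w e : ℝ≥0) := fun e he => hMw ▸ hw e (hE he)
  have hlev' : ∀ e ∈ M'.G.edges, lev e.1 < lev e.2 := fun e he => hlev e (hE he)
  have hbt : M'.G.IsDist M'.w M'.t M'.t 0 := FinDigraph.isDist_target M'.t_mem
  by_cases hfin : ∀ j < m, p.v j = M.t
  · refine .inl ⟨by have := h.count; omega, fun j hj => ⟨hfin j hj, ?_⟩⟩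
    have h1 := h.dist j hj
    rw [hfin j hj, ← ht] at h1
    exact_mod_cast h1.unique hbt
  right
  push Not at hfin
  obtain ⟨j₀, hj₀, hj₀t⟩ := hfin
  obtain ⟨i, hi, himin⟩ := ((Finset.range m).filter (fun j => p.v j ≠ M.t)).exists_min_image
    (fun j => lev (p.v j)) ⟨j₀, by simp [hj₀, hj₀t]⟩
  obtain ⟨him, hit⟩ := Finset.mem_filter.1 hi
  rw [Finset.mem_range] at him
  obtain ⟨x, hx⟩ : ∃ x, p.v i = x := ⟨_, rfl⟩
  rw [hx] at hit himin
  -- The minimum was taken over the pebbles outside the target. Those on the target do no harm,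
  -- since the target is reachable from `x`.
  have hmin : ∀ j, j < m → lev x ≤ lev (p.v j) := fun j hj => by
    by_cases hjt : p.v j = M.t
    · have hxd := h.dist i him
      rw [hx] at hxd
      obtain ⟨⟨P, hP, -⟩, -⟩ := hxd
      rw [hjt, ← ht]
      exact FinDigraph.lev_le_of_isPath M'.acyclic hlev' P hP
    · exact himin j (by simp [hj, hjt])
  have hrem : ∀ q : Position V, (∀ j < m, q.v j = p.v j ∨ (p.v j = x ∧ (x, q.v j) ∈ M'.G.edges)) →
      (x, q.v i) ∈ M'.G.edges → remaining lev L m q < remaining lev L m p := by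
    intro q hq hqi
    refine Finset.sum_lt_sum (fun j hj => ?_) ⟨i, Finset.mem_range.2 him, ?_⟩
    · rcases hq j (Finset.mem_range.1 hj) with h1 | ⟨h1, h2⟩
      · rw [h1]
      · have := hlev' _ h2
        rw [h1]
        dsimp at this
        omega
    · have h1 := hlev' _ hqi
      have h2 := hL _ (M'.G.mem_verts _ hqi).2
      rw [hx]
      dsimp at h1 h2
      omega
  -- moving all pebbles on `x` together
  have together : ∀ z, ∀ b : ℕ, (x, z) ∈ M'.G.edges → M'.G.IsDist M'.w M'.t z b →
      M'.G.IsDist M'.w M'.t x (M'.w (x, z) + b) →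
      (p.v 0 = x → M'.SurelyReaches z ∧ M'.b * M'.w (x, z) + b ≤ M'.r) →
      ∃ q, M.Move w lev m p q ∧ M'.Tracks lev m q ∧
        remaining lev L m q < remaining lev L m p := by
    intro z b hz hzb hxb h0
    let q : Position V :=
      ⟨fun j => if p.v j = x then z else p.v j, fun j => if p.v j = x then b else p.d j, p.c⟩
    have hq1 : ∀ j, p.v j = x → q.v j = z ∧ q.d j = b := fun j hj => by simp [q, hj]
    have hq2 : ∀ j, p.v j ≠ x → q.v j = p.v j ∧ q.d j = p.d j := fun j hj => by simp [q, hj]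
    refine ⟨q, ⟨x, z, hE hz, hit, ⟨i, him, hx⟩, hmin, fun j _ => hq2 j,
      .inl ⟨rfl, fun j hj hjx => ⟨(hq1 j hjx).1, ?_⟩, fun h0x => ?_⟩⟩, ⟨?_, ?_, ?_, ?_⟩,
      hrem q (fun j hj => ?_) ?_⟩
    · have h1 := h.dist j hj
      rw [hjx] at h1
      have h2 := hxb.unique h1
      rw [hw' _ hz] at h2
      rw [(hq1 j hjx).2, add_comm]
      exact_mod_cast h2
    · have h1 := (h0 h0x).2
      rw [hb, hr, hw' _ hz, ← NNReal.coe_le_coe] at h1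
      push_cast at h1
      rw [(hq1 0 h0x).2]
      linarith
    · intro j hj
      by_cases hjx : p.v j = x
      · rw [(hq1 j hjx).1, (hq1 j hjx).2]; exact hzb
      · rw [(hq2 j hjx).1, (hq2 j hjx).2]; exact h.dist j hj
    · by_cases hjx : p.v 0 = x
      · rw [(hq1 0 hjx).1]; exact (h0 hjx).1
      · rw [(hq2 0 hjx).1]; exact h.reaches
    · intro j hj hcj
      have := h.fresh j hj hcj
      simp [q, this]
    · refine lt_of_le_of_lt (Nat.add_le_add_left (Finset.card_le_card ?_) _) h.count
      refine Finset.monotone_filter_right _ (fun u _ hu => le_trans ?_ hu)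
      by_cases hjx : p.v 0 = x
      · rw [(hq1 0 hjx).1, hjx]; exact (hlev' _ hz).le
      · rw [(hq2 0 hjx).1]
    · by_cases hjx : p.v j = x
      · right; rw [(hq1 j hjx).1]; exact ⟨hjx, hz⟩
      · exact .inl (hq2 j hjx).1
    · rw [(hq1 i hx).1]; exact hz
  by_cases h0x : p.v 0 = x
  · have hsr := h.reaches
    rw [h0x] at hsr
    obtain ⟨y, z, a, b, hy, hz, hya, hzb, hxb, hys, hyr, hcase⟩ := hsr.exists_step hw' (ht ▸ hit)
    rcases hcase with ⟨rfl, rfl⟩ | hlt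
    · exact together y a hz hzb hxb (fun _ => ⟨hys, hyr⟩)
    by_cases hyz : y = z
    · subst hyz
      exact together y a hy hya (by rwa [hya.unique hzb]) (fun _ => ⟨hys, hyr⟩)
    -- The agent's edge and the shortest one are now distinct edges of the subgraph.
    have hxbr : x ∈ M'.G.branching := by
      refine Finset.mem_filter.2 ⟨(M'.G.mem_verts _ hy).1, ?_⟩
      have hsub : ({(x, y), (x, z)} : Finset (V × V)) ⊆ M'.G.edges.filter (fun e => e.1 = x) := by
        intro e he
        rcases Finset.mem_insert.1 he with rfl | he
        · exact Finset.mem_filter.2 ⟨hy, rfl⟩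
        · rw [Finset.mem_singleton.1 he]; exact Finset.mem_filter.2 ⟨hz, rfl⟩
      have := Finset.card_le_card hsub
      rw [Finset.card_pair (by simpa using hyz)] at this
      unfold FinDigraph.outDegree
      convert this
    have hcount := h.count
    have hcard : (M'.G.branching.filter (fun u => lev y ≤ lev u)).card + 1 ≤
        (M'.G.branching.filter (fun u => lev (p.v 0) ≤ lev u)).card := by
      rw [h0x, ← Finset.card_insert_of_notMem (a := x)]
      · refine Finset.card_le_card fun u hu => ?_
        rcases Finset.mem_insert.1 hu with rfl | hu
        · exact Finset.mem_filter.2 ⟨hxbr, le_rfl⟩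
        · obtain ⟨h1, h2⟩ := Finset.mem_filter.1 hu
          exact Finset.mem_filter.2 ⟨h1, (hlev' _ hy).le.trans h2⟩
      · intro hc
        exact absurd (Finset.mem_filter.1 hc).2 (hlev' _ hy).not_ge
    have hcm : p.c + 1 < m := by omega
    have hpc : p.v (p.c + 1) = x := (h.fresh _ hcm (Nat.lt_succ_self _)).trans h0x
    have hpd : ∀ j < m, p.v j = x → p.d j = w (x, z) + b := fun j hj hjx => by
      have h1 := h.dist j hj
      rw [hjx] at h1
      have h2 := h1.unique hxb
      rw [hw' _ hz] at h2
      exact_mod_cast h2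
    let q : Position V :=
      ⟨fun j => if p.v j = x then (if j = p.c + 1 then z else y) else p.v j,
        fun j => if p.v j = x then (if j = p.c + 1 then b else a) else p.d j, p.c + 1⟩
    have hq1 : ∀ j, p.v j = x → j ≠ p.c + 1 → q.v j = y ∧ q.d j = a := fun j hj hjc => by
      simp [q, hj, hjc]
    have hq2 : ∀ j, p.v j ≠ x → q.v j = p.v j ∧ q.d j = p.d j := fun j hj => by simp [q, hj]
    have hq3 : q.v (p.c + 1) = z ∧ q.d (p.c + 1) = b := by simp [q, hpc]
    have hq0 := hq1 0 h0x (by omega)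
    refine ⟨q, ⟨x, y, hE hy, hit, ⟨i, him, hx⟩, hmin, fun j _ => hq2 j, .inr
      ⟨h0x, rfl, hcm, hpc, ?_, ?_, fun j hj hjx => ⟨?_, fun hjc => ?_⟩, z, hE hz, hq3.1, ?_, ?_⟩⟩,
      ⟨?_, ?_, ?_, ?_⟩, hrem q (fun j hj => ?_) ?_⟩
    · rw [hb, hr, hw' _ hy, ← NNReal.coe_le_coe] at hyr
      push_cast at hyr
      rw [hq0.2]
      linarith
    · have h1 := hxb.2
      obtain ⟨⟨P, hP, hPa⟩, -⟩ := hya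
      obtain ⟨P, rfl⟩ := hP.exists_cons
      have h2 := h1 (x :: y :: P) ((FinDigraph.isPath_cons_cons M'.acyclic).2 ⟨rfl, hy, hP⟩)
      rw [pathWeight, hPa, hw' _ hy, hw' _ hz] at h2
      rw [hq0.2, hpd 0 hm h0x, add_comm a]
      exact_mod_cast h2
    · rw [hpd j hj hjx, hpd 0 hm h0x]
    · rw [hq0.2]; exact hq1 j hjx hjc
    · rw [hpd 0 hm h0x]
      show q.d (p.c + 1) + _ = _
      rw [hq3.2, add_comm]
    · rw [hb, hw' _ hy, hw' _ hz, ← NNReal.coe_lt_coe] at hlt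
      push_cast at hlt
      show _ < _ + (q.d (p.c + 1) : ℝ)
      rw [hq3.2, hq0.2]
      linarith
    · intro j hj
      by_cases hjx : p.v j = x
      · by_cases hjc : j = p.c + 1
        · rw [hjc, hq3.1, hq3.2]; exact hzb
        · rw [(hq1 j hjx hjc).1, (hq1 j hjx hjc).2]; exact hya
      · rw [(hq2 j hjx).1, (hq2 j hjx).2]; exact h.dist j hj
    · rw [hq0.1]; exact hys
    · intro j hj hcj
      have hcj' : p.c + 1 < j := hcj
      rw [hq0.1]
      exact (hq1 j ((h.fresh j hj (by omega)).trans h0x) (by omega)).1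
    · show p.c + 1 + _ < m
      rw [hq0.1]
      omega
    · by_cases hjx : p.v j = x
      · right
        refine ⟨hjx, ?_⟩
        by_cases hjc : j = p.c + 1
        · rw [hjc, hq3.1]; exact hz
        · rw [(hq1 j hjx hjc).1]; exact hy
      · exact .inl (hq2 j hjx).1
    · by_cases hjc : i = p.c + 1
      · rw [hjc, hq3.1]; exact hz
      · rw [(hq1 i hx hjc).1]; exact hy
  · have hxd := h.dist i him
    rw [hx] at hxd
    obtain ⟨z, b, hz, hzb, hD⟩ := hxd.exists_edge M'.acyclic hw' (ht ▸ hit)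
    exact together z b hz hzb (hD ▸ hxd) (fun h => absurd h h0x)

/-- A simple motivating subgraph guides a play of the pebble game. -/
theorem exists_tracks {M : PlanningModel V} {w : V × V → ℕ} {lev : V → ℕ} {k L : ℕ}
    (hw : ∀ e ∈ M.G.edges, M.w e = (w e : ℝ≥0)) (hlev : ∀ e ∈ M.G.edges, lev e.1 < lev e.2)
    (hL : ∀ v ∈ M.G.verts, lev v ≤ L) (h : M.HasSimpleMotivatingSubgraph k) :
    ∃ R : Position V → Prop, (∃ p, R p ∧ M.Initial (k + 1) p) ∧
      (∀ p q, R p → Agree (k + 1) p q → R q) ∧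
      (∀ p, R p → p.c < k + 1 ∧
        ∀ j < k + 1, p.v j ∈ M.G.verts ∧ p.d j ≤ ∑ e ∈ M.G.edges, w e) ∧
      ∀ p, R p → M.Final (k + 1) p ∨ ∃ q, M.Move w lev (k + 1) p q ∧ R q ∧
        remaining lev L (k + 1) q < remaining lev L (k + 1) p := by
  obtain ⟨G', ⟨hsub, hs, ht, hmot⟩, hbr⟩ := h
  have hw' : ∀ e ∈ G'.edges, M.w e = (w e : ℝ≥0) := fun e he => hw e (hsub.2 he)
  refine ⟨(M.restrict G' hsub hs ht).Tracks lev (k + 1), ?_, fun p q hp ha =>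
    hp.congr (Nat.succ_pos _) ha, fun p hp => ⟨?_, fun j hj => ⟨?_, ?_⟩⟩, fun p hp =>
    Tracks.exists_move (M := M) (M' := M.restrict G' hsub hs ht) hsub.2 rfl rfl rfl rfl hw hlev (fun v hv => hL v (hsub.1 hv)) (Nat.succ_pos _) hp⟩
  · obtain ⟨D, hD⟩ := SurelyReaches.exists_isDist (M := M.restrict G' hsub hs ht) hw' hmot
    refine ⟨⟨fun _ => M.s, fun _ => D, 0⟩, ⟨fun _ _ => hD, hmot, fun _ _ _ => rfl, ?_⟩,
      rfl, fun _ _ => rfl⟩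
    have := Finset.card_filter_le G'.branching (fun u => lev M.s ≤ lev u)
    show 0 + (G'.branching.filter (fun u => lev M.s ≤ lev u)).card < k + 1
    omega
  · have := hp.count
    omega
  · exact hsub.1 (hp.dist j hj).mem_verts
  · have h1 := (hp.dist j hj).le_sum
    have h2 : ∑ e ∈ G'.edges, M.w e ≤ ((∑ e ∈ M.G.edges, w e : ℕ) : ℝ≥0) := by
      rw [Nat.cast_sum, ← Finset.sum_congr rfl hw]
      exact Finset.sum_le_sum_of_subset hsub.2
    exact_mod_cast h1.trans h2

/-- The number of branching vertices is at most the number of vertices. -/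
theorem hasSimpleMotivatingSubgraph_min {M : PlanningModel V} {k : ℕ} :
    M.HasSimpleMotivatingSubgraph (min k M.G.verts.card) ↔ M.HasSimpleMotivatingSubgraph k := by
  refine exists_congr fun G' => and_congr_right ?_
  rintro ⟨hsub, -⟩
  have : G'.branching.card ≤ M.G.verts.card :=
    Finset.card_le_card ((Finset.filter_subset _ _).trans hsub.1)
  simp [this]

end PlanningModel

open RealRAM (layer)

/-! ### Levels -/

/-- Levels of an acyclic digraph, given by the lengths of the walks that end in a vertex. -/
theorem PlanningModel.exists_lev (M : PlanningModel ℕ) {n : ℕ} (hn : M.G.verts = Finset.range n) :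
    ∃ lev : ℕ → ℕ, (∀ e ∈ M.G.edges, lev e.1 < lev e.2) ∧ (∀ v < n, lev v < n) ∧
      ∀ v < n, ∀ z, layer (fun _ => True) (fun u v => (u, v) ∈ M.G.edges) n z v ↔ z ≤ lev v := by
  classical
  obtain ⟨ord, -, hord⟩ := M.acyclic
  have hlt : ∀ e ∈ M.G.edges, e.1 < n ∧ e.2 < n := fun e he => by
    simpa [hn] using M.G.mem_verts e he
  let Lev := layer (fun _ => True) (fun u v => (u, v) ∈ M.G.edges) n
  -- The values of `ord` may be arbitrarily large. Counting the vertices that come earlier bounds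
  -- the length of a walk ending in `v` by `n - 1`, so the cap in `lev` loses nothing.
  let rank (v : ℕ) : ℕ := ((Finset.range n).filter (fun u => ord u < ord v)).card
  have hrank : ∀ v < n, rank v < n := fun v hv => by
    conv_rhs => rw [← Finset.card_range n]
    refine Finset.card_lt_card (Finset.filter_ssubset.2 ⟨v, by simpa using hv, by simp⟩)
  have hrank' : ∀ e ∈ M.G.edges, rank e.1 < rank e.2 := fun e he => by
    refine Finset.card_lt_card ⟨?_, fun hc => ?_⟩
    · exact Finset.monotone_filter_right _ (fun u _ hu => lt_trans hu (hord e he))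
    · have : e.1 ∈ (Finset.range n).filter (fun u => ord u < ord e.2) := by
        simpa using ⟨(hlt e he).1, hord e he⟩
      simpa using (Finset.mem_filter.1 (hc this)).2
  have hLr : ∀ z v, Lev z v → z ≤ rank v := by
    intro z
    induction z with
    | zero => exact fun _ _ => Nat.zero_le _
    | succ z ih =>
      rintro v ⟨u, -, hu, huv⟩
      have h1 := ih u hu
      have h2 := hrank' _ huv
      dsimp at h2
      omega
  -- Dropping the first vertex of a walk shows that the layers are nested, hence determined by the
  -- greatest one containing `v`.
  have hdown : ∀ z v, Lev (z + 1) v → Lev z v := by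
    intro z
    induction z with
    | zero => exact fun _ _ => trivial
    | succ z ih =>
      rintro v ⟨u, hun, hu, huv⟩
      exact ⟨u, hun, ih u hu, huv⟩
  let lev (v : ℕ) : ℕ := Nat.findGreatest (fun z => Lev z v) (n - 1)
  have hspec : ∀ v, Lev (lev v) v := fun v =>
    Nat.findGreatest_spec (P := fun z => Lev z v) (Nat.zero_le _) trivial
  have hiff : ∀ v < n, ∀ z, Lev z v ↔ z ≤ lev v := by
    intro v hv z
    constructor
    · intro h
      refine Nat.le_findGreatest ?_ h
      have := hLr z v h
      have := hrank v hv
      omega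
    · intro h
      have key : ∀ j, Lev (z + j) v → Lev z v := by
        intro j
        induction j with
        | zero => exact id
        | succ j ih => exact fun h => ih (hdown _ _ h)
      refine key (lev v - z) ?_
      rw [Nat.add_sub_cancel' h]
      exact hspec v
  refine ⟨lev, fun e he => ?_, fun v hv => ?_, hiff⟩
  · exact (hiff e.2 (hlt e he).2 (lev e.1 + 1)).1 ⟨e.1, (hlt e he).1, hspec e.1, he⟩
  · exact (hLr _ _ (hspec v)).trans_lt (hrank v hv)

/-! ### Encoding positions -/

/-- The position with the code `x`, whose digits are found with the help of the table `P` of the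
powers of the base `β`. -/
def codePosition (P : ℕ → ℕ) (β m x : ℕ) : Position ℕ where
  v i := x / P i % β
  d i := x / P (m + i) % β
  c := x / P (2 * m) % β

theorem exists_digits {β : ℕ} (L : ℕ) (g : ℕ → ℕ) (hg : ∀ i < L, g i < β) :
    ∃ x < β ^ L, ∀ i < L, x / β ^ i % β = g i := by
  induction L generalizing g with
  | zero => exact ⟨0, by simp, by simp⟩
  | succ L ih =>
    obtain ⟨x, hx, hd⟩ := ih (fun i => g (i + 1)) (fun i hi => hg _ (by omega))
    have h0 := hg 0 (Nat.succ_pos _)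
    refine ⟨g 0 + β * x, ?_, fun i hi => ?_⟩
    · calc g 0 + β * x < β + β * x := by omega
        _ = β * (x + 1) := by ring
        _ ≤ β * β ^ L := Nat.mul_le_mul_left _ hx
        _ = β ^ (L + 1) := by ring
    · cases i with
      | zero => simp [Nat.add_mul_mod_self_left, Nat.mod_eq_of_lt h0]
      | succ i =>
        rw [← hd i (by omega), pow_succ', ← Nat.div_div_eq_div_mul,
          Nat.add_mul_div_left _ _ (by omega), Nat.div_eq_of_lt h0, zero_add]

theorem exists_codePosition {P : ℕ → ℕ} {β m : ℕ} (hP : ∀ i < 2 * m + 1, P i = β ^ i)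
    (q : Position ℕ) (hc : q.c < β) (hvd : ∀ j < m, q.v j < β ∧ q.d j < β) :
    ∃ x < β ^ (2 * m + 1), PlanningModel.Agree m q (codePosition P β m x) := by
  obtain ⟨x, hx, hd⟩ := exists_digits (β := β) (2 * m + 1)
    (fun i => if i < m then q.v i else if i < 2 * m then q.d (i - m) else q.c) (fun i hi => by
      split_ifs with h1 h2
      · exact (hvd i h1).1
      · exact (hvd _ (by omega)).2
      · exact hc)
  refine ⟨x, hx, ?_, fun j hj => ⟨?_, ?_⟩⟩
  · have := hd (2 * m) (by omega)
    simp only [codePosition]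
    rw [hP _ (by omega), this, if_neg (by omega), if_neg (by omega)]
  · have := hd j (by omega)
    simp only [codePosition]
    rw [hP _ (by omega), this, if_pos hj]
  · have := hd (m + j) (by omega)
    simp only [codePosition]
    rw [hP _ (by omega), this, if_neg (by omega), if_pos (by omega), Nat.add_sub_cancel_left]

namespace PlanningModel

/-- One step between codes of positions: nothing changes or a move is made. -/
def CodeStep (M : PlanningModel ℕ) (n : ℕ) (w : ℕ × ℕ → ℕ) (lev : ℕ → ℕ) (m : ℕ)
    (pos : ℕ → Position ℕ) (x y : ℕ) : Prop :=
  x = y ∨ ((∀ j, j < m → (pos x).v j < n) ∧ M.Move w lev m (pos x) (pos y))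

/-- Simple motivating subgraphs are found by searching through the codes of positions. -/
theorem hasSimpleMotivatingSubgraph_iff_layer {M : PlanningModel ℕ} {n k β : ℕ} {w : ℕ × ℕ → ℕ}
    {lev P : ℕ → ℕ} (hn : M.G.verts = Finset.range n)
    (hw : ∀ e ∈ M.G.edges, M.w e = (w e : ℝ≥0)) (hlev : ∀ e ∈ M.G.edges, lev e.1 < lev e.2)
    (hlevn : ∀ v < n, lev v < n) (hβn : n < β) (hβk : k + 1 < β)
    (hβw : ∑ e ∈ M.G.edges, w e < β) (hP : ∀ i < 2 * (k + 1) + 1, P i = β ^ i) :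
    M.HasSimpleMotivatingSubgraph k ↔ ∃ x, x < β ^ (2 * (k + 1) + 1) ∧
      (layer (fun x => M.Initial (k + 1) (codePosition P β (k + 1) x))
        (M.CodeStep n w lev (k + 1) (codePosition P β (k + 1))) (β ^ (2 * (k + 1) + 1))
        (β ^ (2 * (k + 1) + 1) - 1) x ∧ M.Final (k + 1) (codePosition P β (k + 1) x)) := by
  set N := β ^ (2 * (k + 1) + 1) with hN
  set pos := codePosition P β (k + 1) with hpos
  constructor
  · intro h
    obtain ⟨R, ⟨p, hp, hpi⟩, hcongr, hbd, hstep⟩ := exists_tracks (L := n) hw hlev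
      (fun v hv => (hlevn v (by simpa [hn] using hv)).le) h
    have hcode : ∀ q, R q → ∃ x < N, Agree (k + 1) q (pos x) := fun q hq => by
      obtain ⟨h1, h2⟩ := hbd q hq
      refine exists_codePosition hP q (by omega) fun j hj => ?_
      obtain ⟨h3, h4⟩ := h2 j hj
      rw [hn, Finset.mem_range] at h3
      omega
    -- `r` bounds the number of moves still possible, and exactly `r` further steps are made; a play
    -- that ends early is padded with idle steps.
    have key : ∀ r z x, x < N → R (pos x) → remaining lev n (k + 1) (pos x) ≤ r →
        layer (fun x => M.Initial (k + 1) (pos x)) (M.CodeStep n w lev (k + 1) pos) N z x →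
        ∃ x, x < N ∧ layer (fun x => M.Initial (k + 1) (pos x))
          (M.CodeStep n w lev (k + 1) pos) N (z + r) x ∧ M.Final (k + 1) (pos x) := by
      intro r
      induction r with
      | zero =>
        intro z x hx hR hr hl
        rcases hstep _ hR with hfin | ⟨q, -, -, hlt⟩
        · exact ⟨x, hx, hl, hfin⟩
        · omega
      | succ r ih =>
        intro z x hx hR hr hl
        rw [show z + (r + 1) = (z + 1) + r by ring]
        rcases hstep _ hR with hfin | ⟨q, hmove, hRq, hlt⟩
        · have hpad : ∀ j, layer (fun x => M.Initial (k + 1) (pos x))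
              (M.CodeStep n w lev (k + 1) pos) N (z + j) x := by
            intro j
            induction j with
            | zero => exact hl
            | succ j ihj => exact ⟨x, hx, ihj, .inl rfl⟩
          refine ⟨x, hx, ?_, hfin⟩
          rw [add_assoc]
          exact hpad _
        · obtain ⟨y, hy, hag⟩ := hcode q hRq
          refine ih (z + 1) y hy (hcongr _ _ hRq hag) ?_ ⟨x, hx, hl, .inr ⟨fun j hj => ?_,
            hmove.congr (Nat.succ_pos _) hag⟩⟩
          · rw [← remaining_congr hag]
            omega
          · have := ((hbd _ hR).2 j hj).1
            simpa [hn] using this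
    obtain ⟨x, hx, hag⟩ := hcode p hp
    have := key (N - 1) 0 x hx (hcongr _ _ hp hag) ?_ ?_
    · rwa [zero_add] at this
    · have h1 : remaining lev n (k + 1) (pos x) ≤ (k + 1) * n := by
        refine (Finset.sum_le_card_nsmul _ _ n (fun j _ => Nat.sub_le _ _)).trans ?_
        simp
      have h2 : (k + 1) * n < β * β := Nat.mul_lt_mul'' hβk hβn
      have h3 : β * β ≤ N := by
        rw [hN, ← sq]
        exact Nat.pow_le_pow_right (by omega) (by omega)
      omega
    · exact ⟨hag.1 ▸ hpi.1, fun j hj => (hag.2 j hj).1 ▸ hpi.2 j hj⟩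
  · rintro ⟨x, -, hl, hfin⟩
    have key : ∀ z x, layer (fun x => M.Initial (k + 1) (pos x))
        (M.CodeStep n w lev (k + 1) pos) N z x → ∃ x₀, M.Initial (k + 1) (pos x₀) ∧
          Relation.ReflTransGen (M.Move w lev (k + 1)) (pos x₀) (pos x) := by
      intro z
      induction z with
      | zero => exact fun x h => ⟨x, h, .refl⟩
      | succ z ih =>
        rintro y ⟨x, -, hx, hxy⟩
        obtain ⟨x₀, h1, h2⟩ := ih x hx
        rcases hxy with rfl | ⟨-, hmove⟩
        · exact ⟨x₀, h1, h2⟩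
        · exact ⟨x₀, h1, h2.tail hmove⟩
    obtain ⟨x₀, h1, h2⟩ := key _ _ hl
    exact hasSimpleMotivatingSubgraph_of_moves hw hlev h1 hfin h2

end PlanningModel

namespace RealRAM

/-! ### The formulas of the search

The input registers `0`, …, `4` hold `n, |E(G)|, s, t, k`. Array `2` is a copy of the list of edges,
array `3` the table of powers, array `4` the table of levels, array `5` the table of the search, and
array `6` holds the numbers `3 |E(G)|`, the number of pebbles, the sum of the edge list, the base of
the codes, the number of digits, the number of codes, its square, and `n ^ 2`. -/

/-- The position with code `x`. -/
def Ctx.position (c : Ctx) (x : ℕ) : Position ℕ :=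
  codePosition (c.arr 3) (c.arr 6 3) (c.arr 6 1) x

def edgeFormula (c : Ctx) (u v : ℕ) : Prop :=
  ∃ e, e < c.nat 1 ∧ (c.arr 2 (3 * e) = u ∧ c.arr 2 (3 * e + 1) = v)

/-- Layers are nested, so the levels of two vertices are compared by asking whether each layer that
contains `u` contains `v`. Row `z` of array `4` is layer `z`. -/
def levelFormula (c : Ctx) (u v : ℕ) : Prop :=
  ∀ z, z < c.nat 0 → c.arr 4 (z * c.nat 0 + u) = 1 → c.arr 4 (z * c.nat 0 + v) = 1

/-- `PlanningModel.Move` with the first edge at place `e` of the list. -/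
def moveAlong (c : Ctx) (p q : Position ℕ) (e : ℕ) : Prop :=
  c.arr 2 (3 * e) ≠ c.nat 3 ∧ (∃ i, i < c.arr 6 1 ∧ p.v i = c.arr 2 (3 * e)) ∧
    (∀ j, j < c.arr 6 1 → levelFormula c (c.arr 2 (3 * e)) (p.v j)) ∧
    (∀ j, j < c.arr 6 1 → p.v j ≠ c.arr 2 (3 * e) → q.v j = p.v j ∧ q.d j = p.d j) ∧
    ((q.c = p.c ∧
        (∀ j, j < c.arr 6 1 → p.v j = c.arr 2 (3 * e) →
          q.v j = c.arr 2 (3 * e + 1) ∧ q.d j + c.arr 2 (3 * e + 2) = p.d j) ∧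
        (p.v 0 = c.arr 2 (3 * e) →
          (c.arr 2 (3 * e + 2) : ℝ) * c.real 0 + (q.d 0 : ℝ) ≤ c.real 1)) ∨
      (p.v 0 = c.arr 2 (3 * e) ∧ q.c = p.c + 1 ∧ q.c < c.arr 6 1 ∧ p.v q.c = c.arr 2 (3 * e) ∧
        (c.arr 2 (3 * e + 2) : ℝ) * c.real 0 + (q.d 0 : ℝ) ≤ c.real 1 ∧
        p.d 0 ≤ q.d 0 + c.arr 2 (3 * e + 2) ∧
        (∀ j, j < c.arr 6 1 → p.v j = c.arr 2 (3 * e) → p.d j = p.d 0 ∧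
          (j ≠ q.c → q.v j = c.arr 2 (3 * e + 1) ∧ q.d j = q.d 0)) ∧
        ∃ e', e' < c.nat 1 ∧ (c.arr 2 (3 * e') = c.arr 2 (3 * e) ∧
          q.v q.c = c.arr 2 (3 * e' + 1) ∧ q.d q.c + c.arr 2 (3 * e' + 2) = p.d 0 ∧
          (c.arr 2 (3 * e + 2) : ℝ) * c.real 0 + (q.d 0 : ℝ) <
            (c.arr 2 (3 * e' + 2) : ℝ) * c.real 0 + (q.d q.c : ℝ))))

/-- The digits of a code may exceed `n`. The guard ensures that the table of levels is consulted for
actual vertices only. -/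
def stepFormula (c : Ctx) (x y : ℕ) : Prop :=
  x = y ∨ ((∀ j, j < c.arr 6 1 → (c.position x).v j < c.nat 0) ∧
    ∃ e, e < c.nat 1 ∧ moveAlong c (c.position x) (c.position y) e)

def initFormula (c : Ctx) (x : ℕ) : Prop :=
  (c.position x).c = 0 ∧ ∀ j, j < c.arr 6 1 → (c.position x).v j = c.nat 2

def finalFormula (c : Ctx) (x : ℕ) : Prop :=
  (c.position x).c < c.arr 6 1 ∧
    ∀ j, j < c.arr 6 1 → (c.position x).v j = c.nat 3 ∧ (c.position x).d j = 0

/-- The form is dictated by `Computes.layers`: variable `0` is an index into the table, whose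
remainder is the new number, and variable `1` is its candidate predecessor. -/
theorem decides_edgeFormula : Decides 2 (fun c ρ => edgeFormula c (ρ 1) (ρ 0 % c.nat 0)) := by
  unfold edgeFormula
  refine Decides.ex (Term.inp 1 (by norm_num)) (fun X c ρ h => h.nat _) ?_
  refine (Decides.eq ?_ ?_).and (Decides.eq ?_ ?_)
  all_goals repeat' first
    | exact Term.var _ | exact Term.const _ | exact Term.inp _ (by norm_num)
    | apply Term.add | apply Term.mul | apply Term.mod | apply Term.arr _ (by norm_num)

theorem decides_initFormula : Decides 1 (fun c ρ => initFormula c (ρ 0)) := by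
  unfold initFormula Ctx.position codePosition
  refine (Decides.eq ?_ ?_).and (Decides.all ?_ (fun X c ρ h => h.arr _ _) (Decides.eq ?_ ?_))
  all_goals repeat' first
    | exact Term.var _ | exact Term.const _ | exact Term.inp _ (by norm_num)
    | apply Term.add | apply Term.mul | apply Term.mod | apply Term.div
    | apply Term.arr _ (by norm_num)

theorem decides_finalFormula : Decides 1 (fun c ρ => finalFormula c (ρ 0)) := by
  unfold finalFormula Ctx.position codePosition
  refine (Decides.lt ?_ ?_).and (Decides.all ?_ (fun X c ρ h => h.arr _ _)
    ((Decides.eq ?_ ?_).and (Decides.eq ?_ ?_)))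
  all_goals repeat' first
    | exact Term.var _ | exact Term.const _ | exact Term.inp _ (by norm_num)
    | apply Term.add | apply Term.mul | apply Term.mod | apply Term.div
    | apply Term.arr _ (by norm_num)

/-- The proof retraces the syntax of the formula. All quantifiers are bounded by a register or an
array entry, hence by `X`; the remaining goals are terms. -/
theorem decides_stepFormula :
    Decides 2 (fun c ρ => stepFormula c (ρ 1) (ρ 0 % c.arr 6 5)) := by
  unfold stepFormula moveAlong levelFormula Ctx.position codePosition
  dsimp only
  refine Decides.or (Decides.eq ?_ ?_) (Decides.and
    (Decides.all ?_ (fun X c ρ h => h.arr _ _) (Decides.lt ?_ ?_))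
    (Decides.ex ?_ (fun X c ρ h => h.nat _) (Decides.and (Decides.eq ?_ ?_).not
      (Decides.and (Decides.ex ?_ (fun X c ρ h => h.arr _ _) (Decides.eq ?_ ?_))
      (Decides.and (Decides.all ?_ (fun X c ρ h => h.arr _ _)
        (Decides.all ?_ (fun X c ρ h => h.nat _) (Decides.imp (Decides.eq ?_ ?_)
          (Decides.eq ?_ ?_))))
      (Decides.and (Decides.all ?_ (fun X c ρ h => h.arr _ _) (Decides.imp (Decides.eq ?_ ?_).not
        (Decides.and (Decides.eq ?_ ?_) (Decides.eq ?_ ?_))))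
      (Decides.or ?nonbranching ?branching)))))))
  case nonbranching =>
    refine Decides.and (Decides.eq ?_ ?_) (Decides.and
      (Decides.all ?_ (fun X c ρ h => h.arr _ _) (Decides.imp (Decides.eq ?_ ?_)
        (Decides.and (Decides.eq ?_ ?_) (Decides.eq ?_ ?_))))
      (Decides.imp (Decides.eq ?_ ?_)
        (Decides.real_le (RealTerm.add (RealTerm.smul ?_ (RealTerm.inp 0)) (RealTerm.ofNat ?_))
          (RealTerm.inp 1))))
    all_goals repeat' first
      | exact Term.var _ | exact Term.const _ | exact Term.inp _ (by norm_num)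
      | apply Term.add | apply Term.mul | apply Term.mod | apply Term.div
      | apply Term.arr _ (by norm_num)
  case branching =>
    refine Decides.and (Decides.eq ?_ ?_) (Decides.and (Decides.eq ?_ ?_)
      (Decides.and (Decides.lt ?_ ?_) (Decides.and (Decides.eq ?_ ?_) (Decides.and
      (Decides.real_le (RealTerm.add (RealTerm.smul ?_ (RealTerm.inp 0)) (RealTerm.ofNat ?_))
          (RealTerm.inp 1)) (Decides.and (Decides.le ?_ ?_) (Decides.and
      (Decides.all ?_ (fun X c ρ h => h.arr _ _) (Decides.imp (Decides.eq ?_ ?_)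
        (Decides.and (Decides.eq ?_ ?_) (Decides.imp (Decides.eq ?_ ?_).not
          (Decides.and (Decides.eq ?_ ?_) (Decides.eq ?_ ?_))))))
      (Decides.ex ?_ (fun X c ρ h => h.nat _) (Decides.and (Decides.eq ?_ ?_)
        (Decides.and (Decides.eq ?_ ?_) (Decides.and (Decides.eq ?_ ?_)
          (Decides.real_lt (RealTerm.add (RealTerm.smul ?_ (RealTerm.inp 0)) (RealTerm.ofNat ?_))
            (RealTerm.add (RealTerm.smul ?_ (RealTerm.inp 0)) (RealTerm.ofNat ?_)))))))))))))
    all_goals repeat' first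
      | exact Term.var _ | exact Term.const _ | exact Term.inp _ (by norm_num)
      | apply Term.add | apply Term.mul | apply Term.mod | apply Term.div
      | apply Term.arr _ (by norm_num)
  all_goals repeat' first
    | exact Term.var _ | exact Term.const _ | exact Term.inp _ (by norm_num)
    | apply Term.add | apply Term.mul | apply Term.mod | apply Term.div
    | apply Term.arr _ (by norm_num)

/-- An instance of Simple Motivating Subgraph with integer weights. -/
structure Instance where
  M : PlanningModel ℕ
  n : ℕ
  w : ℕ × ℕ → ℕ
  es : List (ℕ × ℕ)
  k : ℕ
  verts_eq : M.G.verts = Finset.range n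
  weight_eq : ∀ e ∈ M.G.edges, M.w e = (w e : ℝ≥0)
  nodup : es.Nodup
  edges_eq : es.toFinset = M.G.edges

namespace Instance

variable (I : Instance)

/-- The number of edges. -/
def m : ℕ := I.es.length

/-- The number of branching vertices that is allowed, at most the number of vertices. -/
def k' : ℕ := I.k - (I.k - I.n)

/-- The initial memory. -/
noncomputable def input : State := I.M.input I.n I.w I.es I.k

/-- The sum of the first `j` numbers of the edge list. -/
noncomputable def partialSum (j : ℕ) : ℕ := ∑ i ∈ Finset.range j, I.input.nat (5 + i)

/-- The base of the codes of positions. -/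
noncomputable def β : ℕ := I.partialSum (3 * I.m) + I.n + (I.k' + 1) + 1

/-- The number of digits of the codes. -/
def digits : ℕ := 2 * (I.k' + 1) + 1

/-- The number of codes. -/
noncomputable def N : ℕ := I.β ^ I.digits

/-- A bound for all numbers that occur in the computation. -/
noncomputable def X : ℕ :=
  I.n + I.m * 3 + I.k + I.β + I.digits + I.N + I.N * I.N + I.n * I.n + 2

/-- The contexts in the course of the computation. -/
noncomputable def ctx (A₂ A₃ A₄ A₅ : ℕ → ℕ) (l : List ℕ) : Ctx where
  nat := I.input.nat
  real := I.input.real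
  arr a := match a with
    | 2 => A₂
    | 3 => A₃
    | 4 => A₄
    | 5 => A₅
    | 6 => fun j => l.getD j 0
    | _ => fun _ => 0

variable {I} {A₂ A₃ A₄ A₅ : ℕ → ℕ} {l : List ℕ}

theorem ctx_set_two (f : ℕ → ℕ) : (I.ctx A₂ A₃ A₄ A₅ l).set 2 f = I.ctx f A₃ A₄ A₅ l := by
  simp only [Ctx.set, ctx, Ctx.mk.injEq, true_and]
  funext a
  by_cases h : a = 2
  · subst h; rw [Function.update_self]; rfl
  · rw [Function.update_of_ne h]; split <;> simp_all

theorem ctx_set_three (f : ℕ → ℕ) : (I.ctx A₂ A₃ A₄ A₅ l).set 3 f = I.ctx A₂ f A₄ A₅ l := by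
  simp only [Ctx.set, ctx, Ctx.mk.injEq, true_and]
  funext a
  by_cases h : a = 3
  · subst h; rw [Function.update_self]; rfl
  · rw [Function.update_of_ne h]; split <;> simp_all

theorem ctx_set_four (f : ℕ → ℕ) : (I.ctx A₂ A₃ A₄ A₅ l).set 4 f = I.ctx A₂ A₃ f A₅ l := by
  simp only [Ctx.set, ctx, Ctx.mk.injEq, true_and]
  funext a
  by_cases h : a = 4
  · subst h; rw [Function.update_self]; rfl
  · rw [Function.update_of_ne h]; split <;> simp_all

theorem ctx_set_five (f : ℕ → ℕ) : (I.ctx A₂ A₃ A₄ A₅ l).set 5 f = I.ctx A₂ A₃ A₄ f l := by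
  simp only [Ctx.set, ctx, Ctx.mk.injEq, true_and]
  funext a
  by_cases h : a = 5
  · subst h; rw [Function.update_self]; rfl
  · rw [Function.update_of_ne h]; split <;> simp_all

theorem ctx_set_six {i : ℕ} (hi : i < l.length) (v : ℕ) :
    (I.ctx A₂ A₃ A₄ A₅ l).set 6 (Function.update ((I.ctx A₂ A₃ A₄ A₅ l).arr 6) i v) =
      I.ctx A₂ A₃ A₄ A₅ (l.set i v) := by
  simp only [Ctx.set, ctx, Ctx.mk.injEq, true_and]
  funext a
  by_cases h : a = 6
  · subst h
    rw [Function.update_self]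
    funext j
    by_cases hj : j = i
    · subst hj
      simp [List.getD_eq_getElem?_getD, hi]
    · simp [List.getD_eq_getElem?_getD, hj, List.getElem?_set_ne (Ne.symm hj)]
  · rw [Function.update_of_ne h]; split <;> simp_all

/-! ### The input -/

theorem nat_edges (i : ℕ) :
    I.input.nat (5 + i) = (I.es.flatMap (fun e => [e.1, e.2, I.w e])).getD i 0 := by
  rw [add_comm]; rfl

theorem getD_flatMap (w : ℕ × ℕ → ℕ) (es : List (ℕ × ℕ)) (e : ℕ) (he : e < es.length) :
    (es.flatMap (fun e => [e.1, e.2, w e])).getD (3 * e) 0 = es[e].1 ∧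
    (es.flatMap (fun e => [e.1, e.2, w e])).getD (3 * e + 1) 0 = es[e].2 ∧
    (es.flatMap (fun e => [e.1, e.2, w e])).getD (3 * e + 2) 0 = w es[e] := by
  induction es generalizing e with
  | nil => simp at he
  | cons a es ih =>
    cases e with
    | zero => simp
    | succ e =>
      have := ih e (by simpa using he)
      simpa [mul_add, add_right_comm] using this

theorem nat_edges_of_le {i : ℕ} (hi : 3 * I.m ≤ i) : I.input.nat (5 + i) = 0 := by
  rw [nat_edges, List.getD_eq_default]
  simpa [m, mul_comm] using hi

theorem edges_getElem {e : ℕ} (he : e < I.m) :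
    I.es[e]'he ∈ I.M.G.edges := by
  rw [← I.edges_eq, List.mem_toFinset]
  exact List.getElem_mem _

theorem edge_lt {e : ℕ × ℕ} (he : e ∈ I.M.G.edges) : e.1 < I.n ∧ e.2 < I.n := by
  simpa [I.verts_eq] using I.M.G.mem_verts e he

theorem s_lt : I.M.s < I.n := by simpa [I.verts_eq] using I.M.s_mem

theorem t_lt : I.M.t < I.n := by simpa [I.verts_eq] using I.M.t_mem

theorem partialSum_le {j : ℕ} (hj : j ≤ 3 * I.m) : I.partialSum j ≤ I.partialSum (3 * I.m) :=
  Finset.sum_le_sum_of_subset (Finset.range_mono hj)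

/-- Truncated subtraction replaces the minimum, which the machine does not offer. Without this
truncation the base `β` would grow with `k` and would not be polynomial in `n W`. -/
theorem k'_eq : I.k' = min I.k I.n := by unfold k'; omega

theorem two_le_β : 2 ≤ I.β := by unfold β; omega

theorem β_le_N : I.β ≤ I.N := by
  have := I.two_le_β
  exact Nat.le_self_pow (by unfold digits; omega) _

theorem nat_le_X (j : ℕ) : I.input.nat j ≤ I.X := by
  have hs := I.s_lt
  have ht := I.t_lt
  match j with
  | 0 => change I.n ≤ _; unfold X; omega
  | 1 => change I.m ≤ _; unfold X; omega
  | 2 => change I.M.s ≤ _; unfold X; omega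
  | 3 => change I.M.t ≤ _; unfold X; omega
  | 4 => change I.k ≤ _; unfold X; omega
  | i + 5 =>
    rw [add_comm]
    by_cases hi : i < 3 * I.m
    · have : I.input.nat (5 + i) ≤ I.partialSum (3 * I.m) :=
        Finset.single_le_sum (f := fun i => I.input.nat (5 + i)) (fun _ _ => Nat.zero_le _)
          (Finset.mem_range.2 hi)
      unfold X β
      omega
    · rw [nat_edges_of_le (by omega)]
      exact Nat.zero_le _

theorem bounded_ctx (h2 : ∀ j, A₂ j ≤ I.X) (h3 : ∀ j, A₃ j ≤ I.X) (h4 : ∀ j, A₄ j ≤ I.X)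
    (h5 : ∀ j, A₅ j ≤ I.X) (hl : ∀ x ∈ l, x ≤ I.X) {ℓ : ℕ} {ρ : Fin ℓ → ℕ} (hρ : ∀ i, ρ i ≤ I.X) :
    Bounded I.X (I.ctx A₂ A₃ A₄ A₅ l) ρ where
  two_le := by unfold X; omega
  nat := nat_le_X
  arr a j := by
    simp only [ctx]
    split
    · exact h2 j
    · exact h3 j
    · exact h4 j
    · exact h5 j
    · change l.getD j 0 ≤ I.X
      by_cases hj : j < l.length
      · rw [List.getD_eq_getElem _ _ hj]; exact hl _ (List.getElem_mem _)
      · rw [List.getD_eq_default _ _ (by omega)]; exact Nat.zero_le _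
    · exact Nat.zero_le _
  var := hρ

variable (I)

/-- The copy of the first `j` numbers of the edge list. -/
noncomputable def edgeArray (j i : ℕ) : ℕ := if i < j then I.input.nat (5 + i) else 0

/-- The table of the powers of the base up to the `j`-th one. -/
noncomputable def powers (j i : ℕ) : ℕ := if i ≤ j then I.β ^ i else 0

open Classical in
/-- The table of levels. -/
noncomputable def levels (j : ℕ) : ℕ :=
  if j < I.n * I.n ∧ layer (fun _ => True) (fun u v => (u, v) ∈ I.M.G.edges) I.n (j / I.n) (j % I.n)
  then 1 else 0

/-- The scalars that the formulas refer to. -/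
noncomputable def scalars : List ℕ :=
  [3 * I.m, I.k' + 1, I.partialSum (3 * I.m), I.β, I.digits, I.N, I.N * I.N, I.n * I.n]

/-- The context in which the search takes place, with the table `T`. -/
noncomputable def searchCtx (T : ℕ → ℕ) : Ctx :=
  I.ctx (I.edgeArray (3 * I.m)) (I.powers I.digits) I.levels T I.scalars

/-- The position with code `x`. -/
noncomputable def position (x : ℕ) : Position ℕ :=
  codePosition (I.powers I.digits) I.β (I.k' + 1) x

variable {I}

/-! ### The meaning of the formulas -/

theorem edgeArray_apply {e : ℕ} (he : e < I.m) :
    I.edgeArray (3 * I.m) (3 * e) = (I.es[e]'he).1 ∧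
    I.edgeArray (3 * I.m) (3 * e + 1) = (I.es[e]'he).2 ∧
    I.edgeArray (3 * I.m) (3 * e + 2) = I.w (I.es[e]'he) := by
  unfold edgeArray
  rw [if_pos (by omega), if_pos (by omega), if_pos (by omega), nat_edges, nat_edges, nat_edges]
  exact getD_flatMap _ _ _ _

/-- Quantifying over places in the list amounts to quantifying over edges. -/
theorem exists_edge_iff {Φ : ℕ → ℕ → Prop} :
    (∃ e, e < I.m ∧ Φ (I.edgeArray (3 * I.m) (3 * e)) (I.edgeArray (3 * I.m) (3 * e + 1))) ↔
      ∃ x y, (x, y) ∈ I.M.G.edges ∧ Φ x y := by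
  constructor
  · rintro ⟨e, he, h⟩
    obtain ⟨h1, h2, -⟩ := edgeArray_apply he
    rw [h1, h2] at h
    exact ⟨_, _, edges_getElem he, h⟩
  · rintro ⟨x, y, he, h⟩
    rw [← I.edges_eq, List.mem_toFinset] at he
    obtain ⟨e, he', heq⟩ := List.getElem_of_mem he
    obtain ⟨h1, h2, -⟩ := edgeArray_apply (I := I) he'
    refine ⟨e, he', ?_⟩
    rw [h1, h2, heq]
    exact h

theorem edgeArray_weight {e : ℕ} (he : e < I.m) : I.edgeArray (3 * I.m) (3 * e + 2) =
    I.w (I.edgeArray (3 * I.m) (3 * e), I.edgeArray (3 * I.m) (3 * e + 1)) := by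
  obtain ⟨h1, h2, h3⟩ := edgeArray_apply he
  rw [h1, h2, h3]

theorem edgeFormula_iff {c : Ctx} (hn : c.nat = I.input.nat)
    (h2 : c.arr 2 = I.edgeArray (3 * I.m)) {u v : ℕ} :
    edgeFormula c u v ↔ (u, v) ∈ I.M.G.edges := by
  unfold edgeFormula
  rw [h2, hn]
  refine (exists_edge_iff (Φ := fun x y => x = u ∧ y = v)).trans ⟨?_, fun h => ⟨u, v, h, rfl, rfl⟩⟩
  rintro ⟨x, y, h, rfl, rfl⟩
  exact h

theorem levels_eq_one {z v : ℕ} (hz : z < I.n) (hv : v < I.n) : I.levels (z * I.n + v) = 1 ↔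
    layer (fun _ => True) (fun u v => (u, v) ∈ I.M.G.edges) I.n z v := by
  have h1 : z * I.n + v < I.n * I.n := by
    calc z * I.n + v < z * I.n + I.n := by omega
      _ = (z + 1) * I.n := by ring
      _ ≤ I.n * I.n := Nat.mul_le_mul_right _ hz
  have h2 : (z * I.n + v) / I.n = z := by
    rw [mul_comm, Nat.mul_add_div (by omega), Nat.div_eq_of_lt hv, add_zero]
  have h3 : (z * I.n + v) % I.n = v := by
    rw [mul_comm, Nat.mul_add_mod, Nat.mod_eq_of_lt hv]
  simp [levels, h1, h2, h3]

theorem levelFormula_iff {T : ℕ → ℕ} {lev : ℕ → ℕ} (hlevn : ∀ v < I.n, lev v < I.n)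
    (hlayer : ∀ v < I.n, ∀ z,
      layer (fun _ => True) (fun u v => (u, v) ∈ I.M.G.edges) I.n z v ↔ z ≤ lev v)
    {u v : ℕ} (hu : u < I.n) (hv : v < I.n) :
    levelFormula (I.searchCtx T) u v ↔ lev u ≤ lev v := by
  have h : ∀ z < I.n, (I.levels (z * I.n + u) = 1 ↔ z ≤ lev u) ∧
      (I.levels (z * I.n + v) = 1 ↔ z ≤ lev v) := fun z hz =>
    ⟨(levels_eq_one hz hu).trans (hlayer u hu z), (levels_eq_one hz hv).trans (hlayer v hv z)⟩
  change (∀ z, z < I.n → I.levels (z * I.n + u) = 1 → I.levels (z * I.n + v) = 1) ↔ _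
  constructor
  · intro h'
    -- The decisive layer is the one numbered `lev u`, which lies within the table.
    have hl := hlevn u hu
    exact (h _ hl).2.1 (h' _ hl ((h _ hl).1.2 le_rfl))
  · intro h' z hz h1
    exact (h z hz).2.2 (((h z hz).1.1 h1).trans h')

/-- Both sides have the same shape once the table entries are read off. The assumption on `p` is
what `levelFormula_iff` needs. -/
theorem moveAlong_iff {T : ℕ → ℕ} {lev : ℕ → ℕ} (hlevn : ∀ v < I.n, lev v < I.n)
    (hlayer : ∀ v < I.n, ∀ z,
      layer (fun _ => True) (fun u v => (u, v) ∈ I.M.G.edges) I.n z v ↔ z ≤ lev v)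
    {p q : Position ℕ} (hp : ∀ j, j < I.k' + 1 → p.v j < I.n) :
    (∃ e, e < I.m ∧ moveAlong (I.searchCtx T) p q e) ↔ I.M.Move I.w lev (I.k' + 1) p q := by
  refine Iff.trans (exists_congr fun e => and_congr_right fun he => ?_) exists_edge_iff
  have hwt := edgeArray_weight he
  have hx : I.edgeArray (3 * I.m) (3 * e) < I.n := by
    rw [(edgeArray_apply he).1]
    exact (edge_lt (edges_getElem he)).1
  unfold moveAlong
  change I.edgeArray (3 * I.m) (3 * e) ≠ I.M.t ∧
    (∃ i, i < I.k' + 1 ∧ p.v i = I.edgeArray (3 * I.m) (3 * e)) ∧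
    (∀ j, j < I.k' + 1 →
      levelFormula (I.searchCtx T) (I.edgeArray (3 * I.m) (3 * e)) (p.v j)) ∧
    (∀ j, j < I.k' + 1 → p.v j ≠ I.edgeArray (3 * I.m) (3 * e) →
      q.v j = p.v j ∧ q.d j = p.d j) ∧
    ((q.c = p.c ∧
        (∀ j, j < I.k' + 1 → p.v j = I.edgeArray (3 * I.m) (3 * e) →
          q.v j = I.edgeArray (3 * I.m) (3 * e + 1) ∧
            q.d j + I.edgeArray (3 * I.m) (3 * e + 2) = p.d j) ∧
        (p.v 0 = I.edgeArray (3 * I.m) (3 * e) →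
          (I.edgeArray (3 * I.m) (3 * e + 2) : ℝ) * I.M.b + (q.d 0 : ℝ) ≤ I.M.r)) ∨
      (p.v 0 = I.edgeArray (3 * I.m) (3 * e) ∧ q.c = p.c + 1 ∧ q.c < I.k' + 1 ∧
        p.v q.c = I.edgeArray (3 * I.m) (3 * e) ∧
        (I.edgeArray (3 * I.m) (3 * e + 2) : ℝ) * I.M.b + (q.d 0 : ℝ) ≤ I.M.r ∧
        p.d 0 ≤ q.d 0 + I.edgeArray (3 * I.m) (3 * e + 2) ∧
        (∀ j, j < I.k' + 1 → p.v j = I.edgeArray (3 * I.m) (3 * e) → p.d j = p.d 0 ∧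
          (j ≠ q.c → q.v j = I.edgeArray (3 * I.m) (3 * e + 1) ∧ q.d j = q.d 0)) ∧
        ∃ e', e' < I.m ∧ (I.edgeArray (3 * I.m) (3 * e') = I.edgeArray (3 * I.m) (3 * e) ∧
          q.v q.c = I.edgeArray (3 * I.m) (3 * e' + 1) ∧
          q.d q.c + I.edgeArray (3 * I.m) (3 * e' + 2) = p.d 0 ∧
          (I.edgeArray (3 * I.m) (3 * e + 2) : ℝ) * I.M.b + (q.d 0 : ℝ) <
            (I.edgeArray (3 * I.m) (3 * e' + 2) : ℝ) * I.M.b + (q.d q.c : ℝ)))) ↔ _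
  rw [hwt]
  generalize I.edgeArray (3 * I.m) (3 * e) = x at hx ⊢
  generalize I.edgeArray (3 * I.m) (3 * e + 1) = y
  have hz : (∃ e', e' < I.m ∧ (I.edgeArray (3 * I.m) (3 * e') = x ∧
      q.v q.c = I.edgeArray (3 * I.m) (3 * e' + 1) ∧
      q.d q.c + I.edgeArray (3 * I.m) (3 * e' + 2) = p.d 0 ∧
      (I.w (x, y) : ℝ) * I.M.b + (q.d 0 : ℝ) <
        (I.edgeArray (3 * I.m) (3 * e' + 2) : ℝ) * I.M.b + (q.d q.c : ℝ))) ↔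
      ∃ z, (x, z) ∈ I.M.G.edges ∧ q.v q.c = z ∧ q.d q.c + I.w (x, z) = p.d 0 ∧
        (I.w (x, y) : ℝ) * I.M.b + (q.d 0 : ℝ) <
          (I.w (x, z) : ℝ) * I.M.b + (q.d q.c : ℝ) := by
    refine (exists_congr fun e' => and_congr_right fun he' => ?_).trans
      ((exists_edge_iff (Φ := fun u z => u = x ∧ q.v q.c = z ∧ q.d q.c + I.w (u, z) = p.d 0 ∧
        (I.w (x, y) : ℝ) * I.M.b + (q.d 0 : ℝ) <
          (I.w (u, z) : ℝ) * I.M.b + (q.d q.c : ℝ))).trans ?_)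
    · rw [edgeArray_weight he']
    · constructor
      · rintro ⟨u, z, h, rfl, h'⟩
        exact ⟨z, h, h'⟩
      · rintro ⟨z, h, h'⟩
        exact ⟨x, z, h, rfl, h'⟩
  have hlev : (∀ j, j < I.k' + 1 → levelFormula (I.searchCtx T) x (p.v j)) ↔
      ∀ j, j < I.k' + 1 → lev x ≤ lev (p.v j) :=
    forall_congr' fun j => imp_congr_right fun hj => levelFormula_iff hlevn hlayer hx (hp j hj)
  rw [hz, hlev]

theorem stepFormula_iff {T : ℕ → ℕ} {lev : ℕ → ℕ} (hlevn : ∀ v < I.n, lev v < I.n)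
    (hlayer : ∀ v < I.n, ∀ z,
      layer (fun _ => True) (fun u v => (u, v) ∈ I.M.G.edges) I.n z v ↔ z ≤ lev v) {x y : ℕ} :
    stepFormula (I.searchCtx T) x y ↔
      I.M.CodeStep I.n I.w lev (I.k' + 1) I.position x y :=
  or_congr Iff.rfl (and_congr_right fun h => moveAlong_iff hlevn hlayer h)

end Instance

/-! ### The program: scalars, tables, search and answer. -/

theorem Computes.setTerm {ι : Type*} {X : ι → ℕ} {ℓ : ℕ} {c : ι → Ctx} {ρ : ι → Fin ℓ → ℕ}
    (hb : ∀ i, Bounded (X i) (c i) (ρ i)) (a : ℕ) (ha : 2 ≤ a ∧ a < 8)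
    {g f : Ctx → (Fin ℓ → ℕ) → ℕ} (hg : Term ℓ g) (hf : Term ℓ f) :
    Computes X (fun i => memory (c i) (ρ i) 0) (fun i =>
      memory ((c i).set a (Function.update ((c i).arr a) (g (c i) (ρ i)) (f (c i) (ρ i))))
        (ρ i) 0) := by
  obtain ⟨e, he⟩ := hg
  obtain ⟨e', he'⟩ := hf
  exact Computes.setArr hb (fun _ => zero_le_one) a ha e e' (fun i => he _ _ _)
    (fun i => he' _ _ _)

namespace Instance

variable {I : Instance}

theorem two_le_X : 2 ≤ I.X := by unfold X; omega
theorem length_le_X : 3 * I.m ≤ I.X := by unfold X; omega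
theorem β_le_X : I.β ≤ I.X := by unfold X; omega
theorem pebbles_lt_X : I.k' < I.X := by unfold X β; omega
theorem digits_le_X : I.digits ≤ I.X := by unfold X; omega
theorem N_le_X : I.N ≤ I.X := by unfold X; omega
theorem N_mul_N_le_X : I.N * I.N ≤ I.X := by unfold X; omega
theorem n_mul_n_le_X : I.n * I.n ≤ I.X := by unfold X; omega

theorem partialSum_le_X {j : ℕ} (hj : j ≤ 3 * I.m) : I.partialSum j ≤ I.X := by
  have := partialSum_le hj
  unfold X β
  omega

theorem edgeArray_le_X (j i : ℕ) : I.edgeArray j i ≤ I.X := by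
  unfold edgeArray
  split_ifs
  · exact nat_le_X _
  · exact Nat.zero_le _

theorem powers_le_X {j : ℕ} (hj : j ≤ I.digits) (i : ℕ) : I.powers j i ≤ I.X := by
  unfold powers
  split_ifs with h
  · exact (Nat.pow_le_pow_right (by have := I.two_le_β; omega) (h.trans hj)).trans N_le_X
  · exact Nat.zero_le _

theorem levels_le_X (j : ℕ) : I.levels j ≤ I.X := by
  have := I.two_le_X
  unfold levels
  split_ifs <;> omega

theorem setScalar {A₂ A₃ A₄ A₅ : Instance → ℕ → ℕ} {l l' : Instance → List ℕ}
    (hb : ∀ I : Instance, Bounded I.X (I.ctx (A₂ I) (A₃ I) (A₄ I) (A₅ I) (l I)) ![]) (i : ℕ)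
    (hi : ∀ I : Instance, i < (l I).length) {f : Ctx → (Fin 0 → ℕ) → ℕ} (hf : Term 0 f)
    (hl : ∀ I : Instance, (l I).set i (f (I.ctx (A₂ I) (A₃ I) (A₄ I) (A₅ I) (l I)) ![]) = l' I) :
    Computes X (fun I => memory (I.ctx (A₂ I) (A₃ I) (A₄ I) (A₅ I) (l I)) ![] 0)
      (fun I => memory (I.ctx (A₂ I) (A₃ I) (A₄ I) (A₅ I) (l' I)) ![] 0) :=
  (Computes.setTerm hb 6 (by norm_num) (.const i) hf).congr (fun _ => rfl) fun I => by
    rw [ctx_set_six (hi I), hl]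

/-- The edge list moves to array `2` because formulas can read arrays at computed places but only
five fixed registers of the input. The same loop adds the numbers up. -/
theorem computes_copy : Computes X
    (fun I => memory (I.ctx 0 0 0 0 [3 * I.m, I.k' + 1, 0, 0, 0, 0, 0, 0]) ![] 0)
    (fun I => memory (I.ctx (I.edgeArray (3 * I.m)) 0 0 0
      [3 * I.m, I.k' + 1, I.partialSum (3 * I.m), 0, 0, 0, 0, 0]) ![] 0) := by
  have hb : ∀ (I : Instance) (A : ℕ → ℕ) (a b : ℕ), (∀ i, A i ≤ I.X) → a ≤ 3 * I.m →
      b ≤ 3 * I.m → Bounded I.X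
        (I.ctx A 0 0 0 [3 * I.m, I.k' + 1, I.partialSum a, 0, 0, 0, 0, 0]) ![b] :=
    fun I A a b hA ha hb => bounded_ctx hA (fun _ => Nat.zero_le _)
      (fun _ => Nat.zero_le _) (fun _ => Nat.zero_le _)
      (by simp [length_le_X, pebbles_lt_X, partialSum_le_X ha])
      (fun _ => by simpa using hb.trans length_le_X)
  -- This is not a `Term`: the value is right only for places inside the input region.
  have hread : ∀ (I : Instance) (A : ℕ → ℕ) (l : List ℕ) (a : ℕ), a < 3 * I.m →
      (NatExp.reg (.add (.const 5) (lastExp 0))).eval (memory (I.ctx A 0 0 0 l) ![a] 0) =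
        I.input.nat (5 + a) := by
    intro I A l a ha
    simp only [NatExp.eval, lastExp_zero_eval]
    exact memory_nat_of_lt _ _ _ (by change _ < 5 + 3 * I.m; omega)
  have hX : ∀ I : Instance, 2 ≤ I.X := fun I => two_le_X
  refine (Computes.forLoop (X := X) (fun I a => I.ctx (I.edgeArray a) 0 0 0
    [3 * I.m, I.k' + 1, I.partialSum a, 0, 0, 0, 0, 0]) (fun I => 3 * I.m)
    (fun I a ha => hb I _ a a (edgeArray_le_X a) ha ha)
    (f := fun c _ => c.arr 6 0) (Term.arr 6 (by norm_num) (.const 0)) (fun I a _ => rfl) ?_).congr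
    (fun I => ?_) (fun I => rfl)
  · refine (Computes.setArr (fun x => hb _ _ _ _ (edgeArray_le_X _) x.2.le x.2.le)
      (fun _ => zero_le_one) 2 (by norm_num) (lastExp 0) _
      (fun x => lastExp_zero_eval _ _ _) (fun x => hread _ _ _ _ x.2)).trans (fun x => hX _) ?_
    have harr : ∀ x : {x : Instance × ℕ // x.2 < 3 * x.1.m},
        Function.update (x.1.1.edgeArray x.1.2) x.1.2 (x.1.1.input.nat (5 + x.1.2)) =
          x.1.1.edgeArray (x.1.2 + 1) := fun x => by
      funext i
      unfold edgeArray
      by_cases hi : i = x.1.2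
      · subst hi; simp
      · rw [Function.update_of_ne hi]
        have : i < x.1.2 + 1 ↔ i < x.1.2 := by omega
        simp [this]
    refine ((Computes.setArr (X := fun x : {x : Instance × ℕ // x.2 < 3 * x.1.m} => x.1.1.X)
      (c := fun x => x.1.1.ctx (x.1.1.edgeArray (x.1.2 + 1)) 0 0 0
        [3 * x.1.1.m, x.1.1.k' + 1, x.1.1.partialSum x.1.2, 0, 0, 0, 0, 0])
      (ρ := fun x => ![x.1.2]) (d := fun _ => 0)
      (fun x => hb _ _ _ _ (edgeArray_le_X _) x.2.le x.2.le)
      (fun _ => zero_le_one) 6 (by norm_num) (.const 2)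
      (.add (.reg (addrExp 6 (.const 2))) (.reg (.add (.const 5) (lastExp 0)))) (k := fun _ => 2)
      (v := fun x => x.1.1.partialSum (x.1.2 + 1))
      (fun x => rfl) (fun x => ?_))).congr (fun x => ?_) (fun x => ?_)
    · have h1 := hread x.1.1 (x.1.1.edgeArray (x.1.2 + 1))
        [3 * x.1.1.m, x.1.1.k' + 1, x.1.1.partialSum x.1.2, 0, 0, 0, 0, 0] x.1.2 x.2
      rw [NatExp.eval, h1]
      simp only [NatExp.eval, addrExp_eval]
      have h2 : x.1.1.partialSum (x.1.2 + 1) =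
          x.1.1.partialSum x.1.2 + x.1.1.input.nat (5 + x.1.2) := Finset.sum_range_succ _ _
      rw [memory_nat_cell _ _ _ (by norm_num), h2]
      rfl
    · rw [ctx_set_two, ← harr x]
      rfl
    · rw [ctx_set_six (by simp)]
      rfl
  · congr 2

/-- The powers serve to extract digits by division, and the last one is the number of codes. -/
theorem computes_powers : Computes X
    (fun I => memory (I.ctx (I.edgeArray (3 * I.m)) (I.powers 0) 0 0
      [3 * I.m, I.k' + 1, I.partialSum (3 * I.m), I.β, I.digits, 0, 0, 0]) ![] 0)
    (fun I => memory (I.ctx (I.edgeArray (3 * I.m)) (I.powers I.digits) 0 0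
      [3 * I.m, I.k' + 1, I.partialSum (3 * I.m), I.β, I.digits, 0, 0, 0]) ![] 0) := by
  have hb : ∀ (I : Instance) (a : ℕ), a ≤ I.digits → Bounded I.X
      (I.ctx (I.edgeArray (3 * I.m)) (I.powers a) 0 0
        [3 * I.m, I.k' + 1, I.partialSum (3 * I.m), I.β, I.digits, 0, 0, 0]) ![a] :=
    fun I a ha => bounded_ctx (edgeArray_le_X _) (powers_le_X ha)
      (fun _ => Nat.zero_le _) (fun _ => Nat.zero_le _)
      (by simp [length_le_X, pebbles_lt_X, partialSum_le_X, β_le_X, digits_le_X])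
      (fun _ => by simpa using ha.trans digits_le_X)
  refine Computes.forLoop (X := X) (fun I a => I.ctx (I.edgeArray (3 * I.m)) (I.powers a) 0 0
    [3 * I.m, I.k' + 1, I.partialSum (3 * I.m), I.β, I.digits, 0, 0, 0]) digits hb
    (f := fun c _ => c.arr 6 4) (Term.arr 6 (by norm_num) (.const 4)) (fun I a _ => rfl) ?_
  refine (Computes.setTerm (fun x => hb _ _ x.2.le) 3 (by norm_num)
    (g := fun _ ρ => ρ 0 + 1) (f := fun c ρ => c.arr 3 (ρ 0) * c.arr 6 3)
    (.add (.var 0) (.const 1)) (.mul (.arr 3 (by norm_num) (.var 0))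
      (.arr 6 (by norm_num) (.const 3)))).congr (fun _ => rfl) (fun x => ?_)
  rw [ctx_set_three]
  congr 2
  funext i
  change Function.update (x.1.1.powers x.1.2) (x.1.2 + 1) (x.1.1.powers x.1.2 x.1.2 * x.1.1.β) i = _
  by_cases hi : i = x.1.2 + 1
  · subst hi
    simp [powers, pow_succ]
  · rw [Function.update_of_ne hi]
    have : i ≤ x.1.2 + 1 ↔ i ≤ x.1.2 := by omega
    simp [powers, this]

theorem computes_scalars : Computes X (fun I => I.input)
    (fun I => memory (I.ctx (I.edgeArray (3 * I.m)) (I.powers I.digits) 0 0 I.scalars) ![] 0) := by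
  have hX : ∀ I : Instance, 2 ≤ I.X := fun I => two_le_X
  have hb : ∀ (I : Instance) (A B : ℕ → ℕ) (l : List ℕ), (∀ i, A i ≤ I.X) → (∀ i, B i ≤ I.X) →
      (∀ x ∈ l, x ≤ I.X) → Bounded I.X (I.ctx A B 0 0 l) ![] := fun I A B l hA hB hl =>
    bounded_ctx hA hB (fun _ => Nat.zero_le _) (fun _ => Nat.zero_le _) hl (fun i => i.elim0)
  have h0 : ∀ (I : Instance) (i : ℕ), (0 : ℕ → ℕ) i ≤ I.X := fun _ _ => Nat.zero_le _
  -- The registers behind the input are zero, so the initial memory is one in which all arrays are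
  -- empty.
  have hinput : ∀ I : Instance,
      memory (I.ctx 0 0 0 0 [0, 0, 0, 0, 0, 0, 0, 0]) ![] 0 = I.input := by
    intro I
    suffices (memory (I.ctx 0 0 0 0 [0, 0, 0, 0, 0, 0, 0, 0]) ![] 0).nat = I.input.nat by
      change State.mk _ _ = State.mk _ _
      congr 1
    funext j
    by_cases hj : j < (I.ctx 0 0 0 0 [0, 0, 0, 0, 0, 0, 0, 0]).base
    · exact memory_nat_of_lt _ _ _ hj
    · have hj' : 5 + 3 * I.m ≤ j := not_lt.1 hj
      obtain ⟨i, rfl⟩ := Nat.exists_eq_add_of_le (show 5 ≤ j by omega)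
      rw [nat_edges_of_le (by omega)]
      have hlist : ∀ i, ([0, 0, 0, 0, 0, 0, 0, 0] : List ℕ).getD i 0 = 0 := fun i => by
        match i with
        | 0 | 1 | 2 | 3 | 4 | 5 | 6 | 7 => rfl
        | i + 8 => rfl
      have harr : ∀ a i, (I.ctx 0 0 0 0 [0, 0, 0, 0, 0, 0, 0, 0]).arr a i = 0 := fun a i => by
        match a with
        | 0 | 1 | 2 | 3 | 4 | 5 => rfl
        | 6 => exact hlist i
        | a + 7 => rfl
      change (if _ < _ then _ else cell _ _ _ _ _) = 0
      rw [if_neg hj]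
      unfold cell
      split_ifs with _ _ _ h
      · rfl
      · rfl
      · exact absurd h (Nat.not_lt_zero _)
      · rfl
      · exact harr _ _
  have h1 := setScalar (A₂ := fun _ => 0) (A₃ := fun _ => 0) (A₄ := fun _ => 0)
    (A₅ := fun _ => 0) (l := fun _ => [0, 0, 0, 0, 0, 0, 0, 0])
    (l' := fun I => [3 * I.m, 0, 0, 0, 0, 0, 0, 0])
    (fun I => hb I _ _ _ (h0 I) (h0 I) (by simp)) 0 (fun _ => by simp)
    (f := fun c _ => 3 * c.nat 1) (.mul (.const 3) (.inp 1 (by norm_num))) (fun _ => rfl)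
  have h2 := setScalar (A₂ := fun _ => 0) (A₃ := fun _ => 0) (A₄ := fun _ => 0)
    (A₅ := fun _ => 0) (l := fun I => [3 * I.m, 0, 0, 0, 0, 0, 0, 0])
    (l' := fun I => [3 * I.m, I.k' + 1, 0, 0, 0, 0, 0, 0])
    (fun I => hb I _ _ _ (h0 I) (h0 I) (by simp [length_le_X])) 1 (fun _ => by simp)
    (f := fun c _ => c.nat 4 - (c.nat 4 - c.nat 0) + 1)
    (.add (.sub (.inp 4 (by norm_num)) (.sub (.inp 4 (by norm_num)) (.inp 0 (by norm_num))))
      (.const 1)) (fun _ => rfl)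
  have h3 := setScalar (A₂ := fun I => I.edgeArray (3 * I.m)) (A₃ := fun _ => 0) (A₄ := fun _ => 0)
    (A₅ := fun _ => 0)
    (l := fun I => [3 * I.m, I.k' + 1, I.partialSum (3 * I.m), 0, 0, 0, 0, 0])
    (l' := fun I => [3 * I.m, I.k' + 1, I.partialSum (3 * I.m), I.β, 0, 0, 0, 0])
    (fun I => hb I _ _ _ (edgeArray_le_X _) (h0 I)
      (by simp [length_le_X, pebbles_lt_X, partialSum_le_X])) 3 (fun _ => by simp)
    (f := fun c _ => c.arr 6 2 + c.nat 0 + c.arr 6 1 + 1)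
    (.add (.add (.add (.arr 6 (by norm_num) (.const 2)) (.inp 0 (by norm_num)))
      (.arr 6 (by norm_num) (.const 1))) (.const 1)) (fun _ => rfl)
  have h4 := setScalar (A₂ := fun I => I.edgeArray (3 * I.m)) (A₃ := fun _ => 0) (A₄ := fun _ => 0)
    (A₅ := fun _ => 0)
    (l := fun I => [3 * I.m, I.k' + 1, I.partialSum (3 * I.m), I.β, 0, 0, 0, 0])
    (l' := fun I => [3 * I.m, I.k' + 1, I.partialSum (3 * I.m), I.β, I.digits, 0, 0, 0])
    (fun I => hb I _ _ _ (edgeArray_le_X _) (h0 I)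
      (by simp [length_le_X, pebbles_lt_X, partialSum_le_X, β_le_X])) 4 (fun _ => by simp)
    (f := fun c _ => 2 * c.arr 6 1 + 1)
    (.add (.mul (.const 2) (.arr 6 (by norm_num) (.const 1))) (.const 1)) (fun _ => rfl)
  have h5 : Computes X
      (fun I => memory (I.ctx (I.edgeArray (3 * I.m)) 0 0 0
        [3 * I.m, I.k' + 1, I.partialSum (3 * I.m), I.β, I.digits, 0, 0, 0]) ![] 0)
      (fun I => memory (I.ctx (I.edgeArray (3 * I.m)) (I.powers 0) 0 0
        [3 * I.m, I.k' + 1, I.partialSum (3 * I.m), I.β, I.digits, 0, 0, 0]) ![] 0) := by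
    refine (Computes.setTerm (fun I => hb I _ _ _ (edgeArray_le_X _) (h0 I)
      (by simp [length_le_X, pebbles_lt_X, partialSum_le_X, β_le_X, digits_le_X])) 3 (by norm_num)
      (g := fun _ _ => 0) (f := fun _ _ => 1) (.const 0) (.const 1)).congr (fun _ => rfl)
      (fun I => ?_)
    rw [ctx_set_three]
    congr 2
    funext i
    by_cases hi : i = 0
    · subst hi; simp [powers]
    · rw [Function.update_of_ne hi]
      simp [powers, hi, ctx]
  have h6 := setScalar (A₂ := fun I => I.edgeArray (3 * I.m)) (A₃ := fun I => I.powers I.digits)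
    (A₄ := fun _ => 0) (A₅ := fun _ => 0)
    (l := fun I => [3 * I.m, I.k' + 1, I.partialSum (3 * I.m), I.β, I.digits, 0, 0, 0])
    (l' := fun I => [3 * I.m, I.k' + 1, I.partialSum (3 * I.m), I.β, I.digits, I.N, 0, 0])
    (fun I => hb I _ _ _ (edgeArray_le_X _) (powers_le_X le_rfl)
      (by simp [length_le_X, pebbles_lt_X, partialSum_le_X, β_le_X, digits_le_X])) 5
    (fun _ => by simp) (f := fun c _ => c.arr 3 (c.arr 6 4))
    (.arr 3 (by norm_num) (.arr 6 (by norm_num) (.const 4))) (fun I => by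
      change [_, _, _, _, _, I.powers I.digits I.digits, _, _] = _
      simp [powers, N])
  have h7 := setScalar (A₂ := fun I => I.edgeArray (3 * I.m)) (A₃ := fun I => I.powers I.digits)
    (A₄ := fun _ => 0) (A₅ := fun _ => 0)
    (l := fun I => [3 * I.m, I.k' + 1, I.partialSum (3 * I.m), I.β, I.digits, I.N, 0, 0])
    (l' := fun I => [3 * I.m, I.k' + 1, I.partialSum (3 * I.m), I.β, I.digits, I.N, I.N * I.N, 0])
    (fun I => hb I _ _ _ (edgeArray_le_X _) (powers_le_X le_rfl)
      (by simp [length_le_X, pebbles_lt_X, partialSum_le_X, β_le_X, digits_le_X, N_le_X])) 6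
    (fun _ => by simp) (f := fun c _ => c.arr 6 5 * c.arr 6 5)
    (.mul (.arr 6 (by norm_num) (.const 5)) (.arr 6 (by norm_num) (.const 5))) (fun I => rfl)
  have h8 := setScalar (A₂ := fun I => I.edgeArray (3 * I.m)) (A₃ := fun I => I.powers I.digits)
    (A₄ := fun _ => 0) (A₅ := fun _ => 0)
    (l := fun I => [3 * I.m, I.k' + 1, I.partialSum (3 * I.m), I.β, I.digits, I.N, I.N * I.N, 0])
    (l' := scalars)
    (fun I => hb I _ _ _ (edgeArray_le_X _) (powers_le_X le_rfl)
      (by simp [length_le_X, pebbles_lt_X, partialSum_le_X, β_le_X, digits_le_X, N_le_X,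
        N_mul_N_le_X])) 7
    (fun _ => by simp) (f := fun c _ => c.nat 0 * c.nat 0)
    (.mul (.inp 0 (by norm_num)) (.inp 0 (by norm_num))) (fun I => rfl)
  exact (((((((((h1.trans hX h2).trans hX computes_copy).trans hX h3).trans hX h4).trans hX
    h5).trans hX computes_powers).trans hX h6).trans hX h7).trans hX h8).congr hinput
    (fun _ => rfl)

theorem scalars_le_X : ∀ x ∈ I.scalars, x ≤ I.X := by
  simp [scalars, length_le_X, pebbles_lt_X, partialSum_le_X, β_le_X, digits_le_X, N_le_X,
        N_mul_N_le_X, n_mul_n_le_X]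

theorem n_pos : 0 < I.n := (Nat.zero_le _).trans_lt I.s_lt

theorem N_pos : 0 < I.N := by
  have := I.two_le_β
  have := I.β_le_N
  omega

theorem computes_levels : Computes X
    (fun I => memory (I.ctx (I.edgeArray (3 * I.m)) (I.powers I.digits) 0 0 I.scalars) ![] 0)
    (fun I => memory (I.searchCtx 0) ![] 0) := by
  classical
  refine (Computes.layers (X := X) 4 (by norm_num) _ (fun I => rfl) (fun I => I.n * I.n) n
    (fun I => n_pos) (fun I => bounded_ctx (edgeArray_le_X _) (powers_le_X le_rfl)
      (fun _ => Nat.zero_le _) (fun _ => Nat.zero_le _) scalars_le_X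
      (fun _ => by simpa using n_mul_n_le_X)) (f := fun c => c.arr 6 7) (sz := fun c => c.nat 0)
    (Term.arr 6 (by norm_num) (.const 7)) (fun I g => rfl) (fun ℓ => Term.inp 0 (by norm_num))
    (fun I g => rfl) (fun X c ρ h => h.nat 0) (P := fun _ _ => True) (Q := edgeFormula)
    ((Decides.eq (.const 0) (.const 0)).congr (fun _ _ => by simp)) decides_edgeFormula
    (fun _ _ => True) (fun I u v => (u, v) ∈ I.M.G.edges) (fun _ _ _ => Iff.rfl)
    (fun I g u v => edgeFormula_iff rfl rfl)).congr (fun _ => rfl) (fun I => ?_)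
  rw [ctx_set_four]
  rfl

/-- The searched codes, layer by layer. -/
def Found (I : Instance) (z x : ℕ) : Prop :=
  layer (initFormula (I.searchCtx 0)) (stepFormula (I.searchCtx 0)) I.N z x

open Classical in
/-- The table of the search. -/
noncomputable def table (I : Instance) (j : ℕ) : ℕ :=
  if j < I.N * I.N ∧ I.Found (j / I.N) (j % I.N) then 1 else 0

theorem table_le_X (j : ℕ) : I.table j ≤ I.X := by
  have := I.two_le_X
  unfold table
  split_ifs <;> omega

theorem bounded_searchCtx {T : ℕ → ℕ} (hT : ∀ j, T j ≤ I.X) {ℓ : ℕ} {ρ : Fin ℓ → ℕ}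
    (hρ : ∀ i, ρ i ≤ I.X) : Bounded I.X (I.searchCtx T) ρ :=
  bounded_ctx (edgeArray_le_X _) (powers_le_X le_rfl) levels_le_X hT scalars_le_X hρ

theorem searchCtx_set (T g : ℕ → ℕ) : (I.searchCtx T).set 5 g = I.searchCtx g :=
  ctx_set_five _

theorem computes_search : Computes X (fun I => memory (I.searchCtx 0) ![] 0)
    (fun I => memory (I.searchCtx I.table) ![] 0) := by
  classical
  refine (Computes.layers (X := X) 5 (by norm_num) _ (fun I => rfl) (fun I => I.N * I.N) N
    (fun I => N_pos) (fun I => bounded_searchCtx (fun _ => Nat.zero_le _)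
      (fun _ => by simpa using N_mul_N_le_X)) (f := fun c => c.arr 6 6) (sz := fun c => c.arr 6 5)
    (Term.arr 6 (by norm_num) (.const 6)) (fun I g => rfl)
    (fun ℓ => Term.arr 6 (by norm_num) (.const 5))
    (fun I g => rfl) (fun X c ρ h => h.arr 6 5) (P := initFormula) (Q := stepFormula)
    decides_initFormula decides_stepFormula (fun I => initFormula (I.searchCtx 0))
    (fun I => stepFormula (I.searchCtx 0)) (fun I g x => ?_) (fun I g x y => ?_)).congr
    (fun _ => rfl) (fun I => ?_)
  -- The formulas do not read array `5`, so the table under construction does not affect their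
  -- truth.
  · rw [searchCtx_set]; exact Iff.rfl
  · rw [searchCtx_set]; exact Iff.rfl
  · rw [searchCtx_set]
    rfl

/-- The last layer contains the code of a final position. -/
def Succeeds (I : Instance) : Prop :=
  ∃ x, x < I.N ∧ (I.Found (I.N - 1) x ∧ finalFormula (I.searchCtx 0) x)

/-- The last row, number `N - 1`, starts at `N * N - N`. -/
theorem table_eq_one {x : ℕ} (hx : x < I.N) :
    I.table (I.N * I.N - I.N + x) = 1 ↔ I.Found (I.N - 1) x := by
  have hN := I.N_pos
  have h0 : I.N * I.N - I.N = I.N * (I.N - 1) := by rw [Nat.mul_sub, mul_one]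
  have h1 : I.N * I.N - I.N + x < I.N * I.N := by
    have : I.N ≤ I.N * I.N := Nat.le_mul_of_pos_left _ hN
    omega
  have h2 : (I.N * (I.N - 1) + x) / I.N = I.N - 1 := by
    rw [Nat.mul_add_div hN, Nat.div_eq_of_lt hx, add_zero]
  have h3 : (I.N * (I.N - 1) + x) % I.N = x := by
    rw [Nat.mul_add_mod, Nat.mod_eq_of_lt hx]
  rw [h0] at h1 ⊢
  simp [table, h1, h2, h3]

theorem succeeds_iff : I.Succeeds ↔ I.M.HasSimpleMotivatingSubgraph I.k := by
  obtain ⟨lev, hlev, hlevn, hlayer⟩ := I.M.exists_lev I.verts_eq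
  have hstep : stepFormula (I.searchCtx 0) =
      I.M.CodeStep I.n I.w lev (I.k' + 1) I.position := by
    funext x y
    exact propext (stepFormula_iff hlevn hlayer)
  -- The machine added up the whole edge list, endpoints included; an upper bound for the total
  -- weight is all that the base of the codes needs.
  have hsum : ∑ e ∈ I.M.G.edges, I.w e ≤ I.partialSum (3 * I.m) := by
    have hsub : ∀ (es : List (ℕ × ℕ)), (es.map I.w).sum ≤
        (es.flatMap (fun e => [e.1, e.2, I.w e])).sum := fun es => by
      induction es with
      | nil => simp
      | cons a es ih => simp; omega
    have h1 : ∑ e ∈ I.M.G.edges, I.w e = (I.es.map I.w).sum := by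
      rw [← I.edges_eq, List.sum_toFinset _ I.nodup]
    have h2 : ∀ l : List ℕ, l.sum = ∑ i ∈ Finset.range l.length, l.getD i 0 := fun l => by
      induction l with
      | nil => simp
      | cons a l ih => rw [List.sum_cons, List.length_cons, Finset.sum_range_succ', ih]; simp [add_comm]
    rw [h1, partialSum]
    refine (hsub _).trans (le_of_eq ?_)
    rw [h2]
    refine Finset.sum_congr ?_ (fun i _ => (nat_edges (I := I) i).symm)
    simp [m, mul_comm]
  have key := PlanningModel.hasSimpleMotivatingSubgraph_iff_layer (k := I.k') (β := I.β)
    (P := I.powers I.digits) I.verts_eq I.weight_eq hlev hlevn (by unfold β; omega)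
    (by have := I.n_pos; unfold β; omega) (by unfold β; omega)
    (fun i hi => if_pos (by unfold digits; omega))
  rw [← PlanningModel.hasSimpleMotivatingSubgraph_min (k := I.k), I.verts_eq, Finset.card_range,
    ← k'_eq, key, Succeeds]
  unfold Found
  rw [hstep]
  rfl

open Classical in
theorem computes_answer : Computes X (fun I => I.input)
    (fun I => memory (I.searchCtx I.table) ![] (if I.Succeeds then 1 else 0)) := by
  have hX : ∀ I : Instance, 2 ≤ I.X := fun I => two_le_X
  have hdec : Decides 0 (fun c _ => ∃ x, x < c.arr 6 5 ∧
      (c.arr 5 (c.arr 6 6 - c.arr 6 5 + x) = 1 ∧ finalFormula c x)) := by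
    refine Decides.ex (.arr 6 (by norm_num) (.const 5)) (fun X c ρ h => h.arr _ _)
      ((Decides.eq (.arr 5 (by norm_num) (.add (.sub (.arr 6 (by norm_num) (.const 6))
        (.arr 6 (by norm_num) (.const 5))) (.var _))) (.const 1)).and decides_finalFormula)
  refine (((computes_scalars.trans hX computes_levels).trans hX computes_search).trans hX
    ((hdec.comp fun I : Instance => (⟨I.X, I.searchCtx I.table, ![],
      bounded_searchCtx table_le_X (fun i => i.elim0)⟩ : Snapshot 0)).congr (fun _ => rfl)
        (fun I => ?_)))
  have : (∃ x, x < I.N ∧ (I.table (I.N * I.N - I.N + x) = 1 ∧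
      finalFormula (I.searchCtx I.table) x)) ↔ I.Succeeds :=
    exists_congr fun x => and_congr_right fun hx => and_congr (table_eq_one hx) Iff.rfl
  refine congrArg (memory _ _) ?_
  by_cases h : I.Succeeds
  · exact (if_pos (this.2 h)).trans (if_pos h).symm
  · exact (if_neg (mt this.1 h)).trans (if_neg h).symm

/-! ### The running time -/

theorem m_le : I.m ≤ I.n * I.n := by
  have h : I.M.G.edges ⊆ Finset.range I.n ×ˢ Finset.range I.n := fun e he => by
    simpa using edge_lt he
  calc I.m = I.es.toFinset.card := (List.toFinset_card_of_nodup I.nodup).symm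
    _ ≤ (Finset.range I.n ×ˢ Finset.range I.n).card := by
      rw [I.edges_eq]; exact Finset.card_le_card h
    _ = I.n * I.n := by simp

theorem nat_edges_le {A : ℕ} (hn : I.n ≤ A) (hw : ∑ e ∈ I.M.G.edges, I.w e ≤ A) (i : ℕ) :
    I.input.nat (5 + i) ≤ A := by
  rw [nat_edges]
  by_cases hi : i < (I.es.flatMap (fun e => [e.1, e.2, I.w e])).length
  · rw [List.getD_eq_getElem _ _ hi]
    obtain ⟨e, he, hx⟩ := List.mem_flatMap.1 (List.getElem_mem hi)
    rw [← List.mem_toFinset, I.edges_eq] at he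
    have h1 := edge_lt he
    have h2 : I.w e ≤ ∑ e ∈ I.M.G.edges, I.w e :=
      Finset.single_le_sum (f := I.w) (fun _ _ => Nat.zero_le _) he
    simp only [List.mem_cons, List.not_mem_nil, or_false] at hx
    omega
  · rw [List.getD_eq_default _ _ (by omega)]
    exact Nat.zero_le _

/-- With `A` the base on the right and `κ = max 1 k`: the list has at most `A ^ 4` numbers of at
most `A`, so `β ≤ A ^ 7`. The number of digits is at most `2 k + 3 ≤ 5 κ`, so `N ≤ A ^ (35 κ)`. The
dominant summand `N * N` is at most `A ^ (70 κ)`, and a factor `16 ≤ A ^ (4 κ)` covers the sum. -/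
theorem X_le : I.X ≤
    (max 2 (I.n * max 1 (∑ e ∈ I.M.G.edges, I.w e))) ^ (74 * max 1 I.k) := by
  have hn0 := I.n_pos
  have hnA : I.n ≤ max 2 (I.n * max 1 (∑ e ∈ I.M.G.edges, I.w e)) :=
    (Nat.le_mul_of_pos_right _ (by omega)).trans (le_max_right _ _)
  have hwA : ∑ e ∈ I.M.G.edges, I.w e ≤ max 2 (I.n * max 1 (∑ e ∈ I.M.G.edges, I.w e)) :=
    (le_max_right 1 _).trans ((Nat.le_mul_of_pos_left _ hn0).trans (le_max_right _ _))
  have hA : 2 ≤ max 2 (I.n * max 1 (∑ e ∈ I.M.G.edges, I.w e)) := le_max_left _ _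
  generalize max 2 (I.n * max 1 (∑ e ∈ I.M.G.edges, I.w e)) = A at hnA hwA hA ⊢
  generalize hκ : max 1 I.k = κ
  have hκ1 : 1 ≤ κ := hκ ▸ le_max_left _ _
  have hkκ : I.k ≤ κ := hκ ▸ le_max_right _ _
  have hA0 : 0 < A := by omega
  have hm : I.m ≤ A ^ 2 := I.m_le.trans ((Nat.mul_le_mul hnA hnA).trans_eq (sq A).symm)
  have hm3 : 3 * I.m ≤ A ^ 4 := by
    calc 3 * I.m ≤ A ^ 2 * A ^ 2 := Nat.mul_le_mul (by nlinarith) hm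
      _ = A ^ 4 := by ring
  have hpart : I.partialSum (3 * I.m) ≤ A ^ 5 := by
    calc I.partialSum (3 * I.m) ≤ ∑ _i ∈ Finset.range (3 * I.m), A :=
          Finset.sum_le_sum fun i _ => nat_edges_le hnA hwA i
      _ = 3 * I.m * A := by simp
      _ ≤ A ^ 4 * A := Nat.mul_le_mul_right _ hm3
      _ = A ^ 5 := by ring
  have hβ : I.β ≤ A ^ 7 := by
    have h1 : A ≤ A ^ 5 := Nat.le_self_pow (by norm_num) _
    have h2 : I.k' ≤ I.n := by rw [k'_eq]; exact min_le_right _ _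
    calc I.β ≤ 4 * A ^ 5 := by unfold β; omega
      _ ≤ A ^ 2 * A ^ 5 := Nat.mul_le_mul_right _ (by nlinarith)
      _ = A ^ 7 := by ring
  have hdig : I.digits ≤ 5 * κ := by
    have h2 : I.k' ≤ I.k := by rw [k'_eq]; exact min_le_left _ _
    unfold digits
    omega
  have hN : I.N ≤ A ^ (35 * κ) := by
    calc I.β ^ I.digits ≤ (A ^ 7) ^ I.digits := Nat.pow_le_pow_left hβ _
      _ ≤ (A ^ 7) ^ (5 * κ) := Nat.pow_le_pow_right (by positivity) hdig
      _ = A ^ (35 * κ) := by rw [← pow_mul]; congr 1; ring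
  have hNN : I.N * I.N ≤ A ^ (70 * κ) := by
    calc I.N * I.N ≤ A ^ (35 * κ) * A ^ (35 * κ) := Nat.mul_le_mul hN hN
      _ = A ^ (70 * κ) := by rw [← pow_add]; congr 1; ring
  have hpow : ∀ {a : ℕ}, a ≤ 70 * κ → A ^ a ≤ A ^ (70 * κ) := Nat.pow_le_pow_right hA0
  have hk : I.k ≤ A ^ (70 * κ) :=
    hkκ.trans ((Nat.lt_pow_self (by omega : 1 < A)).le.trans (hpow (by omega)))
  have hnβ : I.n ≤ I.β := by unfold β; omega
  have hβN := I.β_le_N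
  have hNN' : I.N ≤ I.N * I.N := Nat.le_mul_of_pos_left _ I.N_pos
  have hdN : I.digits ≤ I.N := (Nat.lt_pow_self (by have := I.two_le_β; omega)).le
  have hnn : I.n * I.n ≤ I.N * I.N := Nat.mul_le_mul (hnβ.trans hβN) (hnβ.trans hβN)
  have h2 := I.two_le_β
  have hm4 := hm3.trans (hpow (by omega))
  calc I.X ≤ 16 * A ^ (70 * κ) := by unfold X; omega
    _ ≤ A ^ (4 * κ) * A ^ (70 * κ) := Nat.mul_le_mul_right _ <| by
      calc 16 = 2 ^ 4 := by norm_num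
        _ ≤ A ^ 4 := Nat.pow_le_pow_left hA _
        _ ≤ A ^ (4 * κ) := Nat.pow_le_pow_right hA0 (by omega)
    _ = A ^ (74 * κ) := by rw [← pow_add]; congr 1; ring

end Instance

end RealRAM

theorem theorem2 :
    ∃ (p : RealRAM.Prog) (c : ℕ),
      ∀ (M : PlanningModel ℕ) (n : ℕ) (w : ℕ × ℕ → ℕ) (es : List (ℕ × ℕ)) (k W : ℕ),
        M.G.verts = Finset.range n →
        (∀ e ∈ M.G.edges, M.w e = (w e : NNReal)) →
        W = ∑ e ∈ M.G.edges, w e →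
        es.Nodup → es.toFinset = M.G.edges →
        ∃ (τ : RealRAM.State) (T : ℕ),
          RealRAM.Exec p (M.input n w es k) τ T ∧
          T ≤ (max 2 (n * max 1 W)) ^ (c * max 1 k) ∧
          (M.HasSimpleMotivatingSubgraph k → τ.nat 0 = 1) ∧
          (¬ M.HasSimpleMotivatingSubgraph k → τ.nat 0 = 0) := by
  classical
  -- A last instruction copies the flag into register `0`, overwriting `n`.
  obtain ⟨p, q, h⟩ := RealRAM.Instance.computes_answer.trans (fun I => RealRAM.Instance.two_le_X)
    (RealRAM.Computes.setNat (fun I => RealRAM.Instance.two_le_X)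
      (fun I => (RealRAM.Instance.bounded_searchCtx RealRAM.Instance.table_le_X
        (fun i => i.elim0)).memory_le (by split_ifs <;> norm_num)) (.const 0) RealRAM.flagExp)
  refine ⟨p, 74 * q, ?_⟩
  rintro M n w es k W hn hw rfl hes hE
  let I : RealRAM.Instance := ⟨M, n, w, es, k, hn, hw, hes, hE⟩
  obtain ⟨T, hT, hexec⟩ := h I
  refine ⟨_, T, hexec, ?_, fun hyes => ?_, fun hno => ?_⟩
  · refine (hT.trans (Nat.pow_le_pow_left I.X_le q)).trans (le_of_eq ?_)
    rw [← pow_mul]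
    congr 1
    ring
  · simp [RealRAM.flagExp_eval, RealRAM.NatExp.eval, I.succeeds_iff.2 hyes]
  · have : ¬ I.Succeeds := fun hc => hno (I.succeeds_iff.1 hc)
    simp [RealRAM.flagExp_eval, RealRAM.NatExp.eval, this]
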